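/- Let $R$ be a Dedekind domain that is not a field. A lattice of rank $n$ over $R$ is a finitely generated projective $R$-module of rank $n$, and a quintic ring over $R$ is a commutative $R$-algebra (with unit) that is a lattice of rank $5$ as an $R$-module. For a quintic ring $Q$, put $L = Q/R$, a lattice of rank $4$. For a lattice $M$ of rank $5$, let $\mu \mapsto \mu^\square$ be the quadratic map $\Lambda^2 M \to \Lambda^4 M$ given by $\bigl(\sum_i v_i \wedge w_i\bigr)^\square = \sum_{i<j} v_i \wedge w_i \wedge v_j \wedge w_j$, and for $\mu \in \Lambda^2 M$ and $\alpha, \beta \in \Lambda^4 M$ let $\mu(\alpha,\beta) \in (\Lambda^5 M)^{\otimes 2}$ be the contraction, linear in $\mu$, with $(v \wedge w)(\alpha,\beta) = (\alpha \wedge v)\otimes(\beta \wedge w) - (\alpha \wedge w)\otimes(\beta \wedge v)$. A resolvent of $Q$ is a triple $(M,\phi,\theta)$ consisting of a lattice $M$ of rank $5$ and $R$-linear maps $\phi : \Lambda^4 L \otimes L \to \Lambda^2 M$ and $\theta : \Lambda^5 M \to (\Lambda^4 L)^{\otimes 3}$ such that $$\theta^{\otimes 2}\bigl[\phi(\lambda_1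 \otimes x)\bigl(\phi(\lambda_2 \otimes y)^\square, \phi(\lambda_3 \otimes z)^\square\bigr)\bigr] = \lambda_1 \lambda_2^2 \lambda_3^2\,(x \wedge y \wedge z \wedge yz) \quad \text{in } (\Lambda^4 L)^{\otimes 6}$$ for all $x,y,z \in L$ and $\lambda_1,\lambda_2,\lambda_3 \in \Lambda^4 L$, where $yz$ is the class in $L$ of the product of any lifts of $y$ and $z$ to $Q$ (the right-hand side does not depend on the lifts). It is numerical if $\theta$ is an isomorphism. Two resolvents $(M,\phi,\theta)$ and $(M',\phi',\theta')$ of $Q$ are isomorphic if there is an $R$-linear isomorphism $f : M \to M'$ with $\Lambda^2 f \circ \phi = \phi'$ and $\theta' \circ \Lambda^5 f = \theta$. Theorem. Let $Q$ be a maximal quintic ring over $R$, that is, a quintic ring such that every injective $R$-algebra homomorphism from $Q$ to a quintic ring over $R$ is an isomorphism. Then $Q$ has a resolvent, it is unique up to isomorphism, and it is numerical. -/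

import Mathlib

open scoped TensorProduct

universe u v w w₁ w₂

noncomputable section

namespace QuinticResolvent

section Multilinear

variable {R : Type u} [CommRing R] {M : Type w} [AddCommGroup M] [Module R M]

/-- The exterior product `⋀^a M × ⋀^b M → ⋀^(a+b) M`. -/
def wedge {a b : ℕ} (α : ⋀[R]^a M) (β : ⋀[R]^b M) : ⋀[R]^(a + b) M :=
  ⟨(α : ExteriorAlgebra R M) * (β : ExteriorAlgebra R M), by
    rw [ExteriorAlgebra.exteriorPower, pow_add]
    exact Submodule.mul_mem_mul α.2 β.2⟩

/-- The decomposable 2-vector `x ∧ y`. -/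
def wedge₂ (x y : M) : ⋀[R]^2 M := exteriorPower.ιMulti R 2 ![x, y]

/-- The decomposable 4-vector `x ∧ y ∧ z ∧ t`. -/
def wedge₄ (x y z t : M) : ⋀[R]^4 M := exteriorPower.ιMulti R 4 ![x, y, z, t]

theorem coe_wedge₂ (x y : M) : ((wedge₂ x y : ⋀[R]^2 M) : ExteriorAlgebra R M) =
    ExteriorAlgebra.ι R x * ExteriorAlgebra.ι R y := by
  simp [wedge₂, ExteriorAlgebra.ιMulti_apply]

theorem ι_mul_ι_swap (x y : M) : ExteriorAlgebra.ι R x * ExteriorAlgebra.ι R y =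
    -(ExteriorAlgebra.ι R y * ExteriorAlgebra.ι R x) :=
  eq_neg_of_add_eq_zero_left (ExteriorAlgebra.ι_add_mul_swap x y)

/-- 2-vectors commute with vectors. -/
theorem two_vector_mul_ι (μ : ⋀[R]^2 M) (t : M) :
    (μ : ExteriorAlgebra R M) * ExteriorAlgebra.ι R t =
      ExteriorAlgebra.ι R t * (μ : ExteriorAlgebra R M) := by
  have h : (μ : ExteriorAlgebra R M) ∈
      LinearMap.range (ExteriorAlgebra.ι R : M →ₗ[R] _) *
        LinearMap.range (ExteriorAlgebra.ι R : M →ₗ[R] _) := pow_two (LinearMap.range (ExteriorAlgebra.ι R : M →ₗ[R] _)) ▸ μ.2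
  refine Submodule.mul_induction_on h ?_ ?_
  · rintro _ ⟨x, rfl⟩ _ ⟨y, rfl⟩
    rw [mul_assoc, ι_mul_ι_swap y t, mul_neg, ← mul_assoc, ι_mul_ι_swap x t]
    simp [mul_assoc]
  · intro a b iha ihb
    rw [add_mul, mul_add, iha, ihb]

/-- 2-vectors commute with each other. -/
theorem two_vector_comm (μ ν : ⋀[R]^2 M) :
    (μ : ExteriorAlgebra R M) * (ν : ExteriorAlgebra R M) =
      (ν : ExteriorAlgebra R M) * (μ : ExteriorAlgebra R M) := by
  have h : (ν : ExteriorAlgebra R M) ∈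
      LinearMap.range (ExteriorAlgebra.ι R : M →ₗ[R] _) *
        LinearMap.range (ExteriorAlgebra.ι R : M →ₗ[R] _) := pow_two (LinearMap.range (ExteriorAlgebra.ι R : M →ₗ[R] _)) ▸ ν.2
  refine Submodule.mul_induction_on h ?_ ?_
  · rintro _ ⟨x, rfl⟩ _ ⟨y, rfl⟩
    rw [← mul_assoc, two_vector_mul_ι, mul_assoc, two_vector_mul_ι, mul_assoc]
  · intro a b iha ihb
    rw [add_mul, mul_add, iha, ihb]

theorem wedge_comm_two (μ ν : ⋀[R]^2 M) : wedge μ ν = wedge ν μ :=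
  Subtype.ext (two_vector_comm μ ν)

theorem wedge_add_left {a b : ℕ} (α α' : ⋀[R]^a M) (β : ⋀[R]^b M) :
    wedge (α + α') β = wedge α β + wedge α' β :=
  Subtype.ext (add_mul _ _ _)

theorem wedge_add_right {a b : ℕ} (α : ⋀[R]^a M) (β β' : ⋀[R]^b M) :
    wedge α (β + β') = wedge α β + wedge α β' :=
  Subtype.ext (mul_add _ _ _)

theorem wedge_smul_left {a b : ℕ} (r : R) (α : ⋀[R]^a M) (β : ⋀[R]^b M) :
    wedge (r • α) β = r • wedge α β :=
  Subtype.ext (smul_mul_assoc _ _ _)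

theorem wedge_smul_right {a b : ℕ} (r : R) (α : ⋀[R]^a M) (β : ⋀[R]^b M) :
    wedge α (r • β) = r • wedge α β :=
  Subtype.ext (mul_smul_comm _ _ _)

/-- `v ∧ w ∧ v' ∧ w = 0`. -/
theorem wedge_wedge₂_right (x x' y : M) :
    wedge (wedge₂ x y : ⋀[R]^2 M) (wedge₂ x' y : ⋀[R]^2 M) = 0 := by
  apply Subtype.ext
  change ((wedge₂ x y : ⋀[R]^2 M) : ExteriorAlgebra R M) *
    ((wedge₂ x' y : ⋀[R]^2 M) : ExteriorAlgebra R M) = 0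
  rw [coe_wedge₂ x' y, ← mul_assoc, two_vector_mul_ι, coe_wedge₂, mul_assoc, mul_assoc,
    ExteriorAlgebra.ι_sq_zero, mul_zero, mul_zero]

/-- `v ∧ w ∧ v ∧ w' = 0`. -/
theorem wedge_wedge₂_left (x y y' : M) :
    wedge (wedge₂ x y : ⋀[R]^2 M) (wedge₂ x y' : ⋀[R]^2 M) = 0 := by
  apply Subtype.ext
  change ((wedge₂ x y : ⋀[R]^2 M) : ExteriorAlgebra R M) *
    ((wedge₂ x y' : ⋀[R]^2 M) : ExteriorAlgebra R M) = 0
  rw [coe_wedge₂ x y', ← mul_assoc, two_vector_mul_ι, coe_wedge₂, ← mul_assoc,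
    ExteriorAlgebra.ι_sq_zero, zero_mul, zero_mul]

variable (R M) in
/-- Auxiliary module used to construct the quadratic map `μ ↦ μ^□`: the pairs `(μ, α)` in
`⋀² M × ⋀⁴ M` with `2 α = μ ∧ μ`, under the addition
`(μ, α) + (ν, β) = (μ + ν, α + β + μ ∧ ν)` and the scalar action `r (μ, α) = (r μ, r² α)`. -/
@[ext] structure SquarePair where
  fst : ⋀[R]^2 M
  snd : ⋀[R]^4 M
  two_smul_snd : (2 : R) • snd = (wedge fst fst : ⋀[R]^(2 + 2) M)

namespace SquarePair

instance : Zero (SquarePair R M) :=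
  ⟨⟨0, 0, by rw [smul_zero]; exact (Subtype.ext (mul_zero _)).symm⟩⟩

instance : Add (SquarePair R M) :=
  ⟨fun p q => ⟨p.fst + q.fst, p.snd + q.snd + (wedge p.fst q.fst : ⋀[R]^(2 + 2) M), by
    have h := wedge_comm_two p.fst q.fst
    rw [wedge_add_left, wedge_add_right, wedge_add_right, ← h, ← p.two_smul_snd,
      ← q.two_smul_snd]
    module⟩⟩

instance : Neg (SquarePair R M) :=
  ⟨fun p => ⟨-p.fst, p.snd, by
    rw [p.two_smul_snd]; exact Subtype.ext (neg_mul_neg _ _).symm⟩⟩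

instance : SMul R (SquarePair R M) :=
  ⟨fun r p => ⟨r • p.fst, (r ^ 2) • p.snd, by
    rw [wedge_smul_left, wedge_smul_right, ← p.two_smul_snd]
    module⟩⟩

@[simp] theorem zero_fst : (0 : SquarePair R M).fst = 0 := rfl
@[simp] theorem zero_snd : (0 : SquarePair R M).snd = 0 := rfl
@[simp] theorem add_fst (p q : SquarePair R M) : (p + q).fst = p.fst + q.fst := rfl
@[simp] theorem add_snd (p q : SquarePair R M) :
    (p + q).snd = p.snd + q.snd + (wedge p.fst q.fst : ⋀[R]^(2 + 2) M) := rfl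
@[simp] theorem neg_fst (p : SquarePair R M) : (-p).fst = -p.fst := rfl
@[simp] theorem neg_snd (p : SquarePair R M) : (-p).snd = p.snd := rfl
@[simp] theorem smul_fst (r : R) (p : SquarePair R M) : (r • p).fst = r • p.fst := rfl
@[simp] theorem smul_snd (r : R) (p : SquarePair R M) : (r • p).snd = (r ^ 2) • p.snd := rfl

theorem wedge_zero_left {a b : ℕ} (β : ⋀[R]^b M) : wedge (0 : ⋀[R]^a M) β = 0 :=
  Subtype.ext (zero_mul _)

theorem wedge_zero_right {a b : ℕ} (α : ⋀[R]^a M) : wedge α (0 : ⋀[R]^b M) = 0 :=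
  Subtype.ext (mul_zero _)

theorem wedge_neg_left {a b : ℕ} (α : ⋀[R]^a M) (β : ⋀[R]^b M) :
    wedge (-α) β = -wedge α β :=
  Subtype.ext (neg_mul _ _)

instance : AddCommGroup (SquarePair R M) where
  add_assoc p q r := by
    ext1
    · exact add_assoc _ _ _
    · simp only [add_snd, add_fst, wedge_add_left, wedge_add_right]
      abel
  zero_add p := by
    ext1
    · exact zero_add _
    · simp only [add_snd, zero_fst, zero_snd, wedge_zero_left, zero_add]
      exact add_zero _
  add_zero p := by
    ext1
    · exact add_zero _
    · simp only [add_snd, zero_fst, zero_snd, wedge_zero_right, add_zero]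
  nsmul := nsmulRec
  zsmul := zsmulRec
  neg_add_cancel p := by
    ext1
    · exact neg_add_cancel _
    · simp only [add_snd, neg_fst, neg_snd, zero_snd, wedge_neg_left, ← p.two_smul_snd]
      module
  add_comm p q := by
    ext1
    · exact add_comm _ _
    · simp only [add_snd, wedge_comm_two p.fst q.fst]
      abel

instance : Module R (SquarePair R M) where
  one_smul p := by
    ext1
    · exact one_smul _ _
    · simp
  mul_smul r s p := by
    ext1
    · exact mul_smul _ _ _
    · simp only [smul_snd]
      module
  smul_zero r := by
    ext1
    · exact smul_zero _
    · simp
  smul_add r p q := by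
    ext1
    · exact smul_add _ _ _
    · simp only [smul_snd, add_snd, smul_fst, wedge_smul_left, wedge_smul_right]
      module
  add_smul r s p := by
    ext1
    · exact add_smul _ _ _
    · simp only [smul_snd, add_snd, smul_fst, wedge_smul_left, wedge_smul_right,
        ← p.two_smul_snd]
      module
  zero_smul p := by
    ext1
    · exact zero_smul _ _
    · simp

end SquarePair

theorem wedge₂_add_left (x x' y : M) :
    (wedge₂ (x + x') y : ⋀[R]^2 M) = wedge₂ x y + wedge₂ x' y :=
  Subtype.ext (by
    rw [Submodule.coe_add]
    simp only [coe_wedge₂, map_add, add_mul])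

theorem wedge₂_add_right (x y y' : M) :
    (wedge₂ x (y + y') : ⋀[R]^2 M) = wedge₂ x y + wedge₂ x y' :=
  Subtype.ext (by
    rw [Submodule.coe_add]
    simp only [coe_wedge₂, map_add, mul_add])

theorem wedge₂_smul_left (r : R) (x y : M) :
    (wedge₂ (r • x) y : ⋀[R]^2 M) = r • wedge₂ x y :=
  Subtype.ext (by
    rw [Submodule.coe_smul]
    simp only [coe_wedge₂, map_smul, smul_mul_assoc])

theorem wedge₂_smul_right (r : R) (x y : M) :
    (wedge₂ x (r • y) : ⋀[R]^2 M) = r • wedge₂ x y :=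
  Subtype.ext (by
    rw [Submodule.coe_smul]
    simp only [coe_wedge₂, map_smul, mul_smul_comm])

theorem wedge₂_self (x : M) : (wedge₂ x x : ⋀[R]^2 M) = 0 :=
  Subtype.ext (by
    rw [Submodule.coe_zero, coe_wedge₂, ExteriorAlgebra.ι_sq_zero])

/-- A bilinear alternating function of two vectors, as an alternating map on `Fin 2 → M`. -/
def alternatingOfTwo {N : Type*} [AddCommGroup N] [Module R N] (f : M → M → N)
    (add_left : ∀ x x' y, f (x + x') y = f x y + f x' y)
    (add_right : ∀ x y y', f x (y + y') = f x y + f x y')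
    (smul_left : ∀ (r : R) x y, f (r • x) y = r • f x y)
    (smul_right : ∀ (r : R) x y, f x (r • y) = r • f x y)
    (self : ∀ x, f x x = 0) : M [⋀^Fin 2]→ₗ[R] N where
  toFun m := f (m 0) (m 1)
  map_update_add' m i x y := by
    fin_cases i
    · simp [add_left]
    · simp [add_right]
  map_update_smul' m i c x := by
    fin_cases i
    · simp [smul_left]
    · simp [smul_right]
  map_eq_zero_of_eq' m i j h hij := by
    have h01 : m 0 = m 1 := by
      fin_cases i <;> fin_cases j <;> simp_all
    rw [h01, self]

variable (R M) in
/-- The alternating map `(v, w) ↦ (v ∧ w, 0)`. -/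
def squarePairAlternating : M [⋀^Fin 2]→ₗ[R] SquarePair R M :=
  alternatingOfTwo
    (fun v w => ⟨wedge₂ v w, 0, by rw [wedge_wedge₂_right, smul_zero]⟩)
    (fun x x' y => by
      ext1
      · exact wedge₂_add_left x x' y
      · simp [wedge_wedge₂_right])
    (fun x y y' => by
      ext1
      · exact wedge₂_add_right x y y'
      · simp [wedge_wedge₂_left])
    (fun r x y => by
      ext1
      · exact wedge₂_smul_left r x y
      · simp)
    (fun r x y => by
      ext1
      · exact wedge₂_smul_right r x y
      · simp)
    (fun x => by
      ext1
      · exact wedge₂_self x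
      · simp)

/-- The quadratic map `μ ↦ μ^□` from `⋀² M` to `⋀⁴ M`, that is
`(∑ᵢ vᵢ ∧ wᵢ)^□ = ∑_{i<j} vᵢ ∧ wᵢ ∧ vⱼ ∧ wⱼ`; equivalently, `(v ∧ w)^□ = 0` and
`(μ + ν)^□ = μ^□ + ν^□ + μ ∧ ν` (see `square_wedge₂`, `square_add`). -/
def square (μ : ⋀[R]^2 M) : ⋀[R]^4 M :=
  (exteriorPower.alternatingMapLinearEquiv (squarePairAlternating R M) μ).snd

theorem square_wedge₂ (v w : M) : square (wedge₂ v w : ⋀[R]^2 M) = 0 := by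
  rw [square, wedge₂, exteriorPower.alternatingMapLinearEquiv_apply_ιMulti]
  rfl

theorem squarePair_fst (μ : ⋀[R]^2 M) :
    (exteriorPower.alternatingMapLinearEquiv (squarePairAlternating R M) μ).fst = μ := by
  let p : SquarePair R M →ₗ[R] ⋀[R]^2 M :=
    { toFun := SquarePair.fst, map_add' := fun _ _ => rfl, map_smul' := fun _ _ => rfl }
  have h : p ∘ₗ exteriorPower.alternatingMapLinearEquiv (squarePairAlternating R M) =
      LinearMap.id := by
    apply exteriorPower.linearMap_ext
    ext m : 1
    simp only [LinearMap.compAlternatingMap_apply, LinearMap.comp_apply,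
      exteriorPower.alternatingMapLinearEquiv_apply_ιMulti, LinearMap.id_apply]
    change wedge₂ (m 0) (m 1) = _
    rw [wedge₂]
    congr 1
    ext i
    fin_cases i <;> rfl
  exact LinearMap.congr_fun h μ

theorem square_add (μ ν : ⋀[R]^2 M) :
    square (μ + ν) = square μ + square ν + (wedge μ ν : ⋀[R]^(2 + 2) M) := by
  simp only [square, map_add, SquarePair.add_snd, squarePair_fst]

/-- The linear map `v ↦ α ∧ v` from `M` to `⋀⁵ M` attached to `α` in `⋀⁴ M`. -/
def wedgeVec (α : ⋀[R]^4 M) : M →ₗ[R] ⋀[R]^5 M where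
  toFun v := ⟨(α : ExteriorAlgebra R M) * ExteriorAlgebra.ι R v, by
    rw [ExteriorAlgebra.exteriorPower, pow_succ]
    exact Submodule.mul_mem_mul α.2 ⟨v, rfl⟩⟩
  map_add' v w := Subtype.ext (by simp [mul_add])
  map_smul' r v := Subtype.ext (by simp)

/-- The contraction `μ(α, β)` in `(⋀⁵ M)^{⊗ 2}` of `μ` in `⋀² M` with `α, β` in `⋀⁴ M`, regarded
as the `⋀⁵ M`-valued linear forms `α ∧ ·` and `β ∧ ·`. It is linear in `μ`, and for `μ = v ∧ w`
it equals `(α ∧ v) ⊗ (β ∧ w) - (α ∧ w) ⊗ (β ∧ v)`. -/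
def contract (μ : ⋀[R]^2 M) (α β : ⋀[R]^4 M) : (⋀[R]^5 M) ⊗[R] (⋀[R]^5 M) :=
  exteriorPower.alternatingMapLinearEquiv
    (alternatingOfTwo
      (fun v w => wedgeVec α v ⊗ₜ[R] wedgeVec β w - wedgeVec α w ⊗ₜ[R] wedgeVec β v)
      (fun x x' y => by
        simp only [map_add, TensorProduct.add_tmul, TensorProduct.tmul_add]; abel)
      (fun x y y' => by
        simp only [map_add, TensorProduct.add_tmul, TensorProduct.tmul_add]; abel)
      (fun r x y => by
        simp only [map_smul, TensorProduct.smul_tmul', TensorProduct.tmul_smul, smul_sub])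
      (fun r x y => by
        simp only [map_smul, TensorProduct.smul_tmul', TensorProduct.tmul_smul, smul_sub])
      (fun x => sub_self _)) μ

end Multilinear

/-- A lattice of rank `n` over a domain `R`: a finitely generated projective module of rank `n`
(over a Dedekind domain, projective is the same as torsion-free here). -/
structure IsLattice (R : Type u) [CommRing R] (n : ℕ) (M : Type w) [AddCommGroup M]
    [Module R M] : Prop where
  finite : Module.Finite R M
  projective : Module.Projective R M
  finrank_eq : Module.finrank R M = n

/-- A quintic ring over `R`: a commutative `R`-algebra whose underlying module is a lattice of
rank `5`. -/
def IsQuinticRing (R : Type u) [CommRing R] (Q : Type v) [CommRing Q] [Algebra R Q] : Prop :=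
  IsLattice R 5 Q

/-- A quintic ring is maximal if it is not contained in any strictly larger quintic ring: each
embedding into a quintic ring is onto. -/
def IsMaximalQuinticRing (R : Type u) [CommRing R] (Q : Type v) [CommRing Q] [Algebra R Q] :
    Prop :=
  IsQuinticRing R Q ∧
    ∀ (Q' : Type v) [CommRing Q'] [Algebra R Q'], IsQuinticRing R Q' →
      ∀ f : Q →ₐ[R] Q', Function.Injective f → Function.Surjective f

/-- The module `L = Q / R`. -/
abbrev QuotMod (R : Type u) [CommRing R] (Q : Type v) [CommRing Q] [Algebra R Q] : Type v :=
  Q ⧸ LinearMap.range (Algebra.linearMap R Q)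

/-- The quotient map `Q → L = Q / R`. -/
abbrev quotMk (R : Type u) [CommRing R] {Q : Type v} [CommRing Q] [Algebra R Q] (x : Q) :
    QuotMod R Q :=
  Submodule.Quotient.mk x

/-- The module `⋀⁴ L`. -/
abbrev TopL (R : Type u) [CommRing R] (Q : Type v) [CommRing Q] [Algebra R Q] :
    Type (max u v) :=
  ⋀[R]^4 (QuotMod R Q)

/-- The module `(⋀⁴ L)^{⊗ 3}`. -/
abbrev TopLCube (R : Type u) [CommRing R] (Q : Type v) [CommRing Q] [Algebra R Q] :
    Type (max u v) :=
  TopL R Q ⊗[R] (TopL R Q ⊗[R] TopL R Q)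

/-- A resolvent `(M, φ, θ)` of `Q`. The identity, in `(⋀⁴ L)^{⊗ 6}`, is
`θ^{⊗ 2} [φ(λ₁ x)(φ(λ₂ y)^□, φ(λ₃ z)^□)] = λ₁ λ₂² λ₃² (x ∧ y ∧ z ∧ yz)`.
Since `⋀⁴ L` has rank one, the order of the six tensor factors is immaterial. The vectors
`x`, `y`, `z` of `L` are given by arbitrary lifts to `Q`. -/
structure Resolvent (R : Type u) [CommRing R] (Q : Type v) [CommRing Q] [Algebra R Q] where
  M : Type w
  [addCommGroup : AddCommGroup M]
  [module : Module R M]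
  isLattice : IsLattice R 5 M
  φ : TopL R Q ⊗[R] QuotMod R Q →ₗ[R] ⋀[R]^2 M
  θ : ⋀[R]^5 M →ₗ[R] TopLCube R Q
  identity : ∀ (l₁ l₂ l₃ : TopL R Q) (x y z : Q),
    TensorProduct.map θ θ
        (contract (φ (l₁ ⊗ₜ quotMk R x))
          (square (φ (l₂ ⊗ₜ quotMk R y))) (square (φ (l₃ ⊗ₜ quotMk R z)))) =
      (l₁ ⊗ₜ[R] (l₂ ⊗ₜ[R] l₂)) ⊗ₜ[R]
        (l₃ ⊗ₜ[R] (l₃ ⊗ₜ[R]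
          wedge₄ (quotMk R x) (quotMk R y) (quotMk R z) (quotMk R (y * z))))

attribute [instance] Resolvent.addCommGroup Resolvent.module

namespace Resolvent

variable {R : Type u} [CommRing R] {Q : Type v} [CommRing Q] [Algebra R Q]

/-- A resolvent is numerical if `θ` is an isomorphism. -/
def IsNumerical (X : Resolvent.{u, v, w} R Q) : Prop := Function.Bijective X.θ

/-- Two resolvents `(M, φ, θ)` and `(M', φ', θ')` of `Q` are isomorphic if there is an isomorphism
`M ≃ M'` that carries `φ` to `φ'` and `θ` to `θ'`. -/
def IsIsomorphic (X : Resolvent.{u, v, w₁} R Q) (Y : Resolvent.{u, v, w₂} R Q) : Prop :=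
  ∃ f : X.M ≃ₗ[R] Y.M,
    exteriorPower.map 2 f.toLinearMap ∘ₗ X.φ = Y.φ ∧
      Y.θ ∘ₗ exteriorPower.map 5 f.toLinearMap = X.θ

end Resolvent

end QuinticResolvent

end

noncomputable section
namespace QuinticResolvent

section

/-! ### Calculus of alternating four-forms. -/

section FourForm

variable {R M N : Type*} [CommRing R] [AddCommGroup M] [Module R M] [AddCommGroup N] [Module R N]
  (d : M [⋀^Fin 4]→ₗ[R] N)

/-! The resolvent module is found inside the problem. Let `N` be the module of quadratic maps `Q →
⋀⁴ L` spanned by the `z ↦ x ∧ y ∧ z ∧ y z` (`quadModule`). Once `N` is known to be a lattice of rank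
5, take `M = N`; each `y` in `Q` gives an evaluation `ev_y : M → ⋀⁴ L`. Two conditions then pin down
the rest: `φ (l ⊗ x)`, paired with `ev_y` and `ev_z`, is `l ⊗ (x ∧ y ∧ z ∧ y z)`
(`Realization.IsPhi`), and `θ (φ (l ⊗ y)^□ ∧ m) = l ⊗ l ⊗ m(y)` (`Realization.IsTheta`). Together
they imply the resolvent identity. Such a `φ` is possible because `x ∧ y ∧ z ∧ y z` is skew in `y`
and `z`, by commutativity of `Q`, and lies in `N` as a function of either.

Maximality enters through two facts. First, every maximal ideal of `Q` over a nonzero prime is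
locally principal (`IsMaximalQuinticRing.exists_local_generator`). So `Q / pQ` has a basis `1, s, t,
e, s t` in which `s²` has no `s t` component (`exists_generators`), and by Nakayama it lifts to `Q`
near `p`. Five functionals built from `s, t, e` then have an invertible matrix near `p` on five
suitable elements of `N`: its determinant is, up to a unit, the square of a Pfaffian that is a unit
because of the condition on `s²`. Second, `Q` is reduced, so its generic fiber carries a Frobenius
form, and there the span of the quadratic maps has dimension at most five (`finrank_span_wedge_le`).
Hence the five functionals are local coordinates on `N` (`PreFrame.ψ_smul`).

The map `θ` rests on a Pfaffian identity. In local coordinates `φ (l ⊗ y)` is a skew `5 × 5` matrix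
depending linearly on `y`, up to scalars. Since `y ∧ y = 0`, the coordinates of `ev_y` form a kernel
vector of it, hence are proportional to its `4 × 4` Pfaffians, and these are the coordinates of `φ
(l ⊗ y)^□`. The ratio is constant and a unit at `p` (`PreFrame.ψ_mul_pfaffians`), so `θ` exists and
is bijective. Local solutions glue because the scalars `r` for which `r φ` or `r θ` can be realized
form an ideal contained in no maximal ideal.

For uniqueness, send a vector `m` of an arbitrary resolvent to the function `(l, z) ↦ θ (φ (l ⊗ z)^□
∧ m)`. Contracting one half of the resolvent identity shows that the image contains `l ⊗ l ⊗ F(z)`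
for every `F` in `N`. Equality of ranks makes the map injective, and the five functionals rule out
denominators, so the image is exactly `N` (`Resolvent.exists_equiv`). Then `φ` and `θ` are forced as
well. -/

theorem four_add₀ (x x' y z t : M) : d ![x + x', y, z, t] = d ![x, y, z, t] + d ![x', y, z, t] := by
  have e : ∀ v, Function.update ![0, y, z, t] 0 v = ![v, y, z, t] := fun v => by
    ext i; fin_cases i <;> rfl
  have h := d.map_update_add ![0, y, z, t] 0 x x'
  rwa [e, e, e] at h

theorem four_add₁ (x y y' z t : M) : d ![x, y + y', z, t] = d ![x, y, z, t] + d ![x, y', z, t] := by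
  have e : ∀ v, Function.update ![x, 0, z, t] 1 v = ![x, v, z, t] := fun v => by
    ext i; fin_cases i <;> rfl
  have h := d.map_update_add ![x, 0, z, t] 1 y y'
  rwa [e, e, e] at h

theorem four_add₂ (x y z z' t : M) : d ![x, y, z + z', t] = d ![x, y, z, t] + d ![x, y, z', t] := by
  have e : ∀ v, Function.update ![x, y, 0, t] 2 v = ![x, y, v, t] := fun v => by
    ext i; fin_cases i <;> rfl
  have h := d.map_update_add ![x, y, 0, t] 2 z z'
  rwa [e, e, e] at h

theorem four_add₃ (x y z t t' : M) : d ![x, y, z, t + t'] = d ![x, y, z, t] + d ![x, y, z, t'] := by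
  have e : ∀ v, Function.update ![x, y, z, 0] 3 v = ![x, y, z, v] := fun v => by
    ext i; fin_cases i <;> rfl
  have h := d.map_update_add ![x, y, z, 0] 3 t t'
  rwa [e, e, e] at h

theorem four_smul₀ (c : R) (x y z t : M) : d ![c • x, y, z, t] = c • d ![x, y, z, t] := by
  have e : ∀ v, Function.update ![0, y, z, t] 0 v = ![v, y, z, t] := fun v => by
    ext i; fin_cases i <;> rfl
  have h := d.map_update_smul ![0, y, z, t] 0 c x
  rwa [e, e] at h

theorem four_smul₂ (c : R) (x y z t : M) : d ![x, y, c • z, t] = c • d ![x, y, z, t] := by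
  have e : ∀ v, Function.update ![x, y, 0, t] 2 v = ![x, y, v, t] := fun v => by
    ext i; fin_cases i <;> rfl
  have h := d.map_update_smul ![x, y, 0, t] 2 c z
  rwa [e, e] at h

theorem four_smul₃ (c : R) (x y z t : M) : d ![x, y, z, c • t] = c • d ![x, y, z, t] := by
  have e : ∀ v, Function.update ![x, y, z, 0] 3 v = ![x, y, z, v] := fun v => by
    ext i; fin_cases i <;> rfl
  have h := d.map_update_smul ![x, y, z, 0] 3 c t
  rwa [e, e] at h

theorem four_eq₀₁ (x z t : M) : d ![x, x, z, t] = 0 :=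
  d.map_eq_zero_of_eq _ (i := 0) (j := 1) rfl (by decide)

theorem four_eq₀₂ (x y t : M) : d ![x, y, x, t] = 0 :=
  d.map_eq_zero_of_eq _ (i := 0) (j := 2) rfl (by decide)

theorem four_eq₁₂ (x y t : M) : d ![x, y, y, t] = 0 :=
  d.map_eq_zero_of_eq _ (i := 1) (j := 2) rfl (by decide)

theorem four_eq₁₃ (x y z : M) : d ![x, y, z, y] = 0 :=
  d.map_eq_zero_of_eq _ (i := 1) (j := 3) rfl (by decide)

theorem four_eq₂₃ (x y z : M) : d ![x, y, z, z] = 0 :=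
  d.map_eq_zero_of_eq _ (i := 2) (j := 3) rfl (by decide)

theorem four_swap₀₁ (x y z t : M) : d ![y, x, z, t] = -d ![x, y, z, t] := by
  have h := four_eq₀₁ d (x + y) z t
  rw [four_add₀, four_add₁, four_add₁, four_eq₀₁, four_eq₀₁, zero_add, add_zero] at h
  exact eq_neg_of_add_eq_zero_right h

theorem four_swap₁₂ (x y z t : M) : d ![x, z, y, t] = -d ![x, y, z, t] := by
  have h := four_eq₁₂ d x (y + z) t
  rw [four_add₁, four_add₂, four_add₂, four_eq₁₂, four_eq₁₂, zero_add, add_zero] at h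
  exact eq_neg_of_add_eq_zero_right h

theorem four_swap₂₃ (x y z t : M) : d ![x, y, t, z] = -d ![x, y, z, t] := by
  have h := four_eq₂₃ d x y (z + t)
  rw [four_add₂, four_add₃, four_add₃, four_eq₂₃, four_eq₂₃, zero_add, add_zero] at h
  exact eq_neg_of_add_eq_zero_right h

end FourForm

end

section

/-! ### Generators of local algebras of dimension four or five. -/

section LocalAlgebra

theorem linearIndependent_four {k V : Type*} [Ring k] [AddCommGroup V] [Module k V] {x y z t : V}
    (h : ∀ a b c d : k, a • x + b • y + c • z + d • t = 0 → a = 0 ∧ b = 0 ∧ c = 0 ∧ d = 0) :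
    LinearIndependent k ![x, y, z, t] := by
  rw [Fintype.linearIndependent_iff]
  intro g hg
  obtain ⟨h0, h1, h2, h3⟩ := h (g 0) (g 1) (g 2) (g 3) (by simpa [Fin.sum_univ_four] using hg)
  intro i
  fin_cases i <;> assumption

/-- The degree of any `σ` outside `k` divides 4 or 5, so it is 2 or at least 4. In degree 2 any `τ`
outside `k(σ)` works, since `1, σ` and `1, τ` are bases for the two steps of a tower up to
independence; otherwise take `τ = σ²`. -/
theorem exists_indep_of_field {k F : Type*} [Field k] [Field F] [Algebra k F]
    (hn : Module.finrank k F = 4 ∨ Module.finrank k F = 5) :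
    ∃ σ τ : F, LinearIndependent k ![1, σ, τ, σ * τ] ∧
      σ * σ ∈ Submodule.span k {1, σ, τ} := by
  have : FiniteDimensional k F := Module.finite_of_finrank_pos (by omega)
  obtain ⟨σ, hσ⟩ : ∃ σ : F, σ ∉ (algebraMap k F).range := by
    by_contra! h
    have h1 : Module.finrank k F = 1 := by
      refine Subalgebra.bot_eq_top_iff_finrank_eq_one.1 (top_unique ?_)
      intro x _
      exact Algebra.mem_bot.2 (h x)
    omega
  have hint : IsIntegral k σ := IsIntegral.of_finite k σ
  have hdvd : (minpoly k σ).natDegree ∣ Module.finrank k F :=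
    minpoly.degree_dvd hint
  have h2 : 2 ≤ (minpoly k σ).natDegree := by
    rw [minpoly.two_le_natDegree_iff hint]
    exact hσ
  have hcase : (minpoly k σ).natDegree = 2 ∨ 4 ≤ (minpoly k σ).natDegree := by
    by_contra! hc
    have : (minpoly k σ).natDegree = 3 := by omega
    rw [this] at hdvd
    omega
  rcases hcase with hc | hc
  · obtain ⟨τ, hτ⟩ : ∃ τ : F, τ ∉ IntermediateField.adjoin k {σ} := by
      by_contra! h
      have : IntermediateField.adjoin k {σ} = ⊤ := by
        rw [eq_top_iff]; exact fun x _ => h x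
      have h3 := IntermediateField.adjoin.finrank hint
      rw [this, IntermediateField.finrank_top', hc] at h3
      omega
    have hmem : σ ∈ IntermediateField.adjoin k {σ} := IntermediateField.mem_adjoin_simple_self k σ
    have hlin : ∀ a b : k, a • (1 : F) + b • σ = 0 → a = 0 ∧ b = 0 := by
      intro a b hab
      have hb : b = 0 := by
        by_contra hb
        apply hσ
        refine ⟨-(b⁻¹ * a), ?_⟩
        have : σ = b⁻¹ • (b • σ) := by rw [smul_smul, inv_mul_cancel₀ hb, one_smul]
        rw [this, eq_neg_of_add_eq_zero_right hab, Algebra.algebraMap_eq_smul_one]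
        module
      subst hb
      simpa using hab
    refine ⟨σ, τ, linearIndependent_four ?_, ?_⟩
    · intro a b c d h
      have hz : c • (1 : F) + d • σ = 0 := by
        by_contra hne
        apply hτ
        have : τ = -(a • (1 : F) + b • σ) / (c • (1 : F) + d • σ) := by
          rw [eq_div_iff hne]
          simp only [Algebra.smul_def] at h ⊢
          linear_combination h
        rw [this]
        refine div_mem (neg_mem (add_mem ?_ ?_)) (add_mem ?_ ?_)
        all_goals
          apply IntermediateField.smul_mem
          first | exact one_mem _ | exact hmem
      obtain ⟨hc0, hd0⟩ := hlin c d hz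
      subst hc0 hd0
      obtain ⟨ha, hb⟩ := hlin a b (by simpa using h)
      exact ⟨ha, hb, rfl, rfl⟩
    · have hm := minpoly.aeval k σ
      rw [(minpoly.monic hint).as_sum, hc] at hm
      simp only [map_add, map_pow, Polynomial.aeval_X, Finset.sum_range_succ, Finset.sum_range_zero,
        zero_add, pow_zero, mul_one, pow_one, map_mul, Polynomial.aeval_C] at hm
      have : σ * σ = -((minpoly k σ).coeff 0) • (1 : F) + -((minpoly k σ).coeff 1) • σ := by
        simp only [Algebra.smul_def, map_neg]
        linear_combination hm
      rw [this]
      refine add_mem (Submodule.smul_mem _ _ (Submodule.subset_span (by simp)))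
        (Submodule.smul_mem _ _ (Submodule.subset_span (by simp)))
  · refine ⟨σ, σ ^ 2, ?_, Submodule.subset_span (by simp [pow_two])⟩
    have := (linearIndependent_pow (K := k) σ).comp (Fin.castLE hc) (Fin.castLE_injective hc)
    convert this using 1
    ext i
    fin_cases i <;> simp [pow_succ, mul_assoc]

/-- If the residue field is larger than `k` and `π ≠ 0`, the dimension forces `π² = 0`, and `π`
together with a residue generator works. If the residue field is `k`, the dimension forces `π³ ≠ 0`,
and `π, π²` work. The case `π = 0` is that of a field. -/
theorem exists_indep_of_isLocalRing {k B : Type*} [Field k] [CommRing B] [Algebra k B]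
    [IsLocalRing B] {π : B} (hπ : IsLocalRing.maximalIdeal B = Ideal.span {π})
    (hn : Module.finrank k B = 4 ∨ Module.finrank k B = 5) :
    ∃ σ τ : B, LinearIndependent k ![1, σ, τ, σ * τ] ∧
      σ * σ ∈ Submodule.span k {1, σ, τ} := by
  have : FiniteDimensional k B := Module.finite_of_finrank_pos (by omega)
  have hart : IsArtinianRing B := IsArtinianRing.of_finite k B
  by_cases hπ0 : π = 0
  · have hF : IsField B := by
      rw [IsLocalRing.isField_iff_maximalIdeal_eq, hπ, hπ0]
      simp
    let := hF.toField
    exact exists_indep_of_field hn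
  have hπm : π ∈ IsLocalRing.maximalIdeal B := by
    rw [hπ]; exact Ideal.mem_span_singleton_self π
  have hmem : ∀ {x : B}, x ∈ IsLocalRing.maximalIdeal B → ∃ y, x = π * y := fun {x} hx => by
    rw [hπ] at hx
    exact Ideal.mem_span_singleton.1 hx
  have hunit : ∀ {x y : B}, x ∉ IsLocalRing.maximalIdeal B → x * y = 0 → y = 0 := by
    intro x y hx hxy
    exact (IsLocalRing.notMem_maximalIdeal.1 hx).mul_right_eq_zero.1 hxy
  obtain ⟨N, hN⟩ : IsNilpotent π := by
    have := IsArtinianRing.isNilpotent_jacobson_bot (R := B)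
    rw [IsLocalRing.jacobson_eq_maximalIdeal ⊥ bot_ne_top] at this
    obtain ⟨N, hN⟩ := this
    refine ⟨N, ?_⟩
    have h := Ideal.pow_mem_pow hπm N
    rw [hN] at h
    simpa using h
  by_cases hα : ∃ α : B, ∀ c : k, α - c • 1 ∉ IsLocalRing.maximalIdeal B
  · obtain ⟨α, hα⟩ := hα
    have hlin : ∀ a b : k, a • (1 : B) + b • α ∈ IsLocalRing.maximalIdeal B → a = 0 ∧ b = 0 := by
      intro a b hab
      have hb : b = 0 := by
        by_contra hb
        apply hα (-(b⁻¹ * a))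
        have : α - (-(b⁻¹ * a)) • (1 : B) = b⁻¹ • (a • (1 : B) + b • α) := by
          rw [smul_add, smul_smul, smul_smul, inv_mul_cancel₀ hb, one_smul]
          module
        rw [this, Algebra.smul_def]
        exact Ideal.mul_mem_left _ _ hab
      subst hb
      refine ⟨?_, rfl⟩
      by_contra ha
      rw [zero_smul, add_zero] at hab
      have : (1 : B) = a⁻¹ • (a • (1 : B)) := by rw [smul_smul, inv_mul_cancel₀ ha, one_smul]
      apply (IsLocalRing.maximalIdeal.isMaximal B).ne_top
      rw [Ideal.eq_top_iff_one, this, Algebra.smul_def]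
      exact Ideal.mul_mem_left _ _ hab
    -- Reduce modulo the maximal ideal, remove one factor `π`, and repeat. The disjunction lets the
    -- same argument serve for six elements when `π² ≠ 0` and for four elements in any case.
    have hstep : ∀ a b c d e f : k, π * π ≠ 0 ∨ (e = 0 ∧ f = 0) →
        (a • (1 : B) + b • α) + (c • (1 : B) + d • α) * π + (e • (1 : B) + f • α) * (π * π) = 0 →
        a = 0 ∧ b = 0 ∧ c = 0 ∧ d = 0 ∧ e = 0 ∧ f = 0 := by
      intro a b c d e f hef h
      obtain ⟨rfl, rfl⟩ := hlin a b (by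
        have : a • (1 : B) + b • α =
            (-(c • (1 : B) + d • α) - (e • (1 : B) + f • α) * π) * π := by
          linear_combination h
        rw [this]
        exact Ideal.mul_mem_left _ _ hπm)
      obtain ⟨rfl, rfl⟩ := hlin c d (by
        by_contra hcd
        apply hπ0
        have : (c • (1 : B) + d • α) + (e • (1 : B) + f • α) * π ∉ IsLocalRing.maximalIdeal B := by
          intro hmem
          exact hcd ((Ideal.add_mem_iff_left _ (Ideal.mul_mem_left _ _ hπm)).1 hmem)
        refine hunit this ?_
        simp only [zero_smul, zero_add] at h
        linear_combination h)
      refine ⟨rfl, rfl, rfl, rfl, ?_⟩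
      rcases hef with hne | hef
      · refine hlin e f ?_
        by_contra hef
        exact hne (hunit hef (by simpa using h))
      · exact hef
    -- Otherwise `1, α` times `1, π, π²` would be six independent elements.
    have hsq : π * π = 0 := by
      by_contra hsq
      have hli : LinearIndependent k ![1, α, π, α * π, π * π, α * (π * π)] := by
        rw [Fintype.linearIndependent_iff]
        intro g hg
        obtain ⟨h0, h1, h2, h3, h4, h5⟩ :=
          hstep (g 0) (g 1) (g 2) (g 3) (g 4) (g 5) (Or.inl hsq) (by
            rw [← hg, Fin.sum_univ_six]
            simp only [Matrix.cons_val, Algebra.smul_def]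
            ring)
        intro i
        fin_cases i <;> assumption
      have := hli.fintype_card_le_finrank
      simp at this
      omega
    refine ⟨π, α, linearIndependent_four ?_, by rw [hsq]; exact zero_mem _⟩
    intro a b c d h
    have := hstep a c b d 0 0 (Or.inr ⟨rfl, rfl⟩) (by
      rw [← h]
      simp only [Algebra.smul_def, map_zero]
      ring)
    exact ⟨this.1, this.2.2.1, this.2.1, this.2.2.2.1⟩
  · push Not at hα
    -- With residue field `k`, every `x` has an expansion in powers of `π`; if `π³` vanished, three
    -- powers would span.
    have hπ3 : π ^ 3 ≠ 0 := by
      intro h3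
      have htop : Submodule.span k (Set.range ![1, π, π ^ 2]) = ⊤ := by
        rw [eq_top_iff]
        rintro x -
        obtain ⟨c₀, h₀⟩ := hα x
        obtain ⟨x₁, h₁⟩ := hmem h₀
        obtain ⟨c₁, h₁'⟩ := hα x₁
        obtain ⟨x₂, h₂⟩ := hmem h₁'
        obtain ⟨c₂, h₂'⟩ := hα x₂
        obtain ⟨x₃, h₃⟩ := hmem h₂'
        have : x = c₀ • (1 : B) + c₁ • π + c₂ • π ^ 2 := by
          simp only [Algebra.smul_def] at h₁ h₂ h₃ ⊢
          linear_combination h₁ + π * h₂ + π ^ 2 * h₃ + x₃ * h3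
        rw [this]
        refine add_mem (add_mem ?_ ?_) ?_ <;>
          refine Submodule.smul_mem _ _ (Submodule.subset_span ?_)
        exacts [⟨0, rfl⟩, ⟨1, rfl⟩, ⟨2, rfl⟩]
      have := finrank_range_le_card (R := k) ![1, π, π ^ 2]
      rw [Set.finrank, htop, finrank_top] at this
      simp at this
      omega
    classical
    have hex : ∃ N, π ^ N = 0 := ⟨N, hN⟩
    obtain ⟨ν, hν⟩ : ∃ ν, Nat.find hex = ν + 4 := by
      refine ⟨Nat.find hex - 4, ?_⟩
      have : ¬ Nat.find hex ≤ 3 := fun hle => hπ3 (pow_eq_zero_of_le hle (Nat.find_spec hex))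
      omega
    have hz : π ^ (ν + 4) = 0 := hν ▸ Nat.find_spec hex
    have hnz : π ^ (ν + 3) ≠ 0 := Nat.find_min hex (by omega)
    refine ⟨π, π ^ 2, linearIndependent_four ?_, Submodule.subset_span (by simp [pow_two])⟩
    have key : ∀ a : k, a • π ^ (ν + 3) = 0 → a = 0 := fun a ha =>
      (smul_eq_zero.1 ha).resolve_right hnz
    intro a b c d h
    simp only [Algebra.smul_def] at h key
    -- Multiplying the relation by the largest suitable power of `π` leaves only its lowest term, a
    -- multiple of the last nonzero power.
    have ha : a = 0 := key a (by
      linear_combination π ^ (ν + 3) * h -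
        (algebraMap k B b + algebraMap k B c * π + algebraMap k B d * π ^ 2) * hz)
    subst ha
    have hb : b = 0 := key b (by
      simp only [map_zero] at h
      linear_combination π ^ (ν + 2) * h - (algebraMap k B c + algebraMap k B d * π) * hz)
    subst hb
    have hc : c = 0 := key c (by
      simp only [map_zero] at h
      linear_combination π ^ (ν + 1) * h - (algebraMap k B d) * hz)
    subst hc
    refine ⟨rfl, rfl, rfl, key d (by
      simp only [map_zero] at h
      linear_combination π ^ ν * h)⟩

end LocalAlgebra

end

section

/-! ### Generators of a five-dimensional algebra with locally principal maximal ideals. -/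

section LocalAlgebra

theorem exists_linearIndependent_five {k V : Type*} [Field k] [AddCommGroup V] [Module k V]
    (hn : Module.finrank k V = 5) {x y z t : V} (h : LinearIndependent k ![x, y, z, t]) :
    ∃ e : V, LinearIndependent k ![x, y, z, e, t] := by
  have : FiniteDimensional k V := Module.finite_of_finrank_pos (by omega)
  obtain ⟨e, he⟩ : ∃ e, e ∉ Submodule.span k (Set.range ![x, y, z, t]) := by
    by_contra! hall
    have := finrank_range_le_card (R := k) ![x, y, z, t]
    rw [Set.finrank, (eq_top_iff.2 fun x _ => hall x : Submodule.span k (Set.range ![x, y, z, t]) = ⊤),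
      finrank_top, hn] at this
    simp at this
  refine ⟨e, ?_⟩
  have h5 : LinearIndependent k (Fin.cons e ![x, y, z, t] : Fin 5 → V) :=
    linearIndependent_finCons.2 ⟨h, he⟩
  have := h5.comp (![1, 2, 3, 0, 4] : Fin 5 → Fin 5) (by decide)
  convert this using 1
  ext i
  fin_cases i <;> rfl

/-- Fitting's argument: if `aⁿ = aⁿ⁺¹ b`, then `(a b)ⁿ` is idempotent. If it is 0, then `a` is
nilpotent; if it is 1, then `a` is a unit. -/
theorem isLocalRing_of_idempotent {B : Type*} [CommRing B] [Nontrivial B] [IsArtinianRing B]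
    (h : ∀ e : B, e * e = e → e = 0 ∨ e = 1) : IsLocalRing B := by
  refine IsLocalRing.of_isUnit_or_isUnit_one_sub_self fun a => ?_
  obtain ⟨n, b, hb⟩ := IsArtinian.exists_pow_succ_smul_dvd a (1 : B)
  simp only [smul_eq_mul, mul_one, pow_succ] at hb
  have hpow : ∀ j, a ^ (n + j) * b ^ j = a ^ n := by
    intro j
    induction j with
    | zero => simp
    | succ j ih =>
      calc a ^ (n + (j + 1)) * b ^ (j + 1) = (a ^ n * a * b) * a ^ j * b ^ j := by ring
        _ = a ^ n := by rw [hb, ← pow_add, ih]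
  rcases h ((a * b) ^ n) (by
    have := hpow n
    calc (a * b) ^ n * (a * b) ^ n = (a ^ (n + n) * b ^ n) * b ^ n := by ring
      _ = (a * b) ^ n := by rw [this]; ring) with h0 | h1
  · right
    have : a ^ n = 0 := by
      rw [← hpow n]
      calc a ^ (n + n) * b ^ n = a ^ n * (a * b) ^ n := by ring
        _ = 0 := by rw [h0, mul_zero]
    exact IsNilpotent.isUnit_one_sub ⟨n, this⟩
  · left
    rcases Nat.eq_zero_or_pos n with hn | hn
    · subst hn
      exact IsUnit.of_mul_eq_one b (by simpa using hb)
    · refine isUnit_of_dvd_one ⟨a ^ (n - 1) * b ^ n, ?_⟩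
      rw [← h1]
      obtain ⟨m, rfl⟩ : ∃ m, n = m + 1 := ⟨n - 1, by omega⟩
      simp only [Nat.add_sub_cancel]
      ring

/-- The four elements live in `A ε × A (1 - ε)`, where they recombine into the independent pairs `ε,
σ` and `1 - ε, τ`. -/
theorem linearIndependent_of_idempotent {k A : Type*} [Field k] [CommRing A] [Algebra k A]
    {ε σ τ : A} (hε : ε * ε = ε) (hσ : ε * σ = σ) (hσ' : ∀ c : k, σ ≠ c • ε)
    (hτ : ε * τ = 0) (hτ' : ∀ c : k, τ ≠ c • (1 - ε)) :
    LinearIndependent k ![1, ε, σ + τ, ε * (σ + τ)] := by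
  have key : ∀ {ε σ : A} (a b : k), ε ≠ 0 → (∀ c : k, σ ≠ c • ε) → a • ε + b • σ = 0 →
      a = 0 ∧ b = 0 := by
    intro ε σ a b hε hσ' hab
    have hb : b = 0 := by
      by_contra hb
      apply hσ' (-(b⁻¹ * a))
      have : σ = b⁻¹ • (b • σ) := by rw [smul_smul, inv_mul_cancel₀ hb, one_smul]
      rw [this, eq_neg_of_add_eq_zero_right hab]
      module
    subst hb
    refine ⟨?_, rfl⟩
    rw [zero_smul, add_zero] at hab
    exact (smul_eq_zero.1 hab).resolve_right hε
  refine linearIndependent_four fun a b c d h => ?_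
  simp only [mul_add, hσ, hτ] at h
  obtain ⟨ha, hc⟩ := key a c (fun h0 => hτ' 0 (by
    rw [zero_smul, ← hτ, ← sub_eq_zero.1 h0, one_mul])) hτ' (by
    simp only [Algebra.smul_def] at h ⊢
    linear_combination (1 - ε) * h + (algebraMap k A b) * hε + (algebraMap k A c) * hσ +
      (algebraMap k A c) * hτ + (algebraMap k A d) * hσ)
  subst ha hc
  obtain ⟨hb, hd⟩ := key b d (fun h0 => hσ' 0 (by rw [← hσ, h0, zero_mul, smul_zero])) hσ' (by
    simp only [Algebra.smul_def] at h ⊢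
    simp only [map_zero] at h
    linear_combination h)
  exact ⟨rfl, hb, rfl, hd⟩

/-- If an idempotent cuts `A` into two pieces both larger than `k`, take it for `s`. Otherwise `A`
is local, or it is `k` times a local algebra of dimension four; then `s, t` come from the local
factor and, in the second case, `e` is the idempotent of the factor `k`. The condition on `s²` is
what later makes a Pfaffian invertible. -/
theorem exists_generators {k A : Type*} [Field k] [CommRing A] [Algebra k A]
    (hn : Module.finrank k A = 5)
    (hP : ∀ n : Ideal A, n.IsMaximal → ∃ a ∈ n, ∃ u ∉ n, ∀ y ∈ n, ∃ z, u * y = a * z) :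
    ∃ s t e : A, LinearIndependent k ![1, s, t, e, s * t] ∧
      s * s ∈ Submodule.span k {1, s, t, e} := by
  have : FiniteDimensional k A := Module.finite_of_finrank_pos (by omega)
  have hart : IsArtinianRing A := IsArtinianRing.of_finite k A
  have : Nontrivial A := Module.nontrivial_of_finrank_pos (R := k) (by omega)
  by_cases hsplit : ∃ ε σ τ : A, ε * ε = ε ∧ ε * σ = σ ∧ (∀ c : k, σ ≠ c • ε) ∧ ε * τ = 0 ∧
      ∀ c : k, τ ≠ c • (1 - ε)
  · obtain ⟨ε, σ, τ, hε, hσ, hσ', hτ, hτ'⟩ := hsplit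
    obtain ⟨e, he⟩ := exists_linearIndependent_five hn
      (linearIndependent_of_idempotent hε hσ hσ' hτ hτ')
    exact ⟨ε, σ + τ, e, he, by rw [hε]; exact Submodule.subset_span (by simp)⟩
  have hdich : ∀ ε : A, ε * ε = ε → (∀ σ, ε * σ = σ → ∃ c : k, σ = c • ε) ∨
      (∀ τ, ε * τ = 0 → ∃ c : k, τ = c • (1 - ε)) := by
    intro ε hε
    by_contra! hcon
    obtain ⟨⟨σ, h1, h2⟩, τ, h3, h4⟩ := hcon
    exact hsplit ⟨ε, σ, τ, hε, h1, h2, h3, h4⟩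
  by_cases htriv : ∀ ε : A, ε * ε = ε → ε = 0 ∨ ε = 1
  · have := isLocalRing_of_idempotent htriv
    obtain ⟨a, ha, u, hu, hau⟩ := hP _ (IsLocalRing.maximalIdeal.isMaximal A)
    have hm : IsLocalRing.maximalIdeal A = Ideal.span {a} := by
      apply le_antisymm
      · intro y hy
        obtain ⟨z, hz⟩ := hau y hy
        have := IsLocalRing.notMem_maximalIdeal.1 hu
        rw [Ideal.mem_span_singleton]
        exact this.dvd_mul_left.1 ⟨z, hz⟩
      · rwa [Ideal.span_singleton_le_iff_mem]
    obtain ⟨σ, τ, hli, hsq⟩ := exists_indep_of_isLocalRing hm (Or.inr hn)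
    obtain ⟨e, he⟩ := exists_linearIndependent_five hn hli
    refine ⟨σ, τ, e, he, Submodule.span_mono ?_ hsq⟩
    intro x hx
    simp only [Set.mem_insert_iff, Set.mem_singleton_iff] at hx ⊢
    tauto
  obtain ⟨ε, hε, hε0, hε1, hεk⟩ : ∃ ε : A, ε * ε = ε ∧ ε ≠ 0 ∧ ε ≠ 1 ∧
      ∀ σ, ε * σ = σ → ∃ c : k, σ = c • ε := by
    push Not at htriv
    obtain ⟨ε, hε, h0, h1⟩ := htriv
    rcases hdich ε hε with h | h
    · exact ⟨ε, hε, h0, h1, h⟩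
    · refine ⟨1 - ε, by linear_combination hε, sub_ne_zero.2 h1.symm, by simpa using h0, ?_⟩
      intro σ hσ
      exact h σ (by linear_combination -hσ)
  set I : Ideal A := Ideal.span {ε} with hI
  have hImem : ∀ x, x ∈ I → ∃ c : k, x = c • ε := by
    intro x hx
    obtain ⟨y, rfl⟩ := Ideal.mem_span_singleton.1 hx
    exact hεk _ (by linear_combination y * hε)
  have hB : Module.finrank k (A ⧸ I) = 4 := by
    have h1 := LinearMap.finrank_range_add_finrank_ker (Ideal.Quotient.mkₐ k I).toLinearMap
    rw [LinearMap.range_eq_top.2 (Ideal.Quotient.mkₐ_surjective k I), finrank_top, hn] at h1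
    have h2 : LinearMap.ker (Ideal.Quotient.mkₐ k I).toLinearMap = Submodule.span k {ε} := by
      ext x
      rw [LinearMap.mem_ker, Submodule.mem_span_singleton]
      change Ideal.Quotient.mk I x = 0 ↔ _
      rw [Ideal.Quotient.eq_zero_iff_mem]
      constructor
      · intro hx
        obtain ⟨c, hc⟩ := hImem x hx
        exact ⟨c, hc.symm⟩
      · rintro ⟨c, rfl⟩
        rw [Algebra.smul_def]
        exact Ideal.mul_mem_left _ _ (Ideal.mem_span_singleton_self ε)
    rw [h2, finrank_span_singleton hε0] at h1
    omega
  -- If instead the complementary piece were one-dimensional, it would be spanned by `ε`, which lies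
  -- in it; this forces `g = 1 - ε`.
  have hone : ∀ g : A, g * g = g → ε * g = 0 → g ≠ 1 - ε → ∀ σ, g * σ = σ → ∃ c : k, σ = c • g := by
    intro g hg hεg hg1
    refine (hdich g hg).resolve_right fun h => ?_
    obtain ⟨c, hc⟩ := h ε (by linear_combination hεg)
    have h0 : c • (1 - ε - g) = 0 := by
      simp only [Algebra.smul_def] at hc ⊢
      linear_combination -hε - (1 - ε) * hc - (algebraMap k A c) * hεg
    rcases smul_eq_zero.1 h0 with h0 | h0
    · exact hε0 (by rw [hc, h0, zero_smul])
    · exact hg1 (by linear_combination -h0)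
  have hidem : ∀ g : A, g * g = g → ε * g = 0 → g = 0 ∨ g = 1 - ε := by
    intro g hg hεg
    by_contra! hcon
    have hg1 := hone g hg hεg hcon.2
    have hg2 := hone (1 - ε - g) (by linear_combination hε + hg + 2 * hεg)
      (by linear_combination -hε - hεg) (by
        intro h
        exact hcon.1 (by linear_combination -h))
    -- A further splitting would make `A` a product of three lines.
    have htop : Submodule.span k (Set.range ![ε, g, 1 - ε - g]) = ⊤ := by
      rw [eq_top_iff]
      rintro x -
      obtain ⟨c₀, h₀⟩ := hεk (ε * x) (by linear_combination x * hε)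
      obtain ⟨c₁, h₁⟩ := hg1 (g * x) (by linear_combination x * hg)
      obtain ⟨c₂, h₂⟩ := hg2 ((1 - ε - g) * x) (by
        linear_combination x * (hε + hg + 2 * hεg))
      have : x = c₀ • ε + c₁ • g + c₂ • (1 - ε - g) := by
        rw [← h₀, ← h₁, ← h₂]
        ring
      rw [this]
      refine add_mem (add_mem ?_ ?_) ?_ <;>
        refine Submodule.smul_mem _ _ (Submodule.subset_span ?_)
      exacts [⟨0, rfl⟩, ⟨1, rfl⟩, ⟨2, rfl⟩]
    have := finrank_range_le_card (R := k) ![ε, g, 1 - ε - g]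
    rw [Set.finrank, htop, finrank_top, hn] at this
    simp at this
  have : Nontrivial (A ⧸ I) := Module.nontrivial_of_finrank_pos (R := k) (by omega)
  have : FiniteDimensional k (A ⧸ I) := Module.finite_of_finrank_pos (by omega)
  have hartB : IsArtinianRing (A ⧸ I) := IsArtinianRing.of_finite k _
  have hε' : Ideal.Quotient.mk I ε = 0 :=
    Ideal.Quotient.eq_zero_iff_mem.2 (Ideal.mem_span_singleton_self ε)
  have hlocB : IsLocalRing (A ⧸ I) := by
    refine isLocalRing_of_idempotent fun g hg => ?_
    obtain ⟨a, rfl⟩ := Ideal.Quotient.mk_surjective g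
    rw [← map_mul, Ideal.Quotient.eq] at hg
    obtain ⟨c, hc⟩ := hImem _ hg
    rw [Algebra.smul_def] at hc
    rcases hidem ((1 - ε) * a) (by
      linear_combination (1 - ε) * hc + (a * a - algebraMap k A c) * hε)
      (by linear_combination -a * hε) with h | h
    · left
      have := congrArg (Ideal.Quotient.mk I) h
      simpa [hε'] using this
    · right
      have := congrArg (Ideal.Quotient.mk I) h
      simpa [hε'] using this
  obtain ⟨a, ha, u, hu, hau⟩ := hP ((IsLocalRing.maximalIdeal (A ⧸ I)).comap (Ideal.Quotient.mk I))
    (Ideal.comap_isMaximal_of_surjective _ Ideal.Quotient.mk_surjective)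
  have hm : IsLocalRing.maximalIdeal (A ⧸ I) = Ideal.span {Ideal.Quotient.mk I a} := by
    apply le_antisymm
    · intro y hy
      obtain ⟨y, rfl⟩ := Ideal.Quotient.mk_surjective y
      obtain ⟨z, hz⟩ := hau y hy
      have := IsLocalRing.notMem_maximalIdeal.1 hu
      rw [Ideal.mem_span_singleton]
      exact this.dvd_mul_left.1 ⟨Ideal.Quotient.mk I z, by rw [← map_mul, hz, map_mul]⟩
    · rwa [Ideal.span_singleton_le_iff_mem]
  obtain ⟨σ, τ, hli, hsq⟩ := exists_indep_of_isLocalRing hm (Or.inl hB)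
  obtain ⟨s, rfl⟩ := Ideal.Quotient.mk_surjective σ
  obtain ⟨t, rfl⟩ := Ideal.Quotient.mk_surjective τ
  rw [Fintype.linearIndependent_iff] at hli
  have hmk : ∀ (c : k) (x : A), Ideal.Quotient.mk I (c • x) = c • Ideal.Quotient.mk I x :=
    fun c x => map_smul (Ideal.Quotient.mkₐ k I) c x
  refine ⟨s, t, ε, Fintype.linearIndependent_iff.2 fun g hg => ?_, ?_⟩
  · rw [Fin.sum_univ_five] at hg
    simp only [Matrix.cons_val] at hg
    have h4 := hli ![g 0, g 1, g 2, g 4] (by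
      rw [Fin.sum_univ_four]
      have := congrArg (Ideal.Quotient.mk I) hg
      simp only [map_add, hmk, hε', smul_zero, add_zero, map_zero, map_one, map_mul] at this
      simpa using this)
    have h0 : g 0 = 0 := h4 0
    have h1 : g 1 = 0 := h4 1
    have h2 : g 2 = 0 := h4 2
    have h4 : g 4 = 0 := h4 3
    have h3 : g 3 = 0 := by
      rw [h0, h1, h2, h4] at hg
      simp only [zero_smul, zero_add, add_zero] at hg
      exact (smul_eq_zero.1 hg).resolve_right hε0
    intro i
    fin_cases i <;> assumption
  · rw [Submodule.mem_span_triple] at hsq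
    obtain ⟨a, b, c, h⟩ := hsq
    have : s * s - (a • 1 + b • s + c • t) ∈ I := by
      rw [← Ideal.Quotient.eq_zero_iff_mem, map_sub, map_add, map_add, hmk, hmk, hmk, map_one, h,
        map_mul, sub_self]
    obtain ⟨d, hd⟩ := hImem _ this
    rw [eq_add_of_sub_eq hd]
    refine add_mem ?_ (add_mem (add_mem ?_ ?_) ?_) <;>
      exact Submodule.smul_mem _ _ (Submodule.subset_span (by simp))

end LocalAlgebra

end

section

/-! ### Frobenius forms and the dimension bound five. -/

section Frobenius

/-- A reduced finite-dimensional commutative algebra has a linear form whose kernel contains no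
nonzero ideal. -/
theorem exists_frobenius_form {K A : Type*} [Field K] [CommRing A] [Algebra K A]
    [FiniteDimensional K A] [IsReduced A] :
    ∃ s : A →ₗ[K] K, ∀ a, (∀ b, s (a * b) = 0) → a = 0 := by
  have : IsArtinianRing A := IsArtinianRing.of_finite K A
  classical
  have hf : ∀ I : MaximalSpectrum A, ∃ f : (A ⧸ I.asIdeal) →ₗ[K] K, f ≠ 0 := fun I => by
    have := I.isMaximal
    have : Nontrivial (A ⧸ I.asIdeal) := Ideal.Quotient.nontrivial_iff.2 I.isMaximal.ne_top
    obtain ⟨f, hf⟩ := exists_ne (0 : Module.Dual K (A ⧸ I.asIdeal))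
    exact ⟨f, hf⟩
  choose f hf using hf
  have : Fintype (MaximalSpectrum A) := Fintype.ofFinite _
  refine ⟨∑ I, f I ∘ₗ (Ideal.Quotient.mkₐ K I.asIdeal).toLinearMap, fun a ha => ?_⟩
  have hz : ∀ I : MaximalSpectrum A, Ideal.Quotient.mk I.asIdeal a = 0 := by
    intro I
    by_contra hne
    obtain ⟨x, hx⟩ : ∃ x, f I x ≠ 0 := by
      by_contra! h
      exact hf I (LinearMap.ext h)
    have := I.isMaximal
    let := Ideal.Quotient.field I.asIdeal
    set y : ∀ J : MaximalSpectrum A, A ⧸ J.asIdeal := Pi.single I ((Ideal.Quotient.mk I.asIdeal a)⁻¹ * x)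
    have hb := ha ((IsArtinianRing.equivPi A).symm y)
    have hy : ∀ J : MaximalSpectrum A, Ideal.Quotient.mk J.asIdeal ((IsArtinianRing.equivPi A).symm y)
        = y J := by
      intro J
      conv_rhs => rw [← (IsArtinianRing.equivPi A).apply_symm_apply y]
      rfl
    rw [LinearMap.sum_apply, Finset.sum_eq_single I] at hb
    · apply hx
      rw [← hb]
      simp only [LinearMap.comp_apply, AlgHom.toLinearMap_apply, Ideal.Quotient.mkₐ_eq_mk, map_mul, hy]
      congr 1
      simp only [y, Pi.single_eq_same]
      rw [mul_inv_cancel_left₀ hne]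
    · intro J _ hJ
      simp only [LinearMap.comp_apply, AlgHom.toLinearMap_apply, Ideal.Quotient.mkₐ_eq_mk, map_mul, hy]
      simp [y, Pi.single_eq_of_ne hJ]
    · simp
  apply (IsArtinianRing.equivPi A).injective
  rw [map_zero]
  ext I
  exact hz I

theorem sum_symm_mul_alt {K : Type*} [CommRing K] {n : ℕ} (c w : Fin n → Fin n → K)
    (hc : ∀ i j, c i j = c j i) (hw : ∀ i j, w i j = -w j i) (hw' : ∀ i, w i i = 0) :
    ∑ i, ∑ j, c i j * w i j = 0 := by
  induction n with
  | zero => simp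
  | succ n ih =>
    simp only [Fin.sum_univ_succ, hw' 0, mul_zero, zero_add, Finset.sum_add_distrib]
    rw [ih (fun i j => c i.succ j.succ) (fun i j => w i.succ j.succ) (fun i j => hc _ _)
      (fun i j => hw _ _) (fun i => hw' _), add_zero, ← Finset.sum_add_distrib]
    refine Finset.sum_eq_zero fun i _ => ?_
    rw [hc 0 i.succ, hw 0 i.succ]
    ring

/-- Folds a sum over ordered pairs into the ten unordered pairs, the coordinates on a symmetric
square of a four-dimensional space. -/
theorem sum_upper_triangle {K V : Type*} [CommRing K] [AddCommGroup V] [Module K V]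
    (G : Fin 4 → Fin 4 → K) (X : Fin 4 → Fin 4 → V) (hX : ∀ i j, X i j = X j i) :
    ∑ p : Fin 10, (![G 0 0, G 1 1, G 2 2, G 3 3, G 0 1 + G 1 0, G 0 2 + G 2 0, G 0 3 + G 3 0,
      G 1 2 + G 2 1, G 1 3 + G 3 1, G 2 3 + G 3 2] p : K) •
      (![X 0 0, X 1 1, X 2 2, X 3 3, X 0 1, X 0 2, X 0 3, X 1 2, X 1 3, X 2 3] p : V) =
    ∑ i, ∑ j, G i j • X i j := by
  rw [Fin.sum_univ_four]
  simp only [Fin.sum_univ_four]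
  rw [Fin.sum_univ_castSucc, Fin.sum_univ_castSucc, Fin.sum_univ_eight]
  rw [hX 1 0, hX 2 0, hX 3 0, hX 2 1, hX 3 1, hX 3 2]
  change G 0 0 • X 0 0 + G 1 1 • X 1 1 + G 2 2 • X 2 2 + G 3 3 • X 3 3 +
    (G 0 1 + G 1 0) • X 0 1 + (G 0 2 + G 2 0) • X 0 2 + (G 0 3 + G 3 0) • X 0 3 +
    (G 1 2 + G 2 1) • X 1 2 + (G 1 3 + G 3 1) • X 1 3 + (G 2 3 + G 3 2) • X 2 3 = _
  module

/-- The quadratic maps `z ↦ x ∧ y ∧ z ∧ y z` on a five-dimensional algebra with a Frobenius form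
span a space of dimension at most five. -/
theorem finrank_span_wedge_le {K A : Type*} [Field K] [CommRing A] [Algebra K A]
    (s : A →ₗ[K] K) (hs : ∀ a, (∀ b, s (a * b) = 0) → a = 0) (b : Module.Basis (Fin 5) K A)
    (hb : b 0 = 1) (d : A [⋀^Fin 4]→ₗ[K] K) (hd : ∀ x : Fin 4 → A, ∀ i, x i = 1 → d x = 0) :
    Module.finrank K (Submodule.span K
      (Set.range fun p : A × A => fun z : A => d ![p.1, p.2, z, p.2 * z])) ≤ 5 := by
  have hfin : FiniteDimensional K A := b.finiteDimensional_of_finite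
  have hdimA : Module.finrank K A = 5 := by simpa using Module.finrank_eq_card_basis b
  -- the basis dual to `b` for the trace form `(x, y) ↦ s (x y)`
  set T : A →ₗ[K] Module.Dual K A := (LinearMap.mul K A).compr₂ s with hT
  have hTapp : ∀ x y, T x y = s (x * y) := fun x y => rfl
  have hTsurj : Function.Surjective T := by
    refine (LinearMap.injective_iff_surjective_of_finrank_eq_finrank
      (Subspace.dual_finrank_eq).symm).1 ?_
    rw [injective_iff_map_eq_zero]
    intro a ha
    exact hs a fun c => by rw [← hTapp, ha]; rfl
  choose b' hb' using fun i => hTsurj (b.coord i)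
  have hrepr : ∀ i z, s (b' i * z) = b.repr z i := fun i z => by
    rw [← hTapp, hb']; rfl
  have hexp : ∀ z, z = ∑ i, s (b' i * z) • b i := fun z => by
    simp only [hrepr]; exact (b.sum_repr z).symm
  have hone : ∀ i : Fin 4, s (b' i.succ) = 0 := fun i => by
    rw [← mul_one (b' i.succ), hrepr, ← hb, b.repr_self]
    simp [Fin.succ_ne_zero]
  have hb'ne : b' 1 ≠ 0 := fun h => by
    have := hrepr 1 (b 1)
    rw [h, zero_mul, map_zero, b.repr_self] at this
    simp at this
  let idx : Fin 10 → Fin 4 × Fin 4 :=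
    ![(0, 0), (1, 1), (2, 2), (3, 3), (0, 1), (0, 2), (0, 3), (1, 2), (1, 3), (2, 3)]
  let prod : Fin 10 → A := fun p => b' (idx p).1.succ * b' (idx p).2.succ
  have hprod : ∀ i j : Fin 4, ∃ p, prod p = b' i.succ * b' j.succ := by
    intro i j
    have : ∃ p, idx p = (i, j) ∨ idx p = (j, i) := by
      revert i j; decide
    obtain ⟨p, hp | hp⟩ := this
    · exact ⟨p, by simp only [prod, hp]⟩
    · exact ⟨p, by simp only [prod, hp]; exact mul_comm _ _⟩
  let μ : (Fin 10 → K) →ₗ[K] A := Fintype.linearCombination K prod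
  -- The ten products `b'ᵢ b'ⱼ` with `i, j ≥ 1` span `A`. A form `s(a ·)` killing them makes each `a
  -- b'ᵢ` a scalar; a nonzero scalar would make two of the `b'ᵢ` dependent, so all vanish, and then
  -- `a` is itself a scalar with `a b'₁ = 0`. The kernel of `μ` thus has dimension `10 - 5`.
  have hμ : LinearMap.range μ = ⊤ := by
    by_contra hne
    obtain ⟨f, hf0, hf⟩ := Submodule.exists_le_ker_of_lt_top _ (lt_top_iff_ne_top.2 hne)
    obtain ⟨a, rfl⟩ := hTsurj f
    have hvan : ∀ i j : Fin 4, s (a * (b' i.succ * b' j.succ)) = 0 := by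
      intro i j
      obtain ⟨p, hp⟩ := hprod i j
      rw [← hp, ← hTapp]
      refine LinearMap.mem_ker.1 (hf ⟨Pi.single p 1, ?_⟩)
      simp [μ, Fintype.linearCombination_apply_single]
    have hab : ∀ i : Fin 4, ∃ c : K, a * b' i.succ = algebraMap K A c := by
      intro i
      refine ⟨s (b' 0 * (a * b' i.succ)), ?_⟩
      refine (hexp (a * b' i.succ)).trans ?_
      rw [Fin.sum_univ_succ, Finset.sum_eq_zero, add_zero, hb, Algebra.algebraMap_eq_smul_one]
      intro j _
      rw [show b' j.succ * (a * b' i.succ) = a * (b' i.succ * b' j.succ) by ring, hvan, zero_smul]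
    choose c hc using hab
    have hc0 : ∀ i, c i = 0 := by
      by_contra! h
      obtain ⟨i, hi⟩ := h
      obtain ⟨j, hj⟩ : ∃ j : Fin 4, j ≠ i := exists_ne i
      have h1 : algebraMap K A (c i) * b' j.succ = algebraMap K A (c j) * b' i.succ := by
        rw [← hc, ← hc]; ring
      have h2 := congrArg (fun x => s (x * b j.succ)) h1
      simp only [← Algebra.smul_def, smul_mul_assoc, map_smul, hrepr, b.repr_self] at h2
      rw [Finsupp.single_eq_same, Finsupp.single_eq_of_ne (by simpa using hj.symm)] at h2
      simp at h2
      exact hi h2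
    have ha : a = s (b' 0 * a) • (1 : A) := by
      conv_lhs => rw [hexp a]
      rw [Fin.sum_univ_succ, Finset.sum_eq_zero, add_zero, hb]
      intro j _
      rw [mul_comm, hc, hc0, map_zero, map_zero, zero_smul]
    have h1 := hc 0
    rw [hc0, map_zero, ha, smul_mul_assoc, one_mul] at h1
    apply hf0
    rcases smul_eq_zero.1 h1 with h | h
    · rw [ha, h, zero_smul, map_zero]
    · exact absurd h hb'ne
  have hker : Module.finrank K (LinearMap.ker μ) = 5 := by
    have := LinearMap.finrank_range_add_finrank_ker μ
    rw [hμ, finrank_top, hdimA, Module.finrank_fin_fun] at this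
    omega
  let ev : (Fin 10 → K) →ₗ[K] (A → K) := Fintype.linearCombination K fun p z =>
    s (b' (idx p).1.succ * z) * s (b' (idx p).2.succ * z)
  refine le_trans (Submodule.finrank_mono (t := (LinearMap.ker μ).map ev) ?_)
    ((Submodule.finrank_map_le ev _).trans hker.le)
  rw [Submodule.span_le]
  rintro _ ⟨⟨x, y⟩, rfl⟩
  simp only [SetLike.mem_coe, Submodule.mem_map, LinearMap.mem_ker]
  let β : A →ₗ[K] A →ₗ[K] K := LinearMap.mk₂ K (fun z z' => d ![x, y, z, y * z'])
    (fun _ _ _ => four_add₂ d _ _ _ _ _) (fun _ _ _ => four_smul₂ d _ _ _ _ _)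
    (fun _ _ _ => by rw [mul_add]; exact four_add₃ d _ _ _ _ _)
    (fun _ _ _ => by rw [mul_smul_comm]; exact four_smul₃ d _ _ _ _ _)
  have hβ : ∀ z z', β z z' = d ![x, y, z, y * z'] := fun _ _ => rfl
  have hβ0 : ∀ z, β (b 0) z = 0 := fun z => hd _ 2 hb
  have hβ0' : ∀ z, β z (b 0) = 0 := fun z => by
    rw [hβ, hb, mul_one, four_eq₁₃]
  -- Since `β` vanishes when either argument is 1, the quadratic map involves only the four
  -- coordinates of `z` other than that of 1, so it comes from ten coefficients.
  have hsum : ∀ z, d ![x, y, z, y * z] =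
      ∑ i : Fin 4, ∑ j : Fin 4, (s (b' i.succ * z) * s (b' j.succ * z)) *
        β (b i.succ) (b j.succ) := by
    intro z
    rw [← hβ]
    conv_lhs => rw [hexp z, Fin.sum_univ_succ]
    simp only [map_add, LinearMap.add_apply, map_sum, map_smul, LinearMap.sum_apply,
      LinearMap.smul_apply, smul_eq_mul, hβ0, hβ0', mul_zero, zero_add, Finset.sum_const_zero]
    rw [Finset.sum_congr rfl fun i _ => Finset.mul_sum _ _ _, Finset.sum_comm]
    refine Finset.sum_congr rfl fun i _ => Finset.sum_congr rfl fun j _ => ?_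
    ring
  -- These coefficients lie in the kernel of `μ`. After pairing with `a` under the Frobenius form
  -- and expanding `y a b'ᵢ` in the basis, the sum becomes one of a symmetric matrix against the
  -- alternating `d(x, y, bᵢ, bₖ)`.
  have hzero : ∑ i : Fin 4, ∑ j : Fin 4, β (b i.succ) (b j.succ) • (b' i.succ * b' j.succ) = 0 := by
    refine hs _ fun a => ?_
    have h5 : ∑ i : Fin 5, ∑ j : Fin 5, β (b i) (b j) * s (a * (b' i * b' j)) = 0 := by
      have h1 : ∀ i, ∑ j, β (b i) (b j) * s (a * (b' i * b' j)) = d ![x, y, b i, (y * a) * b' i] := by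
        intro i
        rw [mul_assoc, ← hβ, hexp (a * b' i), map_sum]
        refine Finset.sum_congr rfl fun j _ => ?_
        rw [map_smul, smul_eq_mul, mul_comm]
        congr 2
        ring
      have h2 : ∀ i, d ![x, y, b i, (y * a) * b' i] =
          ∑ k, s ((y * a) * (b' k * b' i)) * d ![x, y, b i, b k] := by
        intro i
        let δ : A →ₗ[K] K :=
          { toFun := fun v => d ![x, y, b i, v]
            map_add' := fun _ _ => four_add₃ d _ _ _ _ _
            map_smul' := fun _ _ => four_smul₃ d _ _ _ _ _ }
        change δ _ = ∑ k, _ * δ (b k)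
        rw [hexp ((y * a) * b' i), map_sum]
        refine Finset.sum_congr rfl fun j _ => ?_
        rw [map_smul, smul_eq_mul]
        congr 2
        ring
      simp only [h1, h2]
      refine sum_symm_mul_alt _ (fun i k => d ![x, y, b i, b k]) (fun i j => ?_) (fun i j => ?_)
        (fun i => ?_)
      · rw [mul_comm (b' j)]
      · exact four_swap₂₃ d _ _ _ _
      · exact four_eq₂₃ d _ _ _
    simp only [Fin.sum_univ_succ (n := 4), hβ0, hβ0', zero_mul, Finset.sum_const_zero, zero_add] at h5
    rw [Finset.sum_mul, map_sum, ← h5]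
    refine Finset.sum_congr rfl fun i _ => ?_
    rw [Finset.sum_mul, map_sum]
    refine Finset.sum_congr rfl fun j _ => ?_
    rw [smul_mul_assoc, map_smul, smul_eq_mul, mul_comm a]
  let G : Fin 4 → Fin 4 → K := fun i j => β (b i.succ) (b j.succ)
  refine ⟨![G 0 0, G 1 1, G 2 2, G 3 3, G 0 1 + G 1 0, G 0 2 + G 2 0, G 0 3 + G 3 0,
    G 1 2 + G 2 1, G 1 3 + G 3 1, G 2 3 + G 3 2], ?_, ?_⟩
  · rw [← hzero, ← sum_upper_triangle G (fun i j => b' i.succ * b' j.succ) fun i j => mul_comm _ _]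
    change ∑ p, _ • prod p = _
    refine Finset.sum_congr rfl fun p _ => ?_
    congr 1
    fin_cases p <;> rfl
  · ext z
    rw [hsum]
    have h := sum_upper_triangle G (fun i j => s (b' i.succ * z) * s (b' j.succ * z))
      fun i j => mul_comm _ _
    simp only [smul_eq_mul] at h
    simp only [mul_comm _ (β _ _)]
    refine Eq.trans ?_ h
    rw [Fintype.linearCombination_apply, Finset.sum_apply]
    refine Finset.sum_congr rfl fun p _ => ?_
    rw [Pi.smul_apply, smul_eq_mul]
    congr 1
    fin_cases p <;> rfl

end Frobenius

end

section

/-! ### What maximality gives: integral closedness, reducedness, locally principal maximal ideals.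
-/

section Maximal

open scoped nonZeroDivisors

variable {R : Type u} [CommRing R] {Q : Type v} [CommRing Q] [Algebra R Q]

variable (R Q) in
/-- The localization `K ⊗ Q` of an `R`-algebra `Q` at the nonzero elements of `R`. -/
abbrev GenericFiber : Type v := Localization (Algebra.algebraMapSubmonoid Q R⁰)

theorem IsLattice.isTorsionFree {n : ℕ} {M : Type w} [AddCommGroup M] [Module R M]
    (h : IsLattice R n M) : Module.IsTorsionFree R M :=
  have := h.projective
  inferInstance

variable [IsDedekindDomain R]

theorem isLattice_of_isTorsionFree {n : ℕ} {M : Type w} [AddCommGroup M] [Module R M]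
    [Module.Finite R M] [Module.IsTorsionFree R M] (h : Module.finrank R M = n) :
    IsLattice R n M where
  finite := inferInstance
  projective := by
    have := Module.finitePresentation_of_finite R M
    exact Module.Flat.projective_of_finitePresentation
  finrank_eq := h

/-- Adjoining `x` gives a finite torsion-free algebra of the same rank, hence a quintic ring
containing `Q`, which must equal `Q`. -/
theorem IsMaximalQuinticRing.mem_range_of_isIntegral (hQ : IsMaximalQuinticRing R Q)
    {x : GenericFiber R Q} (hx : IsIntegral Q x) :
    ∃ q, algebraMap Q _ q = x := by
  have := hQ.1.isTorsionFree
  have := hQ.1.finite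
  let T := GenericFiber R Q
  have htors : Module.IsTorsionFree R T := by
    refine Module.IsTorsionFree.of_smul_eq_zero fun r t h => ?_
    by_contra! hne
    have hu : IsUnit (algebraMap Q T (algebraMap R Q r)) :=
      IsLocalization.map_units T (⟨algebraMap R Q r, r, mem_nonZeroDivisors_of_ne_zero hne.1, rfl⟩ :
        Algebra.algebraMapSubmonoid Q R⁰)
    rw [Algebra.smul_def, IsScalarTower.algebraMap_apply R Q T] at h
    exact hne.2 (hu.mul_right_eq_zero.1 h)
  have hinj : Function.Injective (algebraMap Q T) := by
    refine IsLocalization.injective T (M := Algebra.algebraMapSubmonoid Q R⁰) ?_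
    rintro _ ⟨r, hr, rfl⟩
    rw [mem_nonZeroDivisors_iff_right]
    intro q hq
    rw [mul_comm, ← Algebra.smul_def] at hq
    exact (smul_eq_zero.1 hq).resolve_left (nonZeroDivisors.ne_zero hr)
  let Q' := Algebra.adjoin Q {x}
  have hfin : Module.Finite Q Q' := Module.Finite.iff_fg.2 hx.fg_adjoin_singleton
  have : Module.Finite R Q' := Module.Finite.trans Q Q'
  have : Module.IsTorsionFree R Q' := by
    refine Module.IsTorsionFree.of_smul_eq_zero fun r t h => ?_
    have := congrArg Subtype.val h
    rcases smul_eq_zero.1 (this : r • (t : T) = 0) with h | h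
    · exact Or.inl h
    · exact Or.inr (Subtype.ext h)
  let f : Q →ₐ[R] Q' := IsScalarTower.toAlgHom R Q Q'
  have hf : Function.Injective f := by
    intro a b hab
    exact hinj (congrArg Subtype.val hab)
  have hrank : Module.finrank R Q' = 5 := by
    have h1 := Submodule.finrank_quotient_add_finrank (LinearMap.range f.toLinearMap)
    rw [LinearMap.finrank_range_of_inj hf, hQ.1.finrank_eq] at h1
    rw [← h1, Nat.add_eq_right, Module.finrank_eq_zero_iff]
    intro z
    obtain ⟨z, rfl⟩ := Submodule.Quotient.mk_surjective _ z
    obtain ⟨q, ⟨_, c, hc, rfl⟩, hqc⟩ := IsLocalization.exists_mk'_eq (Algebra.algebraMapSubmonoid Q R⁰) (z : T)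
    refine ⟨c, nonZeroDivisors.ne_zero hc, ?_⟩
    rw [← Submodule.Quotient.mk_smul, Submodule.Quotient.mk_eq_zero]
    refine ⟨q, Subtype.ext ?_⟩
    change algebraMap Q T q = c • (z : T)
    rw [← hqc, Algebra.smul_def, IsScalarTower.algebraMap_apply R Q T]
    exact (IsLocalization.mk'_spec' T q _).symm
  obtain ⟨q, hq⟩ := hQ.2 Q' (isLattice_of_isTorsionFree hrank) f hf ⟨x, Algebra.self_mem_adjoin_singleton Q x⟩
  exact ⟨q, congrArg Subtype.val hq⟩

/-- If `b / c` is integral over the maximal ring `Q`, then `c` divides `b`. -/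
theorem IsMaximalQuinticRing.exists_eq_smul (hQ : IsMaximalQuinticRing R Q) {c : R} (hc : c ≠ 0)
    {b : Q} (h : ∀ x : GenericFiber R Q,
      c • x = algebraMap Q _ b → IsIntegral Q x) : ∃ q, b = c • q := by
  have := hQ.1.isTorsionFree
  let T := GenericFiber R Q
  have hmem : algebraMap R Q c ∈ Algebra.algebraMapSubmonoid Q R⁰ :=
    ⟨c, mem_nonZeroDivisors_of_ne_zero hc, rfl⟩
  have hx : c • IsLocalization.mk' T b ⟨_, hmem⟩ = algebraMap Q T b := by
    rw [Algebra.smul_def, IsScalarTower.algebraMap_apply R Q T]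
    exact IsLocalization.mk'_spec' T b ⟨_, hmem⟩
  obtain ⟨q, hq⟩ := hQ.mem_range_of_isIntegral (h _ hx)
  refine ⟨q, ?_⟩
  have hinj : Function.Injective (algebraMap Q T) := by
    refine IsLocalization.injective T (M := Algebra.algebraMapSubmonoid Q R⁰) ?_
    rintro _ ⟨r, hr, rfl⟩
    rw [mem_nonZeroDivisors_iff_right]
    intro q hq
    rw [mul_comm, ← Algebra.smul_def] at hq
    exact (smul_eq_zero.1 hq).resolve_left (nonZeroDivisors.ne_zero hr)
  apply hinj
  rw [← hx, ← hq, Algebra.smul_def, Algebra.smul_def, map_mul, IsScalarTower.algebraMap_apply R Q T]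

/-- If `x² = 0`, every `x / cⁿ` squares to 0 and is therefore integral, so `x` is divisible by all
powers of `c`. Taking `c` in a proper ideal, Krull's intersection theorem gives `x = 0`. -/
theorem IsMaximalQuinticRing.isReduced (hR : ¬ IsField R) (hQ : IsMaximalQuinticRing R Q) :
    IsReduced Q := by
  have := hQ.1.isTorsionFree
  have := hQ.1.finite
  obtain ⟨I, hI0, hI1⟩ := Ring.not_isField_iff_exists_ideal_bot_lt_and_lt_top.1 hR
  obtain ⟨c, hcI, hc0⟩ := Submodule.exists_mem_ne_zero_of_ne_bot hI0.ne'
  rw [isReduced_iff_pow_one_lt 2 one_lt_two]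
  intro x hx
  have hbot := Ideal.iInf_pow_smul_eq_bot_of_isTorsionFree (M := Q) I hI1.ne
  rw [← Submodule.mem_bot R, ← hbot, Submodule.mem_iInf]
  intro n
  obtain ⟨q, rfl⟩ := hQ.exists_eq_smul (pow_ne_zero n hc0) (b := x) fun y hy => by
    have hy2 : y ^ 2 = 0 := by
      have h1 : IsUnit (algebraMap R (GenericFiber R Q) (c ^ n)) := by
        rw [IsScalarTower.algebraMap_apply R Q]
        exact IsLocalization.map_units _ (⟨algebraMap R Q (c ^ n), _,
          mem_nonZeroDivisors_of_ne_zero (pow_ne_zero n hc0), rfl⟩ :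
          Algebra.algebraMapSubmonoid Q R⁰)
      rw [Algebra.smul_def] at hy
      have h2 := congrArg (· ^ 2) hy
      simp only [mul_pow, ← map_pow, hx, map_zero] at h2
      refine (IsUnit.mul_right_eq_zero ?_).1 h2
      rw [map_pow]
      exact h1.pow 2
    refine ⟨Polynomial.X ^ 2, Polynomial.monic_X_pow 2, ?_⟩
    simp [hy2]
  exact Submodule.smul_mem_smul (Ideal.pow_mem_pow hcI n) trivial

/-- The usual criterion for a discrete valuation ring: `n` is associated to `Q / c`, so `n` consists
of the `y` with `b y` in `c Q`. Either `b / c` carries some element of `n` outside `n`, and that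
element generates `n` locally, or `b / c` maps `n` into itself and is integral. -/
theorem IsMaximalQuinticRing.exists_local_generator (hQ : IsMaximalQuinticRing R Q)
    {p : Ideal R} (hp0 : p ≠ ⊥) {n : Ideal Q} (hn : n.IsMaximal)
    (hpn : p.map (algebraMap R Q) ≤ n) :
    ∃ a ∈ n, ∃ u ∉ n, ∀ y ∈ n, ∃ z, u * y = a * z := by
  have := hQ.1.isTorsionFree
  have := hQ.1.finite
  have : IsNoetherianRing Q := IsNoetherianRing.of_finite R Q
  obtain ⟨c, hcp, hc0⟩ := Submodule.exists_mem_ne_zero_of_ne_bot hp0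
  set I : Ideal Q := Ideal.span {algebraMap R Q c} with hI
  have hcn : algebraMap R Q c ∈ n := hpn (Ideal.mem_map_of_mem _ hcp)
  -- A prime of `Q` containing `c` lies over a nonzero prime of `R`, hence is maximal; so `n` is
  -- minimal over `c`, and therefore associated.
  have hmin : n ∈ I.minimalPrimes := by
    refine ⟨⟨hn.isPrime, (Ideal.span_singleton_le_iff_mem _).2 hcn⟩, ?_⟩
    rintro q ⟨hq, hIq⟩ hqn
    have hcq : c ∈ q.comap (algebraMap R Q) :=
      (Ideal.span_singleton_le_iff_mem (I := q)).1 hIq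
    have : (q.comap (algebraMap R Q)).IsMaximal :=
      (Ideal.IsPrime.isMaximal (Ideal.comap_isPrime _ _) fun h => hc0 (by rwa [h] at hcq))
    have hqm : q.IsMaximal := Ideal.isMaximal_of_isIntegral_of_isMaximal_comap q this
    exact (hqm.eq_of_le hn.ne_top hqn).ge
  have hass : n ∈ associatedPrimes Q (Q ⧸ I) := by
    apply Module.associatedPrimes.minimalPrimes_annihilator_subset_associatedPrimes
    rwa [Ideal.annihilator_quotient]
  obtain ⟨-, b, hb⟩ := Submodule.isAssociatedPrime_iff.1 hass
  obtain ⟨b, rfl⟩ := Ideal.Quotient.mk_surjective b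
  have hdvd : ∀ x : Q, x ∈ I ↔ ∃ z, x = c • z := fun x => by
    simp only [hI, Ideal.mem_span_singleton, Algebra.smul_def]
    rfl
  have hb' : ∀ y, y ∈ n ↔ ∃ z, b * y = c • z := by
    intro y
    rw [hb, Submodule.mem_colon_singleton, Submodule.mem_bot, ← hdvd, ← Ideal.Quotient.eq_zero_iff_mem,
      mul_comm]
    rfl
  by_cases hex : ∃ a ∈ n, ∃ u ∉ n, b * a = c • u
  · obtain ⟨a, ha, u, hu, hau⟩ := hex
    refine ⟨a, ha, u, hu, fun y hy => ?_⟩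
    obtain ⟨z, hz⟩ := (hb' y).1 hy
    refine ⟨z, ?_⟩
    have : c • (u * y) = c • (a * z) := by
      simp only [Algebra.smul_def] at hau hz ⊢
      linear_combination a * hz - y * hau
    exact smul_right_injective Q hc0 this
  · exfalso
    push Not at hex
    have hn1 : (1 : Q) ∉ n := (Ideal.ne_top_iff_one n).1 hn.ne_top
    obtain ⟨q, hq⟩ := hQ.exists_eq_smul hc0 (b := b) fun x hx => by
      choose f hf using fun y : n => (hb' y).1 y.2
      have hfn : ∀ y, f y ∈ n := fun y => by
        by_contra h
        exact hex y y.2 (f y) h (hf y)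
      let g : n →ₗ[Q] n :=
        { toFun := fun y => ⟨f y, hfn y⟩
          map_add' := fun y y' => by
            apply Subtype.ext
            apply smul_right_injective Q hc0
            simp only [Submodule.coe_add, smul_add, ← hf, mul_add]
          map_smul' := fun r y => by
            apply Subtype.ext
            apply smul_right_injective Q hc0
            change c • f (r • y) = c • (r * f y)
            rw [← mul_smul_comm, ← hf, ← hf, SetLike.val_smul, smul_eq_mul]
            ring }
      have hu : IsUnit (algebraMap R (GenericFiber R Q) c) := by
        rw [IsScalarTower.algebraMap_apply R Q]
        exact IsLocalization.map_units _ (⟨algebraMap R Q c, _,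
          mem_nonZeroDivisors_of_ne_zero hc0, rfl⟩ : Algebra.algebraMapSubmonoid Q R⁰)
      have hgx : ∀ y : n, algebraMap Q (GenericFiber R Q) (g y) = x * algebraMap Q _ y := by
        intro y
        apply hu.mul_left_cancel
        rw [← mul_assoc, ← Algebra.smul_def c x, hx, ← map_mul, hf, Algebra.smul_def, map_mul,
          ← IsScalarTower.algebraMap_apply]
        rfl
      -- Cayley–Hamilton for multiplication by `b / c` on `n`, tested on the nonzero scalar `c` in
      -- `n`. Integrality puts `b` in `c Q`, so `1` would be in `n`.
      obtain ⟨P, hP, hP0⟩ := LinearMap.exists_monic_and_aeval_eq_zero Q g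
      refine ⟨P, hP, ?_⟩
      have haeval : ∀ (P : Polynomial Q) (y : n), algebraMap Q (GenericFiber R Q)
          (Polynomial.aeval g P y : n) = Polynomial.aeval x P * algebraMap Q _ (y : Q) := by
        intro P
        induction P using Polynomial.induction_on' with
        | add p q hp hq =>
          intro y
          simp only [map_add, LinearMap.add_apply, Submodule.coe_add, hp, hq, add_mul]
        | monomial k r =>
          intro y
          simp only [Polynomial.aeval_monomial, Module.algebraMap_end_eq_smul_id,
            LinearMap.smul_apply, Module.End.mul_apply, LinearMap.id_apply, SetLike.val_smul,
            smul_eq_mul, map_mul, mul_assoc]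
          congr 1
          induction k generalizing y with
          | zero => simp
          | succ k ih => rw [pow_succ, Module.End.mul_apply, ih, hgx, pow_succ, mul_assoc]
      have := haeval P ⟨algebraMap R Q c, hcn⟩
      rw [hP0, LinearMap.zero_apply, Submodule.coe_zero, map_zero,
        ← IsScalarTower.algebraMap_apply, mul_comm] at this
      exact hu.mul_right_eq_zero.1 this.symm
    refine hn1 ((hb' 1).2 ⟨q, by rw [mul_one, hq]⟩)

end Maximal

end

section

/-! ### Lifting the generators from `Q / pQ` to `Q`. -/

section LocalCoordinates

variable {R : Type u} [CommRing R] [IsDedekindDomain R] {Q : Type v} [CommRing Q] [Algebra R Q]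

/-- The rank at the zero prime and the rank at `p` agree because the rank of a finite flat module
does not change under specialization. -/
theorem finrank_quotient_map_of_projective [Module.Finite R Q] [Module.Projective R Q] (p : Ideal R)
    [hp : p.IsMaximal] : Module.finrank (R ⧸ p) (Q ⧸ p.map (algebraMap R Q)) = Module.finrank R Q := by
  let := Ideal.Quotient.field p
  have h1 : Module.finrank (R ⧸ p) ((R ⧸ p) ⊗[R] Q) = Module.finrank R Q := by
    have h2 := Module.rankAtStalk_baseChange (R := R) (M := Q) (S := R ⧸ p) ⊥
    rw [Module.rankAtStalk_eq_finrank_of_free] at h2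
    have h3 := Module.rankAtStalk_baseChange (R := R) (M := Q) (S := FractionRing R) ⊥
    rw [Module.rankAtStalk_eq_finrank_of_free] at h3
    have h4 : Module.finrank (FractionRing R) (FractionRing R ⊗[R] Q) = Module.finrank R Q :=
      IsBaseChange.finrank_eq (TensorProduct.isBaseChange R Q (FractionRing R))
    have h5 := Module.rankAtStalk_eq_of_le_of_finite_of_flat Q (R := R)
      (bot_le : (⊥ : PrimeSpectrum R) ≤ PrimeSpectrum.comap (algebraMap R (R ⧸ p)) ⊥)
    have h6 : PrimeSpectrum.comap (algebraMap R (FractionRing R)) ⊥ = ⊥ := by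
      ext1
      exact (RingHom.ker_eq_bot_iff_eq_zero _).2 fun x hx =>
        (injective_iff_map_eq_zero _).1 (IsFractionRing.injective R (FractionRing R)) x hx
    rw [h6, h5] at h3
    rw [← h4]
    simp only [Pi.natCast_apply, Nat.cast_id] at h2 h3
    rw [h2, h3]
  rw [← h1]
  let e := TensorProduct.quotTensorEquivQuotSMul Q p
  have e2 : (Q ⧸ (p • ⊤ : Submodule R Q)) ≃ₗ[R] (Q ⧸ p.map (algebraMap R Q)) :=
    Submodule.quotEquivOfEq _ ((p.map (algebraMap R Q)).restrictScalars R)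
      (Ideal.smul_top_eq_map p) ≪≫ₗ
      Submodule.Quotient.restrictScalarsEquiv R _
  exact (LinearEquiv.finrank_eq (LinearEquiv.extendScalarsOfSurjective
    (S := R ⧸ p) Ideal.Quotient.mk_surjective (e ≪≫ₗ e2))).symm

/-- Local coordinates at `p` on a maximal quintic ring: elements `1, s, t, e, s t` that form a
basis modulo `p`, with the coordinates scaled by some `r` outside `p`. -/
theorem exists_local_coordinates (hR : ¬ IsField R) (hQ : IsMaximalQuinticRing R Q)
    (p : Ideal R) [hp : p.IsMaximal] :
    ∃ (s t e : Q) (r : R) (c : Fin 5 → Q →ₗ[R] R), r ∉ p ∧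
      (∀ q, r • q = ∑ i, c i q • (![1, s, t, e, s * t] : Fin 5 → Q) i) ∧
      (∀ i j, c i ((![1, s, t, e, s * t] : Fin 5 → Q) j) = if i = j then r else 0) ∧
      c 4 (s * s) ∈ p := by
  have hproj := hQ.1.projective
  have hfin := hQ.1.finite
  have := hQ.1.isTorsionFree
  have hp0 : p ≠ ⊥ := Ring.ne_bot_of_isMaximal_of_not_isField hp hR
  have hdim := finrank_quotient_map_of_projective (Q := Q) p
  rw [hQ.1.finrank_eq] at hdim
  let := Ideal.Quotient.field p
  let I := p.map (algebraMap R Q)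
  obtain ⟨s', t', e', hli, hsq⟩ := exists_generators (k := R ⧸ p) (A := Q ⧸ I) hdim fun n hn => by
    have hnc : (n.comap (Ideal.Quotient.mk I)).IsMaximal :=
      Ideal.comap_isMaximal_of_surjective _ Ideal.Quotient.mk_surjective
    obtain ⟨a, ha, u, hu, h⟩ := hQ.exists_local_generator hp0 hnc (by
      intro x hx
      rw [Ideal.mem_comap, Ideal.Quotient.eq_zero_iff_mem.2 hx]
      exact zero_mem _)
    refine ⟨_, ha, _, hu, fun y hy => ?_⟩
    obtain ⟨y, rfl⟩ := Ideal.Quotient.mk_surjective y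
    obtain ⟨z, hz⟩ := h y hy
    exact ⟨Ideal.Quotient.mk I z, by rw [← map_mul, hz, map_mul]⟩
  obtain ⟨s, rfl⟩ := Ideal.Quotient.mk_surjective s'
  obtain ⟨t, rfl⟩ := Ideal.Quotient.mk_surjective t'
  obtain ⟨e, rfl⟩ := Ideal.Quotient.mk_surjective e'
  set b : Fin 5 → Q := ![1, s, t, e, s * t] with hb
  have hbm : (![1, Ideal.Quotient.mk I s, Ideal.Quotient.mk I t, Ideal.Quotient.mk I e,
      Ideal.Quotient.mk I s * Ideal.Quotient.mk I t] : Fin 5 → Q ⧸ I) =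
      fun i => Ideal.Quotient.mk I (b i) := by
    ext i
    fin_cases i <;> simp [hb]
  rw [hbm] at hli
  have hspan : Submodule.span (R ⧸ p) (Set.range fun i => Ideal.Quotient.mk I (b i)) = ⊤ :=
    hli.span_eq_top_of_card_eq_finrank' (by rw [hdim]; rfl)
  set Φ := Fintype.linearCombination R b with hΦ
  have hsmul : ∀ (c : R) (x : Q), Ideal.Quotient.mk I (c • x) =
      Ideal.Quotient.mk p c • Ideal.Quotient.mk I x := fun c x => rfl
  have hsup : (⊤ : Submodule R Q) ≤ LinearMap.range Φ ⊔ p • ⊤ := by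
    intro q _
    have hq : Ideal.Quotient.mk I q ∈ (⊤ : Submodule (R ⧸ p) (Q ⧸ I)) := trivial
    rw [← hspan] at hq
    obtain ⟨g, hg⟩ := (Submodule.mem_span_range_iff_exists_fun _).1 hq
    choose g' hg' using fun i => Ideal.Quotient.mk_surjective (g i)
    have : q - Φ g' ∈ I := by
      rw [← Ideal.Quotient.eq_zero_iff_mem, map_sub, ← hg, hΦ, Fintype.linearCombination_apply,
        map_sum, sub_eq_zero]
      simp only [hsmul, hg']
    rw [← sub_add_cancel q (Φ g'), add_comm, Ideal.smul_top_eq_map]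
    exact Submodule.add_mem_sup ⟨g', rfl⟩ this
  -- Nakayama: some `r ≡ 1` modulo `p` carries `Q` into the span of the lifts. Inverting `r` instead
  -- of localizing keeps all coordinates in `R`.
  obtain ⟨r, hrp, hr⟩ := Submodule.exists_sub_one_mem_and_smul_le_of_fg_of_le_sup
    (I := p) (N' := ⊤) (N := LinearMap.range Φ) hfin.1 le_rfl hsup
  have hrange : ∀ q, r • q ∈ LinearMap.range Φ := fun q =>
    hr (Submodule.smul_mem_pointwise_smul q r ⊤ trivial)
  have hrp' : r ∉ p := fun h => by
    apply (Ideal.ne_top_iff_one p).1 hp.ne_top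
    have := sub_mem h hrp
    rwa [sub_sub_cancel] at this
  have hr0 : r ≠ 0 := fun h => hrp' (h ▸ zero_mem p)
  -- The span contains `r Q`, so it has rank at least five and the kernel has rank zero inside a
  -- torsion-free module.
  have hker : LinearMap.ker Φ = ⊥ := by
    have h1 := Submodule.finrank_quotient_add_finrank (LinearMap.ker Φ)
    rw [Module.finrank_fin_fun, Φ.quotKerEquivRange.finrank_eq] at h1
    have h2 : 5 ≤ Module.finrank R (LinearMap.range Φ) := by
      refine hQ.1.finrank_eq.symm.trans_le ?_
      let m : Q →ₗ[R] LinearMap.range Φ := LinearMap.codRestrict _ (LinearMap.lsmul R Q r) hrange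
      refine LinearMap.finrank_le_finrank_of_injective (f := m) ?_
      intro x y hxy
      exact smul_right_injective Q hr0 (congrArg Subtype.val hxy)
    have h3 : Module.finrank R (LinearMap.ker Φ) = 0 := by omega
    rw [Module.finrank_eq_zero_iff] at h3
    rw [eq_bot_iff]
    intro x hx
    obtain ⟨a, ha, hax⟩ := h3 ⟨x, hx⟩
    have := congrArg Subtype.val hax
    exact (smul_eq_zero.1 this).resolve_left ha
  have hinj := LinearMap.ker_eq_bot.1 hker
  let c : Q →ₗ[R] (Fin 5 → R) := (LinearEquiv.ofInjective Φ hinj).symm.toLinearMap ∘ₗ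
    LinearMap.codRestrict _ (LinearMap.lsmul R Q r) hrange
  have hc : ∀ q, Φ (c q) = r • q := fun q =>
    congrArg Subtype.val ((LinearEquiv.ofInjective Φ hinj).apply_symm_apply ⟨r • q, hrange q⟩)
  have hcoord : ∀ q, r • q = ∑ i, c q i • b i := fun q => by
    rw [← hc, hΦ, Fintype.linearCombination_apply]
  refine ⟨s, t, e, r, fun i => LinearMap.proj i ∘ₗ c, hrp', hcoord, ?_, ?_⟩
  · intro i j
    have : c (b j) = Pi.single j r := hinj (by
      rw [hc, hΦ, Fintype.linearCombination_apply_single])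
    change c (b j) i = _
    rw [this, Pi.single_apply]
  · have h1 := congrArg (Ideal.Quotient.mk I) (hcoord (s * s))
    rw [hsmul, map_sum, map_mul] at h1
    simp only [hsmul] at h1
    rw [show ({1, Ideal.Quotient.mk I s, Ideal.Quotient.mk I t, Ideal.Quotient.mk I e} : Set (Q ⧸ I)) =
      Set.range ![Ideal.Quotient.mk I (b 0), Ideal.Quotient.mk I (b 1), Ideal.Quotient.mk I (b 2),
        Ideal.Quotient.mk I (b 3)] by
        ext x
        simp only [Set.mem_insert_iff, Set.mem_singleton_iff, Set.mem_range, Fin.exists_fin_succ,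
          IsEmpty.exists_iff, or_false, eq_comm (b := x)]
        rfl] at hsq
    obtain ⟨g, hg⟩ := (Submodule.mem_span_range_iff_exists_fun _).1 hsq
    rw [← hg, Fin.sum_univ_four, Fin.sum_univ_five] at h1
    rw [Fintype.linearIndependent_iff] at hli
    have h4 := hli ![Ideal.Quotient.mk p (c (s * s) 0) - Ideal.Quotient.mk p r * g 0,
      Ideal.Quotient.mk p (c (s * s) 1) - Ideal.Quotient.mk p r * g 1,
      Ideal.Quotient.mk p (c (s * s) 2) - Ideal.Quotient.mk p r * g 2,
      Ideal.Quotient.mk p (c (s * s) 3) - Ideal.Quotient.mk p r * g 3,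
      Ideal.Quotient.mk p (c (s * s) 4)] (by
        rw [Fin.sum_univ_five]
        simp only [Matrix.cons_val] at h1 ⊢
        rw [eq_comm, ← sub_eq_zero] at h1
        rw [← h1]
        module) 4
    exact Ideal.Quotient.eq_zero_iff_mem.1 h4

end LocalCoordinates

end

section

/-! ### Local-global principles and modules that are locally generated by one element. -/

section LocallyCyclic

variable {R : Type u} [CommRing R]

/-- The gluing principle of the whole proof: apart from its use on elements, it is applied to ideals
of scalars for which a construction can be carried out. -/
theorem exists_mem_of_forall_maximal (I : Ideal R)
    (h : ∀ p : Ideal R, p.IsMaximal → ∃ r ∈ I, r ∉ p) : I = ⊤ := by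
  by_contra hI
  obtain ⟨p, hp, hle⟩ := Ideal.exists_le_maximal I hI
  obtain ⟨r, hr, hrp⟩ := h p hp
  exact hrp (hle hr)

theorem mem_of_forall_maximal {M : Type w} [AddCommGroup M] [Module R M] (N : Submodule R M) (x : M)
    (h : ∀ p : Ideal R, p.IsMaximal → ∃ r, r ∉ p ∧ r • x ∈ N) : x ∈ N := by
  have := exists_mem_of_forall_maximal (N.comap (LinearMap.toSpanSingleton R M x)) fun p hp => by
    obtain ⟨r, hr, hx⟩ := h p hp
    exact ⟨r, hx, hr⟩
  have h1 : (1 : R) ∈ N.comap (LinearMap.toSpanSingleton R M x) := this ▸ trivial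
  simpa using h1

theorem eq_zero_of_forall_maximal {M : Type w} [AddCommGroup M] [Module R M] (x : M)
    (h : ∀ p : Ideal R, p.IsMaximal → ∃ r, r ∉ p ∧ r • x = 0) : x = 0 :=
  (Submodule.mem_bot R).1 (mem_of_forall_maximal ⊥ x (by simpa only [Submodule.mem_bot] using h))

/-- `f` is a coordinate on `M` with respect to `m`, up to the scalar `r`. -/
def IsCoordinate {M : Type w} [AddCommGroup M] [Module R M] (m : M) (f : M →ₗ[R] R) (r : R) : Prop :=
  ∀ x, f x • m = r • x

/-- A module that is generated by one element locally at each maximal ideal, with a coordinate. -/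
def IsLocallyCyclic (R : Type u) [CommRing R] (M : Type w) [AddCommGroup M] [Module R M] : Prop :=
  ∀ p : Ideal R, p.IsMaximal → ∃ (m : M) (f : M →ₗ[R] R) (r : R), r ∉ p ∧ IsCoordinate m f r

/-- The product of two linear forms, as a linear form on the tensor product. -/
def tensorForm {M : Type w₁} [AddCommMonoid M] [Module R M] {N : Type w₂} [AddCommMonoid N]
    [Module R N] (f : M →ₗ[R] R) (g : N →ₗ[R] R) : M ⊗[R] N →ₗ[R] R :=
  LinearMap.mul' R R ∘ₗ TensorProduct.map f g

@[simp] theorem tensorForm_tmul {M : Type w₁} [AddCommMonoid M] [Module R M] {N : Type w₂}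
    [AddCommMonoid N] [Module R N] (f : M →ₗ[R] R) (g : N →ₗ[R] R) (x : M) (y : N) :
    tensorForm f g (x ⊗ₜ y) = f x * g y := rfl

theorem IsCoordinate.tensor {M : Type w₁} [AddCommGroup M] [Module R M] {N : Type w₂}
    [AddCommGroup N] [Module R N] {m : M} {f : M →ₗ[R] R} {a : R} {n : N} {g : N →ₗ[R] R} {b : R}
    (hf : IsCoordinate m f a) (hg : IsCoordinate n g b) :
    IsCoordinate (m ⊗ₜ[R] n) (tensorForm f g) (a * b) := by
  intro x
  induction x with
  | zero => simp
  | add x y hx hy => rw [map_add, add_smul, hx, hy, smul_add]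
  | tmul x y =>
    rw [tensorForm_tmul, ← TensorProduct.smul_tmul_smul, ← TensorProduct.smul_tmul_smul, hf, hg]

theorem IsLocallyCyclic.tensor {M : Type w₁} [AddCommGroup M] [Module R M] {N : Type w₂}
    [AddCommGroup N] [Module R N] (hM : IsLocallyCyclic R M) (hN : IsLocallyCyclic R N) :
    IsLocallyCyclic R (M ⊗[R] N) := by
  intro p hp
  obtain ⟨m, f, a, ha, hf⟩ := hM p hp
  obtain ⟨n, g, b, hb, hg⟩ := hN p hp
  exact ⟨_, _, _, fun h => (hp.isPrime.mem_or_mem h).elim ha hb, hf.tensor hg⟩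

theorem IsLocallyCyclic.isTorsionFree [IsDomain R] {M : Type w} [AddCommGroup M] [Module R M]
    (hM : IsLocallyCyclic R M) : Module.IsTorsionFree R M := by
  refine Module.IsTorsionFree.of_smul_eq_zero fun r x hrx => ?_
  by_contra! hne
  refine hne.2 (eq_zero_of_forall_maximal (R := R) x fun p hp => ?_)
  obtain ⟨m, f, a, ha, hf⟩ := hM p hp
  refine ⟨a, ha, ?_⟩
  have h0 : r * f x = 0 := by rw [← smul_eq_mul, ← map_smul, hrx, map_zero]
  rw [← hf, (mul_eq_zero.1 h0).resolve_left hne.1, zero_smul]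

theorem IsCoordinate.eq_zero [IsDomain R] {M : Type w} [AddCommGroup M] [Module R M]
    [Module.IsTorsionFree R M] {m : M} {f : M →ₗ[R] R} {a : R} (hf : IsCoordinate m f a)
    (ha : a ≠ 0) {x : M} (hx : f x = 0) : x = 0 := by
  have := hf x
  rw [hx, zero_smul, eq_comm] at this
  exact (smul_eq_zero.1 this).resolve_left ha

theorem IsCoordinate.ext [IsDomain R] {M : Type w} [AddCommGroup M] [Module R M]
    [Module.IsTorsionFree R M] {m : M} {f : M →ₗ[R] R} {a : R} (hf : IsCoordinate m f a)
    (ha : a ≠ 0) {x y : M} (hxy : f x = f y) : x = y :=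
  sub_eq_zero.1 (hf.eq_zero ha (by rw [map_sub, hxy, sub_self]))

end LocallyCyclic

theorem _root_.AlternatingMap.eq_det_smul {R : Type u} [CommRing R] {N : Type w} [AddCommGroup N]
    [Module R N] {n : ℕ} (F : (Fin n → R) [⋀^Fin n]→ₗ[R] N) (v : Fin n → Fin n → R) :
    F v = Matrix.det (Matrix.of v) • F fun i => Pi.single i 1 := by
  have h : F = (LinearMap.toSpanSingleton R N (F fun i => Pi.single i 1)).compAlternatingMap
      Matrix.detRowAlternating := by
    refine Module.Basis.ext_alternating (Pi.basisFun R (Fin n)) fun i hi => ?_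
    let σ : Equiv.Perm (Fin n) := Equiv.ofBijective i hi.bijective_of_finite
    have h1 : (fun j => Pi.basisFun R (Fin n) (i j)) =
        (fun j => (Pi.single j 1 : Fin n → R)) ∘ σ := by
      ext j : 1
      simp [σ]
    rw [h1, AlternatingMap.map_perm, LinearMap.compAlternatingMap_apply, AlternatingMap.map_perm]
    have h2 : Matrix.detRowAlternating (fun j : Fin n => (Pi.single j 1 : Fin n → R)) = 1 := by
      refine Eq.trans ?_ (Matrix.det_one (n := Fin n) (R := R))
      change Matrix.det _ = _
      congr 1
      ext a b
      simp [Pi.single_apply, Matrix.one_apply, eq_comm]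
    rw [h2]
    simp
  exact DFunLike.congr_fun h v

/-! ### The form on `Q` with values in `⋀⁴ L`, the quadratic maps, and frames at a prime. -/

section TopForm

variable (R : Type u) [CommRing R] (Q : Type v) [CommRing Q] [Algebra R Q]

/-- The alternating form `(x, y, z, t) ↦ x ∧ y ∧ z ∧ t` on `Q`, with values in `⋀⁴ L`. -/
def topForm : Q [⋀^Fin 4]→ₗ[R] TopL R Q :=
  (exteriorPower.ιMulti R 4).compLinearMap (Submodule.mkQ _)

variable {R Q}

theorem topForm_apply (x y z t : Q) : topForm R Q ![x, y, z, t] =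
    wedge₄ (quotMk R x) (quotMk R y) (quotMk R z) (quotMk R t) := by
  rw [topForm, AlternatingMap.compLinearMap_apply, wedge₄]
  congr 1
  ext i
  fin_cases i <;> rfl

theorem topForm_eq_zero {x : Fin 4 → Q} {i : Fin 4} (h : x i = 1) : topForm R Q x = 0 := by
  rw [topForm, AlternatingMap.compLinearMap_apply]
  refine AlternatingMap.map_coord_zero _ i ?_
  rw [h]
  exact (Submodule.Quotient.mk_eq_zero _).2 ⟨1, (algebraMap R Q).map_one⟩

/-- The quadratic map `z ↦ x ∧ y ∧ z ∧ y z`, as a function. -/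
def wedgeQuad (x y : Q) (z : Q) : TopL R Q := topForm R Q ![x, y, z, y * z]

theorem wedgeQuad_apply (x y z : Q) : wedgeQuad (R := R) x y z = topForm R Q ![x, y, z, y * z] := rfl

variable (R Q) in
/-- The module of quadratic maps spanned by the `z ↦ x ∧ y ∧ z ∧ y z`. -/
def quadModule : Submodule R (Q → TopL R Q) :=
  Submodule.span R (Set.range fun p : Q × Q => wedgeQuad p.1 p.2)

theorem wedgeQuad_mem (x y : Q) : wedgeQuad x y ∈ quadModule R Q :=
  Submodule.subset_span ⟨(x, y), rfl⟩

theorem exists_quadraticMap {F : Q → TopL R Q} (hF : F ∈ quadModule R Q) :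
    ∃ q : QuadraticMap R Q (TopL R Q), ⇑q = F := by
  induction hF using Submodule.span_induction with
  | mem _ h =>
    obtain ⟨⟨x, y⟩, rfl⟩ := h
    exact ⟨LinearMap.BilinMap.toQuadraticMap
      (LinearMap.mk₂ R (fun z z' => topForm R Q ![x, y, z, y * z'])
      (fun _ _ _ => four_add₂ _ _ _ _ _ _) (fun _ _ _ => four_smul₂ _ _ _ _ _ _)
      (fun _ _ _ => by rw [mul_add]; exact four_add₃ _ _ _ _ _ _)
      (fun _ _ _ => by rw [mul_smul_comm]; exact four_smul₃ _ _ _ _ _ _)), rfl⟩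
  | zero => exact ⟨0, rfl⟩
  | add _ _ _ _ h h' =>
    obtain ⟨q, rfl⟩ := h
    obtain ⟨q', rfl⟩ := h'
    exact ⟨q + q', rfl⟩
  | smul r _ _ h =>
    obtain ⟨q, rfl⟩ := h
    exact ⟨r • q, rfl⟩

/-- The elements `s, t, e` of `Q` give a basis `1, s, t, e, s t` of `Q` locally at `p`, and `s²` has
no component along `s t` modulo `p`; the coordinate `δ` on `⋀⁴ L` is scaled by `r`. -/
structure PreFrame (p : Ideal R) where
  s : Q
  t : Q
  e : Q
  a : R
  c : Fin 5 → Q →ₗ[R] R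
  a_notMem : a ∉ p
  smul_eq : ∀ q, a • q = ∑ i, c i q • (![1, s, t, e, s * t] : Fin 5 → Q) i
  c_apply : ∀ i j, c i ((![1, s, t, e, s * t] : Fin 5 → Q) j) = if i = j then a else 0
  c_sq : c 4 (s * s) ∈ p

namespace PreFrame

variable {p : Ideal R} (X : PreFrame (Q := Q) p)

/-- The coordinates on `L` attached to `s, t, e, s t`. -/
def coord (i : Fin 4) : QuotMod R Q →ₗ[R] R :=
  Submodule.liftQ _ (X.c i.succ) (by
    rintro _ ⟨r, rfl⟩
    have : X.c i.succ 1 = 0 := (X.c_apply i.succ 0).trans (if_neg (Fin.succ_ne_zero i))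
    rw [LinearMap.mem_ker, Algebra.linearMap_apply, Algebra.algebraMap_eq_smul_one, map_smul, this,
      smul_zero])

/-- The coordinate on `⋀⁴ L`. -/
def δ : TopL R Q →ₗ[R] R :=
  exteriorPower.alternatingMapLinearEquiv
    (Matrix.detRowAlternating.compLinearMap (LinearMap.pi X.coord))

/-- The scale of the coordinate `δ`. -/
def r : R := X.a ^ 4

/-- The local generator `s ∧ t ∧ e ∧ s t` of `⋀⁴ L`. -/
def D : TopL R Q := topForm R Q ![X.s, X.t, X.e, X.s * X.t]

theorem δ_topForm (x : Fin 4 → Q) :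
    X.δ (topForm R Q x) = Matrix.det (Matrix.of fun j (i : Fin 4) => X.c i.succ (x j)) := by
  rw [δ, topForm, AlternatingMap.compLinearMap_apply,
    exteriorPower.alternatingMapLinearEquiv_apply_ιMulti]
  rfl

theorem δ_topForm_of_mem (u : Q) : X.δ (topForm R Q ![X.s, X.t, X.e, u]) = X.a ^ 3 * X.c 4 u := by
  have hs := fun i => X.c_apply i 1
  have ht := fun i => X.c_apply i 2
  have he := fun i => X.c_apply i 3
  simp only [Matrix.cons_val] at hs ht he
  rw [δ_topForm]
  simp [Matrix.det_succ_row_zero, Fin.sum_univ_succ, hs, ht, he, Fin.succAbove]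
  ring

theorem r_notMem [hp : p.IsPrime] : X.r ∉ p := fun h => X.a_notMem (hp.mem_of_pow_mem _ h)

theorem δ_D : X.δ X.D = X.r := by
  have h4 := X.c_apply 4 4
  simp only [Matrix.cons_val, if_true] at h4
  rw [D, δ_topForm_of_mem, h4, r]
  ring

/-- After scaling each of the four vectors by `a`, they are combinations of `s, t, e, s t` modulo
scalars, and the alternating form becomes a determinant. Hence `r = a⁴`. -/
theorem isCoordinate : IsCoordinate X.D X.δ X.r := by
  have h : LinearMap.toSpanSingleton R _ X.D ∘ₗ X.δ = X.r • LinearMap.id := by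
    apply exteriorPower.linearMap_ext
    ext m : 1
    choose x hx using fun j => Submodule.mkQ_surjective _ (m j)
    obtain rfl : (fun j => Submodule.mkQ _ (x j)) = m := funext hx
    change X.δ (topForm R Q x) • X.D = X.r • topForm R Q x
    let g : (Fin 4 → R) →ₗ[R] Q := Fintype.linearCombination R ![X.s, X.t, X.e, X.s * X.t]
    have hg : ∀ y : Q, X.a • y = X.c 0 y • 1 + g (fun i => X.c i.succ y) := by
      intro y
      rw [X.smul_eq, Fin.sum_univ_succ, Fintype.linearCombination_apply]
      congr 1
    have h1 : X.r • topForm R Q x = topForm R Q fun j => g (fun i => X.c i.succ (x j)) := by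
      have := (topForm R Q).toMultilinearMap.map_smul_univ (fun _ => X.a) x
      rw [Finset.prod_const, Finset.card_univ, Fintype.card_fin] at this
      rw [r]
      refine this.symm.trans ?_
      rw [topForm]
      simp only [AlternatingMap.coe_multilinearMap, AlternatingMap.compLinearMap_apply]
      congr 1
      ext j
      rw [hg, map_add, add_eq_right, map_smul]
      have : Submodule.mkQ (LinearMap.range (Algebra.linearMap R Q)) (1 : Q) = 0 :=
        (Submodule.Quotient.mk_eq_zero _).2 ⟨1, (algebraMap R Q).map_one⟩
      rw [this, smul_zero]
    rw [h1, X.δ_topForm]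
    refine Eq.trans ?_ (((topForm R Q).compLinearMap g).eq_det_smul
      fun j (i : Fin 4) => X.c i.succ (x j)).symm
    congr 1
    rw [D, AlternatingMap.compLinearMap_apply]
    congr 1
    ext i
    fin_cases i <;> simp [g]
  exact fun x => LinearMap.congr_fun h x

end PreFrame

end TopForm

end

section

/-! ### Five functionals on quadratic maps and the dual family. -/

section EvalFive

variable {R : Type u} [CommRing R] {Q : Type v} [AddCommGroup Q]
variable {N : Type w₁} [AddCommGroup N] [Module R N] {N' : Type w₂} [AddCommGroup N'] [Module R N']

variable (R) in
/-- The five functionals `F ↦ F s, F t, F (e, s), F (e, t), F (t, s)` on quadratic maps, written for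
functions `F` that vanish at `0`; here `F (x, y)` is the polar form. -/
def evalFive (s t e : Q) (i : Fin 5) : (Q → N) →ₗ[R] N :=
  LinearMap.proj (R := R) (φ := fun _ : Q => N) ((![s, t, e + s, e + t, t + s] : Fin 5 → Q) i) -
    LinearMap.proj (R := R) (φ := fun _ : Q => N) ((![0, 0, e, e, t] : Fin 5 → Q) i) -
    LinearMap.proj (R := R) (φ := fun _ : Q => N) ((![0, 0, s, t, s] : Fin 5 → Q) i)

theorem evalFive_apply (s t e : Q) (i : Fin 5) (F : Q → N) : evalFive R s t e i F =
    F ((![s, t, e + s, e + t, t + s] : Fin 5 → Q) i) - F ((![0, 0, e, e, t] : Fin 5 → Q) i) -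
      F ((![0, 0, s, t, s] : Fin 5 → Q) i) := rfl

theorem evalFive_swap {s t e : Q} {B : Q → Q → N} (hB : ∀ y z, B y z = -B z y) (i j : Fin 5) :
    evalFive R s t e i (fun y => evalFive R s t e j fun z => B y z) =
      -evalFive R s t e j (fun y => evalFive R s t e i fun z => B y z) := by
  simp only [evalFive_apply]
  generalize (![s, t, e + s, e + t, t + s] : Fin 5 → Q) = u
  generalize (![0, 0, e, e, t] : Fin 5 → Q) = v
  generalize (![0, 0, s, t, s] : Fin 5 → Q) = w
  rw [hB (u i) (u j), hB (u i) (v j), hB (u i) (w j), hB (v i) (u j), hB (v i) (v j),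
    hB (v i) (w j), hB (w i) (u j), hB (w i) (v j), hB (w i) (w j)]
  abel

theorem evalFive_self {s t e : Q} {B : Q → Q → N} (hB : ∀ y z, B y z = -B z y)
    (hB' : ∀ y, B y y = 0) (i : Fin 5) :
    evalFive R s t e i (fun y => evalFive R s t e i fun z => B y z) = 0 := by
  simp only [evalFive_apply]
  generalize (![s, t, e + s, e + t, t + s] : Fin 5 → Q) = u
  generalize (![0, 0, e, e, t] : Fin 5 → Q) = v
  generalize (![0, 0, s, t, s] : Fin 5 → Q) = w
  rw [hB (v i) (u i), hB (w i) (u i), hB (w i) (v i), hB', hB', hB']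
  abel

end EvalFive

variable {R : Type u} [CommRing R] {Q : Type v} [CommRing Q] [Algebra R Q]

theorem wedgeQuad_swap (x y z : Q) : wedgeQuad (R := R) x y z = -wedgeQuad x z y := by
  rw [wedgeQuad_apply, wedgeQuad_apply, mul_comm z y, ← four_swap₁₂]

theorem wedgeQuad_self_left (x y : Q) : wedgeQuad (R := R) x y x = 0 :=
  (wedgeQuad_apply _ _ _).trans (four_eq₀₂ _ _ _ _)

theorem wedgeQuad_self (x y : Q) : wedgeQuad (R := R) x x y = 0 :=
  (wedgeQuad_apply _ _ _).trans (four_eq₀₁ _ _ _ _)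

theorem wedgeQuad_self_right (x y : Q) : wedgeQuad (R := R) x y y = 0 :=
  (wedgeQuad_apply _ _ _).trans (four_eq₁₂ _ _ _ _)

theorem wedgeQuad_zero_right (x y : Q) : wedgeQuad (R := R) x y 0 = 0 :=
  (wedgeQuad_apply _ _ _).trans ((topForm R Q).map_coord_zero 2 rfl)

theorem det_skew_four (A : Matrix (Fin 4) (Fin 4) R) (h : ∀ i, A i i = 0)
    (h' : ∀ i j, A i j = -A j i) :
    A.det = (A 0 1 * A 2 3 - A 0 2 * A 1 3 + A 0 3 * A 1 2) ^ 2 := by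
  have h10 := h' 1 0
  have h20 := h' 2 0
  have h30 := h' 3 0
  have h21 := h' 2 1
  have h31 := h' 3 1
  have h32 := h' 3 2
  simp [Matrix.det_succ_row_zero, Fin.sum_univ_succ, Fin.succAbove, h, h10, h20, h30, h21, h31, h32]
  ring

namespace PreFrame

variable {p : Ideal R} (X : PreFrame (Q := Q) p)

/-- The five functionals attached to `s, t, e`. -/
abbrev ev {N : Type w} [AddCommGroup N] [Module R N] (i : Fin 5) : (Q → N) →ₗ[R] N :=
  evalFive R X.s X.t X.e i

/-- The form `x ∧ y ∧ z ∧ y z` in the coordinate `δ`. -/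
def τ (x y z : Q) : R := X.δ (wedgeQuad x y z)

theorem τ_swap (x y z : Q) : X.τ x y z = -X.τ x z y := by
  rw [τ, wedgeQuad_swap, map_neg, τ]

/-- The skew-symmetric matrix of `(y, z) ↦ x ∧ y ∧ z ∧ y z`. -/
def Φ (x : Q) : Matrix (Fin 5) (Fin 5) R :=
  Matrix.of fun i j => X.ev i fun y => X.ev j fun z => X.τ x y z

theorem Φ_swap (x : Q) (i j : Fin 5) : X.Φ x i j = -X.Φ x j i :=
  evalFive_swap (X.τ_swap x) i j

theorem Φ_self (x : Q) (i : Fin 5) : X.Φ x i i = 0 :=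
  evalFive_self (X.τ_swap x) (fun y => by rw [τ, wedgeQuad_self_right, map_zero]) i

/-- Five quadratic maps in `quadModule R Q`. -/
def ρ : Fin 5 → Q → TopL R Q :=
  Fin.cons (wedgeQuad X.e X.t) fun i : Fin 4 => X.ev i.succ fun y => wedgeQuad X.s y

theorem ev_mem (x : Q) (i : Fin 5) : (X.ev i fun y => wedgeQuad x y) ∈ quadModule R Q := by
  rw [evalFive_apply]
  exact sub_mem (sub_mem (wedgeQuad_mem _ _) (wedgeQuad_mem _ _)) (wedgeQuad_mem _ _)

theorem ρ_mem (i : Fin 5) : X.ρ i ∈ quadModule R Q := by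
  refine Fin.cases ?_ (fun i => ?_) i
  · exact wedgeQuad_mem _ _
  · exact X.ev_mem _ _

/-- The matrix of values of the five functionals on the maps `ρ`. -/
def Ψ : Matrix (Fin 5) (Fin 5) R := Matrix.of fun i j => X.ev j fun z => X.δ (X.ρ i z)

/-- The last four maps `ρ` arise from the same functionals as the columns; this makes the lower part
of `Ψ` skew. -/
theorem Ψ_succ (i : Fin 4) (j : Fin 5) : X.Ψ i.succ j = X.Φ X.s i.succ j := by
  change X.ev j (fun z => X.δ ((X.ev i.succ fun y => wedgeQuad X.s y) z)) = _
  rw [Φ, Matrix.of_apply, evalFive_swap (X.τ_swap _)]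
  rw [← map_neg]
  congr 1
  ext z
  simp only [evalFive_apply, Pi.sub_apply, map_sub, Pi.neg_apply, X.τ_swap _ z]
  simp only [τ]
  ring

/-- The determinant of `Ψ`. -/
def ψ : R := X.Ψ.det

/-- The Pfaffian of the matrix of `s` without its first row and column. -/
def pf : R := X.Φ X.s 1 2 * X.Φ X.s 3 4 - X.Φ X.s 1 3 * X.Φ X.s 2 4 + X.Φ X.s 1 4 * X.Φ X.s 2 3

theorem Ψ_zero : X.Ψ 0 0 = -X.r := by
  change X.ev 0 (fun z => X.δ (wedgeQuad X.e X.t z)) = _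
  simp only [evalFive_apply, Matrix.cons_val_zero, wedgeQuad_zero_right, map_zero, sub_zero]
  rw [wedgeQuad_apply, four_swap₀₁, four_swap₁₂, four_swap₀₁, mul_comm, ← δ_D, D]
  simp

theorem Φ_s_zero (i : Fin 5) : X.Φ X.s i 0 = 0 := by
  simp [Φ, evalFive_apply, τ, wedgeQuad_self_left, wedgeQuad_zero_right]

/-- The first column of `Ψ` vanishes below its top entry, since `s ∧ y ∧ s = 0`; the map `e ∧ t` in
`ρ` was chosen so that this entry is `-r`. What remains is a skew `4 × 4` block. -/
theorem ψ_eq : X.ψ = -X.r * X.pf ^ 2 := by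
  have h (i : Fin 4) : X.Ψ i.succ 0 = 0 := by rw [Ψ_succ, Φ_s_zero]
  rw [ψ, Matrix.det_succ_column_zero, Fin.sum_univ_succ, Finset.sum_eq_zero fun i _ => by
    rw [h, mul_zero, zero_mul], det_skew_four, Ψ_zero, pf]
  · simp only [Matrix.submatrix_apply, Fin.zero_succAbove, Ψ_succ]
    simp
  · intro i
    rw [Matrix.submatrix_apply, Fin.zero_succAbove, Ψ_succ, Φ_self]
  · intro i j
    rw [Matrix.submatrix_apply, Matrix.submatrix_apply, Fin.zero_succAbove, Fin.zero_succAbove,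
      Ψ_succ, Ψ_succ, Φ_swap]

theorem Φ_s_12 : X.Φ X.s 1 2 = X.r := by
  rw [← δ_D, D]
  simp [Φ, evalFive_apply, τ, wedgeQuad_apply, mul_add, four_add₂, four_add₃, four_eq₀₂,
    mul_comm X.t X.s]

theorem Φ_s_34 : X.Φ X.s 3 4 = -X.r := by
  rw [← δ_D, D]
  simp [Φ, evalFive_apply, τ, wedgeQuad_apply, mul_add, add_mul, four_add₂, four_add₃, four_eq₀₂,
    four_eq₁₂, mul_comm X.t X.s, four_add₁]
  rw [four_swap₁₂, map_neg]

theorem Φ_s_14 : X.Φ X.s 1 4 = 0 := by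
  simp [Φ, evalFive_apply, τ, wedgeQuad_apply, mul_add, four_add₂, four_add₃, four_eq₀₂,
    four_eq₁₂, mul_comm X.t X.s]

theorem Φ_s_24 : X.Φ X.s 2 4 = -(X.a ^ 3 * X.c 4 (X.s * X.s)) := by
  rw [← δ_topForm_of_mem]
  simp [Φ, evalFive_apply, τ, wedgeQuad_apply, mul_add, add_mul, four_add₂, four_add₃, four_eq₀₂,
    four_eq₀₁, four_add₁]
  rw [four_swap₁₂, map_neg]

/-- The Pfaffian is `-r²` plus a multiple of the `s t` coordinate of `s²`, and that coordinate lies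
in `p`. -/
theorem pf_notMem [hp : p.IsPrime] : X.pf ∉ p := by
  intro h
  rw [pf, Φ_s_12, Φ_s_34, Φ_s_14, Φ_s_24] at h
  have h1 : X.r ^ 2 ∈ p := by
    have h2 := p.sub_mem (p.mul_mem_left (X.Φ X.s 1 3 * X.a ^ 3) X.c_sq) h
    convert h2 using 1
    ring
  exact X.r_notMem (hp.mem_of_pow_mem _ h1)

theorem ψ_notMem [hp : p.IsPrime] : X.ψ ∉ p := by
  intro h
  rw [ψ_eq] at h
  rcases hp.mem_or_mem h with h | h
  · exact X.r_notMem (neg_mem_iff.1 h)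
  · exact X.pf_notMem (hp.mem_of_pow_mem _ h)

/-- The family of quadratic maps dual to the five functionals, up to the scalar `ψ`. -/
def n (i : Fin 5) : Q → TopL R Q := ∑ k, X.Ψ.adjugate i k • X.ρ k

theorem n_mem (i : Fin 5) : X.n i ∈ quadModule R Q :=
  Submodule.sum_mem _ fun k _ => Submodule.smul_mem _ _ (X.ρ_mem k)

/-- The quadratic form `δ ∘ n i`. -/
def S (i : Fin 5) (z : Q) : R := X.δ (X.n i z)

theorem S_apply (i : Fin 5) (z : Q) : X.S i z = X.δ (X.n i z) := rfl

/-- Cramer's rule: the `n i` are built from the adjugate of `Ψ`, so they are dual to the functionals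
up to its determinant. -/
theorem ev_S (i j : Fin 5) : X.ev j (X.S i) = if i = j then X.ψ else 0 := by
  have h : (X.S i : Q → R) = ∑ k, X.Ψ.adjugate i k • fun z => X.δ (X.ρ k z) := by
    ext z
    simp [S_apply, n]
  rw [h, map_sum]
  simp only [map_smul, smul_eq_mul]
  have h1 := congrFun (congrFun X.Ψ.adjugate_mul i) j
  rw [Matrix.mul_apply] at h1
  rw [show (∑ k, X.Ψ.adjugate i k * X.ev j fun z => X.δ (X.ρ k z)) =
    ∑ k, X.Ψ.adjugate i k * X.Ψ k j from rfl, h1]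
  simp [Matrix.one_apply, ψ]

end PreFrame

end

section

/-! ### Passage to the generic fiber: the five functionals separate the quadratic maps. -/

open scoped nonZeroDivisors

variable {R : Type u} [CommRing R] {Q : Type v} [CommRing Q] [Algebra R Q]

theorem IsMaximalQuinticRing.nonempty_preFrame [IsDedekindDomain R] (hR : ¬ IsField R)
    (hQ : IsMaximalQuinticRing R Q) (p : Ideal R) [p.IsMaximal] :
    Nonempty (PreFrame (Q := Q) p) := by
  obtain ⟨s, t, e, r, c, h1, h2, h3, h4⟩ := exists_local_coordinates hR hQ p
  exact ⟨⟨s, t, e, r, c, h1, h2, h3, h4⟩⟩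

theorem IsMaximalQuinticRing.isLocallyCyclic [IsDedekindDomain R] (hR : ¬ IsField R)
    (hQ : IsMaximalQuinticRing R Q) : IsLocallyCyclic R (TopL R Q) := by
  intro p hp
  obtain ⟨X⟩ := hQ.nonempty_preFrame hR p
  exact ⟨X.D, X.δ, X.r, X.r_notMem, X.isCoordinate⟩

theorem exists_smul_eq_one_tmul [IsDomain R] {N : Type w} [AddCommGroup N] [Module R N]
    (x : FractionRing R ⊗[R] N) : ∃ r : R, r ≠ 0 ∧ ∃ y : N, r • x = 1 ⊗ₜ y := by
  induction x with
  | zero => exact ⟨1, one_ne_zero, 0, by simp⟩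
  | add x y hx hy =>
    obtain ⟨a, ha, u, hu⟩ := hx
    obtain ⟨b, hb, v, hv⟩ := hy
    refine ⟨a * b, mul_ne_zero ha hb, b • u + a • v, ?_⟩
    rw [smul_add, mul_comm, mul_smul, hu, mul_comm, mul_smul, hv, TensorProduct.tmul_add,
      TensorProduct.tmul_smul, TensorProduct.tmul_smul]
  | tmul k y =>
    obtain ⟨⟨a, b⟩, h⟩ := IsLocalization.surj R⁰ k
    refine ⟨b, nonZeroDivisors.coe_ne_zero b, a • y, ?_⟩
    rw [TensorProduct.smul_tmul', Algebra.smul_def, mul_comm, h, TensorProduct.tmul_smul,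
      TensorProduct.smul_tmul', Algebra.smul_def, mul_one]

namespace PreFrame

variable {p : Ideal R} (X : PreFrame (Q := Q) p)

/-- The elements `1, s, t, e, s t`. -/
abbrev v : Fin 5 → Q := ![1, X.s, X.t, X.e, X.s * X.t]

theorem a_ne_zero : X.a ≠ 0 := fun h => X.a_notMem (h ▸ p.zero_mem)

variable [IsDomain R]

/-- The basis `1, s, t, e, s t` of the generic fiber. -/
def basis [Module.Finite R Q] (h : Module.finrank R Q = 5) :
    Module.Basis (Fin 5) (FractionRing R) (FractionRing R ⊗[R] Q) :=
  basisOfLinearIndependentOfCardEqFinrank (b := fun i => 1 ⊗ₜ[R] X.v i) (by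
    rw [Fintype.linearIndependent_iff]
    intro g hg i
    have h1 := congrArg ((X.c i).baseChange (FractionRing R)) hg
    have h2 : ∀ j, X.c i (X.v j) = if i = j then X.a else 0 := X.c_apply i
    simp only [map_sum, map_smul, LinearMap.baseChange_tmul, h2, map_zero] at h1
    rw [Finset.sum_eq_single i (fun j _ hj => by rw [if_neg hj.symm, TensorProduct.tmul_zero,
      smul_zero]) (by simp), if_pos rfl] at h1
    have h3 := congrArg (TensorProduct.rid R (FractionRing R)) h1
    rw [TensorProduct.smul_tmul', TensorProduct.rid_tmul, map_zero] at h3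
    simpa [X.a_ne_zero] using h3) (by
    rw [IsBaseChange.finrank_eq (TensorProduct.isBaseChange R Q (FractionRing R)), h, Fintype.card_fin])

theorem basis_apply [Module.Finite R Q] (h : Module.finrank R Q = 5) (i : Fin 5) :
    X.basis h i = 1 ⊗ₜ X.v i := by
  simp [basis]

theorem basis_coord [Module.Finite R Q] (h : Module.finrank R Q = 5) (i : Fin 5) (q : Q) :
    algebraMap R (FractionRing R) X.a * (X.basis h).coord i (1 ⊗ₜ q) = algebraMap R _ (X.c i q) := by
  have h1 : algebraMap R (FractionRing R) X.a • ((1 : FractionRing R) ⊗ₜ[R] q) =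
      ∑ i, algebraMap R (FractionRing R) (X.c i q) • X.basis h i := by
    simp_rw [basis_apply, algebraMap_smul, ← TensorProduct.tmul_smul, ← TensorProduct.tmul_sum]
    rw [X.smul_eq]
  rw [← smul_eq_mul, ← map_smul, h1, Module.Basis.coord_apply, Module.Basis.repr_sum_self]

theorem isReduced_genericFiber (X : PreFrame (Q := Q) p) [Module.IsTorsionFree R Q] [IsReduced Q] :
    IsReduced (FractionRing R ⊗[R] Q) := by
  refine ⟨fun x ⟨n, hn⟩ => ?_⟩
  obtain ⟨r, hr, y, hy⟩ := exists_smul_eq_one_tmul x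
  have h1 : (1 : FractionRing R) ⊗ₜ[R] (y ^ n) = 0 := by
    rw [← one_pow (M := FractionRing R) n, ← Algebra.TensorProduct.tmul_pow, ← hy, smul_pow, hn, smul_zero]
  have h2 : y ^ n = 0 := by
    have h3 : X.a • y ^ n = 0 := by
      rw [X.smul_eq]
      refine Finset.sum_eq_zero fun i _ => ?_
      have h4 := congrArg (TensorProduct.rid R (FractionRing R))
        (congrArg ((X.c i).baseChange (FractionRing R)) h1)
      rw [LinearMap.baseChange_tmul, TensorProduct.rid_tmul, map_zero, map_zero, Algebra.smul_def,
        mul_one] at h4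
      rw [(IsFractionRing.injective R (FractionRing R)) (h4.trans (map_zero _).symm), zero_smul]
    exact (smul_eq_zero.1 h3).resolve_left X.a_ne_zero
  rw [eq_zero_of_pow_eq_zero h2, TensorProduct.tmul_zero] at hy
  have h5 : algebraMap R (FractionRing R) r • x = 0 := by rw [algebraMap_smul, hy]
  have hu : algebraMap R (FractionRing R) r ≠ 0 := by simpa using hr
  rw [← one_smul (FractionRing R) x, ← inv_mul_cancel₀ hu, mul_smul, h5, smul_zero]

/-- Over the fraction field the quadratic maps span at most five dimensions, while the five
functionals are already surjective on the dual family; so they are injective there, and restriction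
to `Q` loses nothing needed. -/
theorem eq_zero_of_ev_eq_zero [p.IsPrime] [IsReduced Q] [Module.Finite R Q]
    [Module.IsTorsionFree R Q]
    [Module.IsTorsionFree R (TopL R Q)] (h : Module.finrank R Q = 5)
    {F : Q → TopL R Q} (hF : F ∈ quadModule R Q)
    (hev : ∀ j, (X.ev j fun z => X.δ (F z)) = 0) : F = 0 := by
  let K := FractionRing R
  let A := K ⊗[R] Q
  have := X.isReduced_genericFiber
  have hfin : Module.Finite K A := inferInstance
  obtain ⟨s, hs⟩ := exists_frobenius_form (K := K) (A := A)
  let d : A [⋀^Fin 4]→ₗ[K] K := Matrix.detRowAlternating.compLinearMap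
    (LinearMap.pi fun i : Fin 4 => (X.basis h).coord i.succ)
  have hd : ∀ x i, x i = 1 → d x = 0 := by
    intro x i hi
    refine AlternatingMap.map_coord_zero Matrix.detRowAlternating i
      (m := fun i => (LinearMap.pi fun i : Fin 4 => (X.basis h).coord i.succ) (x i)) ?_
    rw [hi, show (1 : A) = X.basis h 0 from (X.basis_apply h 0).symm]
    refine funext fun j => ?_
    simp [Fin.succ_ne_zero]
  have hle := finrank_span_wedge_le s hs (X.basis h) (by rw [basis_apply]; rfl) d hd
  set W := Submodule.span K (Set.range fun p : A × A => fun z : A => d ![p.1, p.2, z, p.2 * z])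
  let ι : Q → A := fun q => 1 ⊗ₜ q
  -- Every map in `quadModule` is the restriction of one over the fraction field. The factor `a⁴`
  -- compares a determinant in the scaled coordinates `c` with one in true coordinates.
  have hex : ∀ G ∈ quadModule R Q, ∃ f ∈ W, ∀ z, algebraMap R K (X.δ (G z)) = f (ι z) := by
    intro G hG
    induction hG using Submodule.span_induction with
    | mem _ hx =>
      obtain ⟨⟨x, y⟩, rfl⟩ := hx
      refine ⟨algebraMap R K X.a ^ 4 • fun z : A => d ![ι x, ι y, z, ι y * z],
        Submodule.smul_mem _ _ (Submodule.subset_span ⟨(ι x, ι y), rfl⟩), fun z => ?_⟩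
      change algebraMap R K (X.δ (topForm R Q ![x, y, z, y * z])) = _
      rw [δ_topForm, RingHom.map_det]
      have h1 : (algebraMap R K).mapMatrix
          (Matrix.of fun j (i : Fin 4) => X.c i.succ (![x, y, z, y * z] j)) =
          algebraMap R K X.a • Matrix.of fun j (i : Fin 4) =>
            (X.basis h).coord i.succ (![ι x, ι y, ι z, ι y * ι z] j) := by
        ext j i
        simp only [RingHom.mapMatrix_apply, Matrix.map_apply, Matrix.of_apply, Matrix.smul_apply,
          smul_eq_mul]
        rw [← X.basis_coord h]
        congr 2
        fin_cases j
        · rfl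
        · rfl
        · rfl
        · refine Eq.trans ?_ (Algebra.TensorProduct.tmul_mul_tmul (R := R) (1 : K) 1 y z).symm
          rw [mul_one]
          rfl
      rw [h1, Matrix.det_smul, Fintype.card_fin]
      rfl
    | zero => exact ⟨0, W.zero_mem, fun z => by simp⟩
    | add _ _ _ _ h h' =>
      obtain ⟨f, hf, hfz⟩ := h
      obtain ⟨g, hg, hgz⟩ := h'
      exact ⟨f + g, W.add_mem hf hg, fun z => by simp [hfz, hgz]⟩
    | smul r _ _ h =>
      obtain ⟨f, hf, hfz⟩ := h
      exact ⟨algebraMap R K r • f, W.smul_mem _ hf, fun z => by simp [hfz]⟩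
  let Γ : W →ₗ[K] (Fin 5 → K) :=
    LinearMap.pi fun j => evalFive K (ι X.s) (ι X.t) (ι X.e) j ∘ₗ W.subtype
  have hΓ : ∀ (G : Q → TopL R Q) (f : A → K), (∀ z, algebraMap R K (X.δ (G z)) = f (ι z)) → ∀ j,
      evalFive K (ι X.s) (ι X.t) (ι X.e) j f = algebraMap R K (X.ev j fun z => X.δ (G z)) := by
    intro G f hf j
    simp only [evalFive_apply, map_sub, hf]
    fin_cases j <;> simp [ι, TensorProduct.tmul_add]
  have hsurj : Function.Surjective Γ := by
    intro w
    choose f hf hfz using fun j => hex (X.n j) (X.n_mem j)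
    have hψ : algebraMap R K X.ψ ≠ 0 := by
      simpa using fun h : X.ψ = 0 => X.ψ_notMem (h ▸ p.zero_mem)
    refine ⟨∑ j, (w j / algebraMap R K X.ψ) • ⟨f j, hf j⟩, ?_⟩
    ext i
    have h1 (j : Fin 5) : Γ ⟨f j, hf j⟩ i = if j = i then algebraMap R K X.ψ else 0 := by
      refine (hΓ (X.n j) (f j) (hfz j) i).trans ?_
      rw [show (fun z => X.δ (X.n j z)) = X.S j from rfl, ev_S]
      split_ifs <;> simp
    simp only [map_sum, map_smul, Finset.sum_apply, Pi.smul_apply, h1, smul_eq_mul, mul_ite, mul_zero]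
    simp only [Finset.sum_ite_eq', Finset.mem_univ, if_true]
    exact div_mul_cancel₀ _ hψ
  have hinj : Function.Injective Γ := by
    have hW : Module.Finite K W := by
      let Δ : (A →ₗ[K] A →ₗ[K] K) →ₗ[K] (A → K) :=
        { toFun := fun B z => B z z
          map_add' := fun _ _ => rfl
          map_smul' := fun _ _ => rfl }
      have : W ≤ LinearMap.range Δ := by
        refine Submodule.span_le.2 ?_
        rintro _ ⟨⟨x, y⟩, rfl⟩
        exact ⟨LinearMap.mk₂ K (fun z z' => d ![x, y, z, y * z'])
          (fun _ _ _ => four_add₂ _ _ _ _ _ _) (fun _ _ _ => four_smul₂ _ _ _ _ _ _)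
          (fun _ _ _ => by rw [mul_add]; exact four_add₃ _ _ _ _ _ _)
          (fun _ _ _ => by rw [mul_smul_comm]; exact four_smul₃ _ _ _ _ _ _), rfl⟩
      exact Submodule.finiteDimensional_of_le this
    have h5 : Module.finrank K W = Module.finrank K (Fin 5 → K) := by
      refine le_antisymm (hle.trans_eq (by simp)) ?_
      exact LinearMap.finrank_le_finrank_of_surjective hsurj
    exact (LinearMap.injective_iff_surjective_of_finrank_eq_finrank h5).2 hsurj
  obtain ⟨f, hf, hfz⟩ := hex F hF
  have hf0 : (⟨f, hf⟩ : W) = 0 := hinj (by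
    rw [map_zero]
    ext j
    exact (hΓ F f hfz j).trans (by rw [hev, map_zero]; rfl))
  ext z : 1
  refine X.isCoordinate.eq_zero (x := F z) (fun h => X.r_notMem (h ▸ p.zero_mem)) ?_
  have := hfz z
  rw [show f = 0 from congrArg Subtype.val hf0] at this
  exact (IsFractionRing.injective R K) (by rw [this, map_zero]; rfl)

end PreFrame
end

section

/-! ### Quadratic forms restricted to lines. -/

section Lines

variable {R : Type u} [CommRing R] {V : Type v} [AddCommGroup V] [Module R V]

open Polynomial in
/-- The restriction of a quadratic form to a line, as a polynomial. -/
def linePolynomial (F : QuadraticMap R V R) (v w : V) : R[X] :=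
  C (F v) + C (QuadraticMap.polar F v w) * X + C (F w) * X ^ 2

theorem eval_linePolynomial (F : QuadraticMap R V R) (v w : V) (x : R) :
    (linePolynomial F v w).eval x = F (v + x • w) := by
  have h := QuadraticMap.polar_smul_right F x v w
  rw [QuadraticMap.polar, QuadraticMap.map_smul] at h
  simp only [linePolynomial, Polynomial.eval_add, Polynomial.eval_C, Polynomial.eval_mul,
    Polynomial.eval_X, Polynomial.eval_pow]
  simp only [smul_eq_mul] at h
  linear_combination -h

theorem coeff_linePolynomial_zero (F : QuadraticMap R V R) (v w : V) :
    (linePolynomial F v w).coeff 0 = F v := by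
  simp [linePolynomial]

theorem coeff_linePolynomial_one (F : QuadraticMap R V R) (v w : V) :
    (linePolynomial F v w).coeff 1 = QuadraticMap.polar F v w := by
  simp [linePolynomial, Polynomial.coeff_X_pow, Polynomial.coeff_C]

theorem coeff_linePolynomial_two (F : QuadraticMap R V R) (v w : V) :
    (linePolynomial F v w).coeff 2 = F w := by
  simp [linePolynomial, Polynomial.coeff_X_pow]

theorem linePolynomial_mul_eq [IsDomain R] [Infinite R] {F G F' G' : QuadraticMap R V R}
    (h : ∀ y, F y * G y = F' y * G' y) (v w : V) :
    linePolynomial F v w * linePolynomial G v w = linePolynomial F' v w * linePolynomial G' v w :=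
  Polynomial.funext fun x => by simp only [Polynomial.eval_mul, eval_linePolynomial, h]

/-- Five quadratic forms `U` that are proportional to five forms `S` vanish if they vanish at a
point `s` and the forms `S` take certain values at two points `s`, `t`. -/
theorem eq_zero_of_proportional [IsDomain R] [Infinite R] {S U : Fin 5 → QuadraticMap R V R}
    (h : ∀ i j y, U i y * S j y = U j y * S i y) {s t : V} {ψ : R} (hψ : ψ ≠ 0)
    (hs : ∀ i, S i s = if i = 0 then ψ else 0) (ht : ∀ i, S i t = if i = 1 then ψ else 0)
    (hst : ∀ i, QuadraticMap.polar (S i) s t = if i = 4 then ψ else 0) (hU : ∀ i, U i s = 0)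
    (i : Fin 5) (y : V) : U i y = 0 := by
  have hs0 : S 0 s = ψ := hs 0
  -- Compare coefficients of degree 1 and 2 in `U k * S 0 = U 0 * S k` along the line from `s` in
  -- direction `w`. The first gives that `U k` has no polar term at `s`, the second the stated
  -- factorization.
  have key (k : Fin 5) (hk : k ≠ 0) (w : V) :
      U k w * ψ = QuadraticMap.polar (U 0) s w * QuadraticMap.polar (S k) s w := by
    have hsk : S k s = 0 := (hs k).trans (if_neg hk)
    have hp := linePolynomial_mul_eq (h k 0) s w
    have h1 := congrArg (fun P => P.coeff 1) hp
    have h2 := congrArg (fun P => P.coeff 2) hp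
    simp only [Polynomial.mul_coeff_one, coeff_linePolynomial_zero, coeff_linePolynomial_one, hU,
      hs0, hsk] at h1
    have hpk : QuadraticMap.polar (U k) s w = 0 := by
      have : QuadraticMap.polar (U k) s w * ψ = 0 := by linear_combination h1
      exact (mul_eq_zero.1 this).resolve_right hψ
    simp only [Polynomial.coeff_mul, Finset.Nat.antidiagonal_succ, Finset.Nat.antidiagonal_zero,
      Finset.sum_cons, Finset.map_singleton, Finset.sum_singleton, Finset.map_cons,
      Function.Embedding.prodMap, Function.Embedding.coeFn_mk, Prod.map,
      Function.Embedding.refl_apply] at h2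
    norm_num at h2
    simp only [coeff_linePolynomial_zero, coeff_linePolynomial_one,
      coeff_linePolynomial_two, hU, hs0, hsk, hpk] at h2
    linear_combination h2
  have hpoly {P P' : Polynomial R} (hP : ∀ x, P.eval x * P'.eval x = 0) (h0 : P'.eval 0 ≠ 0) :
      P = 0 := by
    have : P * P' = 0 := Polynomial.funext fun x => by simpa using hP x
    refine (mul_eq_zero.1 this).resolve_right fun hz => h0 ?_
    rw [hz, Polynomial.eval_zero]
  -- Substituting `key` into `U 4 * S 1 = U 1 * S 4` gives the polar form of `U 0` at `s` times a
  -- cubic that equals `ψ²` at `t`. On each line through `t` the cubic is a nonzero polynomial and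
  -- can be cancelled.
  have ha (w : V) : QuadraticMap.polar (U 0) s w = 0 := by
    let lin (F : QuadraticMap R V R) : Polynomial R :=
      Polynomial.C (QuadraticMap.polar F s t) + Polynomial.C (QuadraticMap.polar F s w) * Polynomial.X
    have hlin (F : QuadraticMap R V R) (x : R) :
        (lin F).eval x = QuadraticMap.polar F s (t + x • w) := by
      rw [QuadraticMap.polar_add_right, QuadraticMap.polar_smul_right]
      simp only [lin, Polynomial.eval_add, Polynomial.eval_mul, Polynomial.eval_C, Polynomial.eval_X,
        smul_eq_mul]
      ring
    have h0 := hpoly (P := lin (U 0)) (P' := lin (S 4) * linePolynomial (S 1) t w -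
        lin (S 1) * linePolynomial (S 4) t w) (fun x => by
      simp only [Polynomial.eval_sub, Polynomial.eval_mul, hlin, eval_linePolynomial]
      linear_combination S 4 (t + x • w) * key 1 (by decide) (t + x • w) -
        S 1 (t + x • w) * key 4 (by decide) (t + x • w) + ψ * h 4 1 (t + x • w)) (by
      rw [Polynomial.eval_sub, Polynomial.eval_mul, Polynomial.eval_mul, hlin, hlin,
        eval_linePolynomial, eval_linePolynomial, zero_smul, add_zero, ht, ht, hst, hst]
      simpa using hψ)
    have h1 := congrArg (fun P => P.coeff 1) h0
    simpa [lin, Polynomial.coeff_C] using h1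
  have hk (k : Fin 5) (hk : k ≠ 0) (w : V) : U k w = 0 := by
    have := key k hk w
    rw [ha, zero_mul] at this
    exact (mul_eq_zero.1 this).resolve_right hψ
  by_cases hi : i = 0
  · subst hi
    have h0 := hpoly (P := linePolynomial (U 0) t y) (P' := linePolynomial (S 1) t y) (fun x => by
      rw [eval_linePolynomial, eval_linePolynomial, h 0 1, hk 1 (by decide), zero_mul]) (by
      rw [eval_linePolynomial, zero_smul, add_zero, ht]
      simpa using hψ)
    rw [← coeff_linePolynomial_two (U 0) t y, h0, Polynomial.coeff_zero]
  · exact hk i hi y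

end Lines

/-! ### Pfaffians and the kernel of a skew matrix. -/

section Pfaffian

variable {R : Type u} [CommRing R]

/-- The vector of signed Pfaffians of the principal `4 × 4` minors of a skew `5 × 5` matrix. -/
def pfaffians (A : Matrix (Fin 5) (Fin 5) R) : Fin 5 → R :=
  ![A 1 2 * A 3 4 - A 1 3 * A 2 4 + A 1 4 * A 2 3,
    -(A 0 2 * A 3 4 - A 0 3 * A 2 4 + A 0 4 * A 2 3),
    A 0 1 * A 3 4 - A 0 3 * A 1 4 + A 0 4 * A 1 3,
    -(A 0 1 * A 2 4 - A 0 2 * A 1 4 + A 0 4 * A 1 2),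
    A 0 1 * A 2 3 - A 0 2 * A 1 3 + A 0 3 * A 1 2]

/-- For a skew matrix of odd size, the Pfaffian vector spans the kernel when the rank is maximal.
Each cross product below is an explicit combination of three kernel equations, so no rank assumption
is needed. -/
theorem pfaffians_mul_eq {A : Matrix (Fin 5) (Fin 5) R} (hA : ∀ i, A i i = 0)
    (hA' : ∀ i j, A i j = -A j i) {S : Fin 5 → R} (hS : ∀ j, ∑ i, S i * A i j = 0) (i j : Fin 5) :
    pfaffians A i * S j = pfaffians A j * S i := by
  have h0 := hS 0
  have h1 := hS 1
  have h2 := hS 2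
  have h3 := hS 3
  have h4 := hS 4
  simp only [Fin.sum_univ_five, hA, hA' 1 0, hA' 2 0, hA' 3 0, hA' 4 0, hA' 2 1, hA' 3 1, hA' 4 1,
    hA' 3 2, hA' 4 2, hA' 4 3] at h0 h1 h2 h3 h4
  have h01 : pfaffians A 0 * S 1 = pfaffians A 1 * S 0 := by
    simp only [pfaffians, Matrix.cons_val]
    linear_combination A 3 4 * h2 - A 2 4 * h3 + A 2 3 * h4
  have h02 : pfaffians A 0 * S 2 = pfaffians A 2 * S 0 := by
    simp only [pfaffians, Matrix.cons_val]
    linear_combination -A 3 4 * h1 + A 1 4 * h3 - A 1 3 * h4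
  have h03 : pfaffians A 0 * S 3 = pfaffians A 3 * S 0 := by
    simp only [pfaffians, Matrix.cons_val]
    linear_combination A 2 4 * h1 - A 1 4 * h2 + A 1 2 * h4
  have h04 : pfaffians A 0 * S 4 = pfaffians A 4 * S 0 := by
    simp only [pfaffians, Matrix.cons_val]
    linear_combination -A 2 3 * h1 + A 1 3 * h2 - A 1 2 * h3
  have h12 : pfaffians A 1 * S 2 = pfaffians A 2 * S 1 := by
    simp only [pfaffians, Matrix.cons_val]
    linear_combination A 3 4 * h0 - A 0 4 * h3 + A 0 3 * h4
  have h13 : pfaffians A 1 * S 3 = pfaffians A 3 * S 1 := by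
    simp only [pfaffians, Matrix.cons_val]
    linear_combination -A 2 4 * h0 + A 0 4 * h2 - A 0 2 * h4
  have h14 : pfaffians A 1 * S 4 = pfaffians A 4 * S 1 := by
    simp only [pfaffians, Matrix.cons_val]
    linear_combination A 2 3 * h0 - A 0 3 * h2 + A 0 2 * h3
  have h23 : pfaffians A 2 * S 3 = pfaffians A 3 * S 2 := by
    simp only [pfaffians, Matrix.cons_val]
    linear_combination A 1 4 * h0 - A 0 4 * h1 + A 0 1 * h4
  have h24 : pfaffians A 2 * S 4 = pfaffians A 4 * S 2 := by
    simp only [pfaffians, Matrix.cons_val]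
    linear_combination -A 1 3 * h0 + A 0 3 * h1 - A 0 1 * h3
  have h34 : pfaffians A 3 * S 4 = pfaffians A 4 * S 3 := by
    simp only [pfaffians, Matrix.cons_val]
    linear_combination A 1 2 * h0 - A 0 2 * h1 + A 0 1 * h2
  fin_cases i <;> fin_cases j <;> first | rfl | assumption | (symm; assumption)

end Pfaffian

variable {R : Type u} [CommRing R] {Q : Type v} [CommRing Q] [Algebra R Q]

/-! ### Coordinates of the quadratic maps, and their proportionality to the Pfaffians. -/

namespace PreFrame

variable {p : Ideal R} (X : PreFrame (Q := Q) p)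

/-- The entries of `Φ` as linear forms. -/
def Φlin (i j : Fin 5) : Q →ₗ[R] R where
  toFun x := X.Φ x i j
  map_add' x x' := by
    simp only [Φ, Matrix.of_apply, evalFive_apply, τ, wedgeQuad_apply, four_add₀, map_add]
    ring
  map_smul' r x := by
    simp only [Φ, Matrix.of_apply, evalFive_apply, τ, wedgeQuad_apply, four_smul₀, map_smul,
      smul_eq_mul, RingHom.id_apply]
    ring

theorem exists_quadraticMap_pfaffians (k : Fin 5) :
    ∃ q : QuadraticMap R Q R, ∀ y, q y = pfaffians (X.Φ y) k := by
  let m (a b c d : Fin 5) := QuadraticMap.linMulLin (X.Φlin a b) (X.Φlin c d)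
  refine ⟨(![m 1 2 3 4 - m 1 3 2 4 + m 1 4 2 3, -(m 0 2 3 4 - m 0 3 2 4 + m 0 4 2 3),
    m 0 1 3 4 - m 0 3 1 4 + m 0 4 1 3, -(m 0 1 2 4 - m 0 2 1 4 + m 0 4 1 2),
    m 0 1 2 3 - m 0 2 1 3 + m 0 3 1 2] : Fin 5 → QuadraticMap R Q R) k, fun y => ?_⟩
  fin_cases k <;> rfl

theorem exists_quadraticMap_S (i : Fin 5) : ∃ q : QuadraticMap R Q R, ⇑q = X.S i := by
  obtain ⟨q, hq⟩ := exists_quadraticMap (X.n_mem i)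
  exact ⟨X.δ.compQuadraticMap q, funext fun z => congrArg X.δ (congrFun hq z)⟩

theorem polar_S (i : Fin 5) : QuadraticMap.polar (X.S i) X.s X.t = if i = 4 then X.ψ else 0 := by
  rw [← X.ev_S, QuadraticMap.polar_comm]
  rfl

theorem S_zero_right (i : Fin 5) : X.S i 0 = 0 := by
  obtain ⟨q, hq⟩ := X.exists_quadraticMap_S i
  rw [← hq, QuadraticMap.map_zero]

theorem S_s (i : Fin 5) : X.S i X.s = if i = 0 then X.ψ else 0 := by
  rw [← X.ev_S]
  simp [evalFive_apply, S_zero_right]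

theorem S_t (i : Fin 5) : X.S i X.t = if i = 1 then X.ψ else 0 := by
  rw [← X.ev_S]
  simp [evalFive_apply, S_zero_right]

theorem r_ne_zero [p.IsPrime] : X.r ≠ 0 := fun h => X.r_notMem (h ▸ p.zero_mem)

theorem ψ_ne_zero [p.IsPrime] : X.ψ ≠ 0 := fun h => X.ψ_notMem (h ▸ p.zero_mem)

variable [IsDedekindDomain R] [p.IsMaximal]

/-- Both sides have the same values under the five functionals, which separate `quadModule`. -/
theorem ψ_smul (hR : ¬ IsField R) (hQ : IsMaximalQuinticRing R Q) {F : Q → TopL R Q}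
    (hF : F ∈ quadModule R Q) :
    X.ψ • F = ∑ j, (X.ev j fun z => X.δ (F z)) • X.n j := by
  have := hQ.isReduced hR
  have := hQ.1.finite
  have := hQ.1.isTorsionFree
  have := (hQ.isLocallyCyclic hR).isTorsionFree
  refine sub_eq_zero.1 (X.eq_zero_of_ev_eq_zero hQ.1.finrank_eq (sub_mem
    (Submodule.smul_mem _ _ hF) (Submodule.sum_mem _ fun j _ => Submodule.smul_mem _ _ (X.n_mem j)))
    fun j => ?_)
  have h : (fun z => X.δ ((X.ψ • F - ∑ j, (X.ev j fun z => X.δ (F z)) • X.n j) z)) =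
      X.ψ • (fun z => X.δ (F z)) - ∑ j, (X.ev j fun z => X.δ (F z)) • X.S j := by
    ext z
    simp [S_apply]
  rw [h, map_sub, map_smul, map_sum]
  simp_rw [map_smul, ev_S]
  simp [mul_comm]

theorem ψ_mul_τ (hR : ¬ IsField R) (hQ : IsMaximalQuinticRing R Q) (x y z : Q) :
    X.ψ * X.τ x y z = ∑ j, (X.ev j (X.τ x y)) * X.S j z := by
  have := congrArg X.δ (congrFun (X.ψ_smul hR hQ (wedgeQuad_mem x y)) z)
  rw [Pi.smul_apply, map_smul, Finset.sum_apply, map_sum] at this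
  simp only [Pi.smul_apply, map_smul] at this
  exact this

/-- By skewness in `y` and `z`, a functional applied in `z` leaves a quadratic map in `y` that again
lies in `quadModule` and can be expanded. -/
theorem ψ_mul_ev (hR : ¬ IsField R) (hQ : IsMaximalQuinticRing R Q) (x y : Q) (j : Fin 5) :
    X.ψ * X.ev j (X.τ x y) = ∑ i, X.Φ x i j * X.S i y := by
  have := congrArg X.δ (congrFun (X.ψ_smul hR hQ (X.ev_mem x j)) y)
  have h1 (w : Q) : X.δ ((X.ev j fun y => wedgeQuad x y) w) = -X.ev j (X.τ x w) := by
    rw [← map_neg]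
    simp only [evalFive_apply, Pi.sub_apply, map_sub, Pi.neg_apply, X.τ_swap _ w, neg_neg]
    rfl
  simp only [h1] at this
  simp only [Pi.smul_apply, map_smul, Finset.sum_apply, map_sum, smul_eq_mul, h1] at this
  have h2 (i : Fin 5) : (X.ev i fun z => -X.ev j (X.τ x z)) = -X.Φ x i j := by
    rw [← Pi.neg_def, map_neg]
    rfl
  simp only [h2, neg_mul, mul_neg, Finset.sum_neg_distrib, neg_inj] at this
  exact this

theorem ψ_sq_mul_τ (hR : ¬ IsField R) (hQ : IsMaximalQuinticRing R Q) (x y z : Q) :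
    X.ψ ^ 2 * X.τ x y z = ∑ j, ∑ i, X.Φ x i j * X.S i y * X.S j z := by
  rw [pow_two, mul_assoc, X.ψ_mul_τ hR hQ, Finset.mul_sum]
  refine Finset.sum_congr rfl fun j _ => ?_
  rw [← mul_assoc, X.ψ_mul_ev hR hQ, Finset.sum_mul]

/-- This is `y ∧ y ∧ z ∧ y z = 0` in coordinates. -/
theorem sum_S_mul_Φ (hR : ¬ IsField R) (hQ : IsMaximalQuinticRing R Q) (y : Q) (j : Fin 5) :
    ∑ i, X.S i y * X.Φ y i j = 0 := by
  have h : X.τ y y = 0 := by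
    ext z
    rw [τ, wedgeQuad_self, map_zero]
    rfl
  have := X.ψ_mul_ev hR hQ y y j
  rw [h, map_zero, mul_zero] at this
  simp_rw [mul_comm (X.S _ y)]
  exact this.symm

/-- The quadratic forms `S` are proportional to the Pfaffians. -/
theorem ψ_mul_pfaffians (hR : ¬ IsField R) (hQ : IsMaximalQuinticRing R Q) (k : Fin 5) (y : Q) :
    X.ψ * pfaffians (X.Φ y) k = X.pf * X.S k y := by
  choose S hS using X.exists_quadraticMap_S
  choose P hP using X.exists_quadraticMap_pfaffians
  -- Comparing polynomials by their values needs infinitely many scalars; a finite domain is a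
  -- field.
  have : Infinite R := by
    by_contra h
    rw [not_infinite_iff_finite] at h
    exact hR (Finite.isField_of_domain R)
  have hPS (i j : Fin 5) (y : Q) : P i y * S j y = P j y * S i y := by
    rw [hP, hP, hS, hS]
    exact pfaffians_mul_eq (X.Φ_self y) (X.Φ_swap y) (X.sum_S_mul_Φ hR hQ y) i j
  have hP0 : P 0 X.s = X.pf := hP 0 X.s
  have hPk (k : Fin 5) (hk : k ≠ 0) : P k X.s = 0 := by
    have := hPS k 0 X.s
    rw [hS, hS, S_s, S_s, if_neg hk, if_pos rfl, mul_zero] at this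
    exact (mul_eq_zero.1 this).resolve_right X.ψ_ne_zero
  -- The differences `ψ P - pf S` are still proportional to `S`, and the constant `pf`, the value of
  -- `P 0` at `s`, makes them vanish at `s`.
  have h := eq_zero_of_proportional (S := S) (U := fun k => X.ψ • P k - X.pf • S k)
    (fun i j y => by
      simp only [sub_apply, smul_apply, smul_eq_mul]
      linear_combination X.ψ * hPS i j y) X.ψ_ne_zero (s := X.s) (t := X.t)
    (fun i => by rw [hS, S_s]) (fun i => by rw [hS, S_t]) (fun i => by rw [hS, polar_S])
    (fun i => by
      simp only [sub_apply, smul_apply, smul_eq_mul]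
      by_cases hi : i = 0
      · rw [hi, hP0, hS, S_s, if_pos rfl]
        ring
      · rw [hPk i hi, hS, S_s, if_neg hi]
        ring) k y
  simp only [sub_apply, smul_apply, smul_eq_mul, hP, hS] at h
  exact sub_eq_zero.1 h

end PreFrame
end

section

/-! ### Functoriality of the exterior operations, and 2-vectors in five coordinates. -/

section ExteriorPowers

variable {R : Type u} [CommRing R] {M : Type w} [AddCommGroup M] [Module R M]
variable {N : Type w₁} [AddCommGroup N] [Module R N] {N' : Type w₂} [AddCommGroup N'] [Module R N']

theorem two_vector_induction {P : ⋀[R]^2 M → Prop} (h : ∀ (r : R) (v w : M), P (r • wedge₂ v w))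
    (add : ∀ μ ν, P μ → P ν → P (μ + ν)) (μ : ⋀[R]^2 M) : P μ := by
  have hμ : μ ∈ Submodule.span R (Set.range (exteriorPower.ιMulti R 2 (M := M))) := by
    rw [exteriorPower.ιMulti_span]
    trivial
  have hv (m : Fin 2 → M) : exteriorPower.ιMulti R 2 m = wedge₂ (m 0) (m 1) := by
    rw [wedge₂]
    congr 1
    ext i
    fin_cases i <;> rfl
  induction hμ using Submodule.closure_induction with
  | zero => simpa using h 0 0 0
  | add _ _ _ _ h h' => exact add _ _ h h'
  | smul_mem r _ hx =>
    obtain ⟨m, rfl⟩ := hx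
    rw [hv]
    exact h r _ _

theorem two_vector_ext {f g : ⋀[R]^2 M →ₗ[R] N} (h : ∀ v w, f (wedge₂ v w) = g (wedge₂ v w)) :
    f = g := by
  refine LinearMap.ext fun μ => ?_
  induction μ using two_vector_induction with
  | h r v w => rw [map_smul, map_smul, h]
  | add μ ν hμ hν => rw [map_add, map_add, hμ, hν]

theorem wedge₂_swap (v w : M) : (wedge₂ v w : ⋀[R]^2 M) = -wedge₂ w v :=
  Subtype.ext (by
    rw [Submodule.coe_neg, coe_wedge₂, coe_wedge₂, ι_mul_ι_swap])

theorem coe_map (n : ℕ) (f : M →ₗ[R] N) (α : ⋀[R]^n M) :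
    (exteriorPower.map n f α : ExteriorAlgebra R N) = ExteriorAlgebra.map f α := by
  have : (⋀[R]^n N).subtype ∘ₗ exteriorPower.map n f =
      (ExteriorAlgebra.map f).toLinearMap ∘ₗ (⋀[R]^n M).subtype := by
    apply exteriorPower.linearMap_ext
    ext m
    simp [exteriorPower.map_apply_ιMulti]
  exact LinearMap.congr_fun this α

theorem map_wedge₂ (f : M →ₗ[R] N) (v w : M) :
    exteriorPower.map 2 f (wedge₂ v w) = wedge₂ (f v) (f w) :=
  Subtype.ext (by rw [coe_map]; simp [coe_wedge₂])

theorem map_wedge (f : M →ₗ[R] N) {a b : ℕ} (α : ⋀[R]^a M) (β : ⋀[R]^b M) :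
    exteriorPower.map (a + b) f (wedge α β) =
      wedge (exteriorPower.map a f α) (exteriorPower.map b f β) :=
  Subtype.ext (by
    rw [coe_map]
    change ExteriorAlgebra.map f (α * β) = _ * _
    rw [map_mul, coe_map, coe_map])

theorem map_wedgeVec (f : M →ₗ[R] N) (α : ⋀[R]^4 M) (v : M) :
    exteriorPower.map 5 f (wedgeVec α v) = wedgeVec (exteriorPower.map 4 f α) (f v) :=
  Subtype.ext (by
    rw [coe_map]
    change ExteriorAlgebra.map f (α * ExteriorAlgebra.ι R v) = _ * _
    rw [map_mul, coe_map, ExteriorAlgebra.map_apply_ι])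

theorem square_smul_wedge₂ (r : R) (v w : M) : square (r • (wedge₂ v w : ⋀[R]^2 M)) = 0 := by
  rw [← wedge₂_smul_left, square_wedge₂]

theorem square_smul (r : R) (μ : ⋀[R]^2 M) : square (r • μ) = r ^ 2 • square μ := by
  simp only [square, map_smul, SquarePair.smul_snd]

theorem map_square (f : M →ₗ[R] N) (μ : ⋀[R]^2 M) :
    exteriorPower.map 4 f (square μ) = square (exteriorPower.map 2 f μ) := by
  induction μ using two_vector_induction with
  | h r v w => rw [map_smul, map_wedge₂, square_smul_wedge₂, square_smul_wedge₂, map_zero]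
  | add μ ν hμ hν =>
    rw [map_add, square_add, square_add, map_add, map_add, hμ, hν]
    congr 1
    exact map_wedge f μ ν

/-- The form `v ∧ w ↦ f v ⊗ g w - f w ⊗ g v`. -/
def pairForm (f : M →ₗ[R] N) (g : M →ₗ[R] N') : ⋀[R]^2 M →ₗ[R] N ⊗[R] N' :=
  exteriorPower.alternatingMapLinearEquiv
    (alternatingOfTwo (fun v w => f v ⊗ₜ[R] g w - f w ⊗ₜ[R] g v)
      (fun x x' y => by simp only [map_add, TensorProduct.add_tmul, TensorProduct.tmul_add]; abel)
      (fun x y y' => by simp only [map_add, TensorProduct.add_tmul, TensorProduct.tmul_add]; abel)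
      (fun r x y => by
        simp only [map_smul, TensorProduct.smul_tmul', TensorProduct.tmul_smul, smul_sub])
      (fun r x y => by
        simp only [map_smul, TensorProduct.smul_tmul', TensorProduct.tmul_smul, smul_sub])
      (fun x => sub_self _))

theorem pairForm_wedge₂ (f : M →ₗ[R] N) (g : M →ₗ[R] N') (v w : M) :
    pairForm f g (wedge₂ v w) = f v ⊗ₜ[R] g w - f w ⊗ₜ[R] g v := by
  rw [pairForm, wedge₂, exteriorPower.alternatingMapLinearEquiv_apply_ιMulti]
  rfl

theorem map_pairForm {P : Type*} {P' : Type*} [AddCommGroup P] [Module R P] [AddCommGroup P']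
    [Module R P'] (f : M →ₗ[R] N) (g : M →ₗ[R] N') (a : N →ₗ[R] P) (b : N' →ₗ[R] P')
    (μ : ⋀[R]^2 M) :
    TensorProduct.map a b (pairForm f g μ) = pairForm (a ∘ₗ f) (b ∘ₗ g) μ := by
  have : TensorProduct.map a b ∘ₗ pairForm f g = pairForm (a ∘ₗ f) (b ∘ₗ g) :=
    two_vector_ext fun v w => by
      simp [pairForm_wedge₂, TensorProduct.map_tmul]
  exact LinearMap.congr_fun this μ

theorem pairForm_map {P : Type*} [AddCommGroup P] [Module R P] (f : M →ₗ[R] N) (g : M →ₗ[R] N')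
    (h : P →ₗ[R] M) (μ : ⋀[R]^2 P) :
    pairForm f g (exteriorPower.map 2 h μ) = pairForm (f ∘ₗ h) (g ∘ₗ h) μ := by
  have : pairForm f g ∘ₗ exteriorPower.map 2 h = pairForm (f ∘ₗ h) (g ∘ₗ h) :=
    two_vector_ext fun v w => by
      simp [pairForm_wedge₂, map_wedge₂]
  exact LinearMap.congr_fun this μ

/-- The 2-vector `∑_{i < j} A i j • b i ∧ b j`. -/
def skewVector (A : Matrix (Fin 5) (Fin 5) R) (b : Fin 5 → M) : ⋀[R]^2 M :=
  ∑ i, ∑ j, if i < j then A i j • wedge₂ (b i) (b j) else 0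

theorem skewVector_eq (A : Matrix (Fin 5) (Fin 5) R) (b : Fin 5 → M) : skewVector A b =
    A 0 1 • wedge₂ (b 0) (b 1) + A 0 2 • wedge₂ (b 0) (b 2) + A 0 3 • wedge₂ (b 0) (b 3) +
    A 0 4 • wedge₂ (b 0) (b 4) + A 1 2 • wedge₂ (b 1) (b 2) + A 1 3 • wedge₂ (b 1) (b 3) +
    A 1 4 • wedge₂ (b 1) (b 4) + A 2 3 • wedge₂ (b 2) (b 3) + A 2 4 • wedge₂ (b 2) (b 4) +
    A 3 4 • wedge₂ (b 3) (b 4) := by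
  simp [skewVector, Fin.sum_univ_five]
  abel

theorem coe_square_skewVector (A : Matrix (Fin 5) (Fin 5) R) (b : Fin 5 → M) :
    (square (skewVector A b) : ExteriorAlgebra R M) =
      (A 1 2 * A 3 4 - A 1 3 * A 2 4 + A 1 4 * A 2 3) • (ExteriorAlgebra.ι R (b 1) *
        (ExteriorAlgebra.ι R (b 2) * (ExteriorAlgebra.ι R (b 3) * ExteriorAlgebra.ι R (b 4)))) +
      (A 0 2 * A 3 4 - A 0 3 * A 2 4 + A 0 4 * A 2 3) • (ExteriorAlgebra.ι R (b 0) *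
        (ExteriorAlgebra.ι R (b 2) * (ExteriorAlgebra.ι R (b 3) * ExteriorAlgebra.ι R (b 4)))) +
      (A 0 1 * A 3 4 - A 0 3 * A 1 4 + A 0 4 * A 1 3) • (ExteriorAlgebra.ι R (b 0) *
        (ExteriorAlgebra.ι R (b 1) * (ExteriorAlgebra.ι R (b 3) * ExteriorAlgebra.ι R (b 4)))) +
      (A 0 1 * A 2 4 - A 0 2 * A 1 4 + A 0 4 * A 1 2) • (ExteriorAlgebra.ι R (b 0) *
        (ExteriorAlgebra.ι R (b 1) * (ExteriorAlgebra.ι R (b 2) * ExteriorAlgebra.ι R (b 4)))) +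
      (A 0 1 * A 2 3 - A 0 2 * A 1 3 + A 0 3 * A 1 2) • (ExteriorAlgebra.ι R (b 0) *
        (ExteriorAlgebra.ι R (b 1) * (ExteriorAlgebra.ι R (b 2) * ExteriorAlgebra.ι R (b 3)))) := by
  have hw (μ ν : ⋀[R]^2 M) : ((wedge μ ν : ⋀[R]^4 M) : ExteriorAlgebra R M) = μ * ν := rfl
  rw [skewVector_eq]
  simp only [square_add, square_smul_wedge₂, Submodule.coe_add, Submodule.coe_smul,
    Submodule.coe_zero, hw, coe_wedge₂, zero_add, add_mul, smul_mul_assoc, mul_smul_comm, mul_assoc,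
    smul_smul]
  have hsw (i j : Fin 5) (_ : j < i) := ι_mul_ι_swap (R := R) (b i) (b j)
  have hsw' (i j : Fin 5) (_ : j < i) (x : ExteriorAlgebra R M) :
      ExteriorAlgebra.ι R (b i) * (ExteriorAlgebra.ι R (b j) * x) =
        -(ExteriorAlgebra.ι R (b j) * (ExteriorAlgebra.ι R (b i) * x)) := by
    rw [← mul_assoc, ι_mul_ι_swap, neg_mul, mul_assoc]
  have hsq (i : Fin 5) := ExteriorAlgebra.ι_sq_zero (R := R) (b i)
  have hsq' (i : Fin 5) (x : ExteriorAlgebra R M) :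
      ExteriorAlgebra.ι R (b i) * (ExteriorAlgebra.ι R (b i) * x) = 0 := by
    rw [← mul_assoc, hsq, zero_mul]
  simp only [hsq, hsq',
    hsw 3 2 (by decide), hsw 4 2 (by decide), hsw 4 3 (by decide),
    hsw' 1 0 (by decide), hsw' 2 0 (by decide), hsw' 3 0 (by decide),
    hsw' 2 1 (by decide), hsw' 3 1 (by decide), hsw' 4 1 (by decide),
    hsw' 3 2 (by decide), hsw' 4 2 (by decide), hsw' 4 3 (by decide),
    mul_neg, neg_neg, mul_zero, smul_zero, smul_neg, neg_zero, add_zero, zero_add]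
  module

theorem coe_ιMulti_five (b : Fin 5 → M) :
    (exteriorPower.ιMulti R 5 b : ExteriorAlgebra R M) =
      ExteriorAlgebra.ι R (b 0) * (ExteriorAlgebra.ι R (b 1) * (ExteriorAlgebra.ι R (b 2) *
        (ExteriorAlgebra.ι R (b 3) * ExteriorAlgebra.ι R (b 4)))) := by
  simp [ExteriorAlgebra.ιMulti_apply]
  rfl

/-- The squaring map computes Pfaffians; the alternating signs in `pfaffians` come from moving `b k`
into its place. -/
theorem wedgeVec_square_skewVector (A : Matrix (Fin 5) (Fin 5) R) (b : Fin 5 → M) (k : Fin 5) :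
    wedgeVec (square (skewVector A b)) (b k) = pfaffians A k • exteriorPower.ιMulti R 5 b := by
  refine Subtype.ext ?_
  rw [Submodule.coe_smul, coe_ιMulti_five]
  change (square (skewVector A b) : ExteriorAlgebra R M) * ExteriorAlgebra.ι R (b k) = _
  rw [coe_square_skewVector]
  have hsw (i j : Fin 5) (_ : j < i) := ι_mul_ι_swap (R := R) (b i) (b j)
  have hsw' (i j : Fin 5) (_ : j < i) (x : ExteriorAlgebra R M) :
      ExteriorAlgebra.ι R (b i) * (ExteriorAlgebra.ι R (b j) * x) =
        -(ExteriorAlgebra.ι R (b j) * (ExteriorAlgebra.ι R (b i) * x)) := by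
    rw [← mul_assoc, ι_mul_ι_swap, neg_mul, mul_assoc]
  have hsq (i : Fin 5) := ExteriorAlgebra.ι_sq_zero (R := R) (b i)
  have hsq' (i : Fin 5) (x : ExteriorAlgebra R M) :
      ExteriorAlgebra.ι R (b i) * (ExteriorAlgebra.ι R (b i) * x) = 0 := by
    rw [← mul_assoc, hsq, zero_mul]
  simp only [add_mul, smul_mul_assoc, mul_assoc]
  fin_cases k <;>
  simp only [Fin.zero_eta, Fin.mk_one, Fin.reduceFinMk, hsq, hsq',
    hsw 3 0 (by decide), hsw 4 0 (by decide), hsw 3 1 (by decide), hsw 4 1 (by decide),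
    hsw 3 2 (by decide), hsw 4 2 (by decide), hsw 4 3 (by decide),
    hsw' 1 0 (by decide), hsw' 2 0 (by decide), hsw' 3 0 (by decide),
    hsw' 2 1 (by decide), hsw' 3 1 (by decide), hsw' 3 2 (by decide),
    mul_neg, neg_neg, mul_zero, smul_zero, smul_neg, neg_zero, add_zero, zero_add, pfaffians,
    Matrix.cons_val, neg_smul]

end ExteriorPowers

/-- A family `b` that is a basis of `M` up to the scalar `r`, with coordinates `κ`. -/
structure LocalBasis (R : Type u) [CommRing R] (M : Type w) [AddCommGroup M] [Module R M] where
  r : R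
  b : Fin 5 → M
  κ : Fin 5 → M →ₗ[R] R
  smul_eq : ∀ m, r • m = ∑ i, κ i m • b i
  κ_b : ∀ i j, κ i (b j) = if i = j then r else 0

namespace LocalBasis

variable {R : Type u} [CommRing R] {M : Type w} [AddCommGroup M] [Module R M] (B : LocalBasis R M)

theorem sum_smul_alternating {N : Type*} [AddCommGroup N] [Module R N] (x y : Fin 5 → R)
    {g : Fin 5 → Fin 5 → N} (h : ∀ i, g i i = 0) (h' : ∀ i j, g i j = -g j i) :
    ∑ i, ∑ j, (x i * y j) • g i j =
      ∑ i, ∑ j, if i < j then (x i * y j - x j * y i) • g i j else 0 := by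
  simp only [Fin.sum_univ_five, h, h' 1 0, h' 2 0, h' 3 0, h' 4 0, h' 2 1, h' 3 1, h' 4 1,
    h' 3 2, h' 4 2, h' 4 3, smul_zero]
  simp
  module

/-- A 2-vector is recovered from its values on pairs of coordinate forms; the square appears because
each of the two vectors must be scaled by `r`. -/
theorem r_sq_smul (μ : ⋀[R]^2 M) :
    B.r ^ 2 • μ =
      skewVector (Matrix.of fun i j => LinearMap.mul' R R (pairForm (B.κ i) (B.κ j) μ)) B.b := by
  induction μ using two_vector_induction with
  | h r v w =>
    have h : B.r ^ 2 • (wedge₂ v w : ⋀[R]^2 M) = wedge₂ (B.r • v) (B.r • w) := by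
      rw [wedge₂_smul_left, wedge₂_smul_right, smul_smul, pow_two]
    have h1 (f : Fin 5 → M) (y : M) : (wedge₂ (∑ i, f i) y : ⋀[R]^2 M) = ∑ i, wedge₂ (f i) y := by
      simp [Fin.sum_univ_five, wedge₂_add_left]
    have h2 (f : Fin 5 → M) (y : M) : (wedge₂ y (∑ i, f i) : ⋀[R]^2 M) = ∑ i, wedge₂ y (f i) := by
      simp [Fin.sum_univ_five, wedge₂_add_right]
    have h3 : (wedge₂ (B.r • v) (B.r • w) : ⋀[R]^2 M) =
        ∑ i, ∑ j, (B.κ i v * B.κ j w) • wedge₂ (B.b i) (B.b j) := by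
      rw [B.smul_eq, B.smul_eq, h1]
      simp only [h2, wedge₂_smul_left, wedge₂_smul_right, smul_smul, mul_comm]
    rw [smul_comm, h, h3, sum_smul_alternating (fun i => B.κ i v) (fun j => B.κ j w)
      (g := fun i j => wedge₂ (B.b i) (B.b j)) (fun i => wedge₂_self _) fun i j => wedge₂_swap _ _]
    rw [skewVector, Finset.smul_sum]
    refine Finset.sum_congr rfl fun i _ => ?_
    rw [Finset.smul_sum]
    refine Finset.sum_congr rfl fun j _ => ?_
    rw [smul_ite, smul_zero, smul_smul, Matrix.of_apply, map_smul, pairForm_wedge₂]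
    simp [mul_comm]
  | add μ ν hμ hν =>
    rw [smul_add, hμ, hν, skewVector, skewVector, skewVector, ← Finset.sum_add_distrib]
    refine Finset.sum_congr rfl fun i _ => ?_
    rw [← Finset.sum_add_distrib]
    refine Finset.sum_congr rfl fun j _ => ?_
    split_ifs
    · rw [← add_smul]
      simp
    · simp

/-- The coordinate on `⋀⁵ M`. -/
def detForm : ⋀[R]^5 M →ₗ[R] R :=
  exteriorPower.alternatingMapLinearEquiv
    (Matrix.detRowAlternating.compLinearMap (LinearMap.pi B.κ))

/-- The local generator of `⋀⁵ M`. -/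
def top : ⋀[R]^5 M := exteriorPower.ιMulti R 5 B.b

theorem isCoordinate : IsCoordinate B.top B.detForm (B.r ^ 5) := by
  have h : LinearMap.toSpanSingleton R _ B.top ∘ₗ B.detForm = B.r ^ 5 • LinearMap.id := by
    apply exteriorPower.linearMap_ext
    ext1 m
    let g : (Fin 5 → R) →ₗ[R] M := Fintype.linearCombination R B.b
    have hg (y : M) : B.r • y = g fun i => B.κ i y := by
      rw [B.smul_eq, Fintype.linearCombination_apply]
    have h1 : B.r ^ 5 • exteriorPower.ιMulti R 5 m =
        exteriorPower.ιMulti R 5 fun j => g fun i => B.κ i (m j) := by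
      have := (exteriorPower.ιMulti R 5 (M := M)).toMultilinearMap.map_smul_univ (fun _ => B.r) m
      rw [Finset.prod_const, Finset.card_univ, Fintype.card_fin] at this
      refine this.symm.trans ?_
      simp only [AlternatingMap.coe_multilinearMap, hg]
    change B.detForm (exteriorPower.ιMulti R 5 m) • B.top = B.r ^ 5 • exteriorPower.ιMulti R 5 m
    rw [h1, detForm, exteriorPower.alternatingMapLinearEquiv_apply_ιMulti]
    refine Eq.trans ?_ (((exteriorPower.ιMulti R 5).compLinearMap g).eq_det_smul
      fun j i => B.κ i (m j)).symm
    have ht : B.top = ((exteriorPower.ιMulti R 5).compLinearMap g) fun i => Pi.single i 1 := by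
      rw [top, AlternatingMap.compLinearMap_apply]
      exact congrArg _ (funext fun i => by simp [g])
    rw [← ht]
    have hd : (Matrix.detRowAlternating.compLinearMap (LinearMap.pi B.κ)) m =
        Matrix.det (Matrix.of fun j i => B.κ i (m j)) := by
      rw [AlternatingMap.compLinearMap_apply, Matrix.det]
      exact congrArg Matrix.detRowAlternating (funext fun j => funext fun i => rfl)
    rw [hd]
  exact fun x => LinearMap.congr_fun h x

theorem detForm_top :
    B.detForm B.top = B.r ^ 5 := by
  rw [detForm, top, exteriorPower.alternatingMapLinearEquiv_apply_ιMulti,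
    AlternatingMap.compLinearMap_apply]
  have : (fun i => LinearMap.pi B.κ (B.b i)) = (B.r • (1 : Matrix (Fin 5) (Fin 5) R)) := by
    ext i j
    simp [B.κ_b, Matrix.one_apply, eq_comm]
  rw [this]
  exact (Matrix.det_smul _ _).trans (by simp)

theorem wedgeVec_square_skewVector (A : Matrix (Fin 5) (Fin 5) R) (m : M) :
    B.r • wedgeVec (square (skewVector A B.b)) m = (∑ k, B.κ k m * pfaffians A k) • B.top := by
  rw [← map_smul, B.smul_eq, map_sum, Finset.sum_smul]
  refine Finset.sum_congr rfl fun k _ => ?_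
  rw [map_smul, QuinticResolvent.wedgeVec_square_skewVector, mul_smul, top]

theorem isLattice [IsDedekindDomain R] [Module.IsTorsionFree R M] (hr : B.r ≠ 0) : IsLattice R 5 M := by
  have h1 : Function.Injective (LinearMap.pi B.κ) := by
    rw [injective_iff_map_eq_zero]
    intro m hm
    have := B.smul_eq m
    rw [Finset.sum_eq_zero fun i _ => by rw [show B.κ i m = 0 from congrFun hm i, zero_smul]] at this
    exact (smul_eq_zero.1 this).resolve_left hr
  have hfin : Module.Finite R M := Module.Finite.of_injective _ h1
  refine isLattice_of_isTorsionFree (le_antisymm ?_ ?_)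
  · exact (LinearMap.finrank_le_finrank_of_injective h1).trans_eq (Module.finrank_fin_fun R)
  · have h2 : Function.Injective (Fintype.linearCombination R B.b) := by
      rw [injective_iff_map_eq_zero]
      intro c hc
      refine funext fun i => ?_
      have := congrArg (B.κ i) hc
      simp only [Fintype.linearCombination_apply, map_sum, map_smul, B.κ_b, map_zero] at this
      simpa [hr] using this
    exact (Module.finrank_fin_fun R).symm.trans_le (LinearMap.finrank_le_finrank_of_injective h2)

end LocalBasis

end

section

/-! ### Construction of the maps `φ` and `θ`. -/

variable {R : Type u} [CommRing R] {Q : Type v} [CommRing Q] [Algebra R Q]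

variable (R Q) in
/-- An identification of a module `M` with `quadModule R Q`. -/
structure Realization (M : Type w) [AddCommGroup M] [Module R M] where
  toFun : M →ₗ[R] (Q → TopL R Q)
  injective : Function.Injective toFun
  range_eq : LinearMap.range toFun = quadModule R Q

namespace Realization

variable {M : Type w} [AddCommGroup M] [Module R M] (J : Realization R Q M)

/-- The value of the quadratic map at `y`, as a linear function on `M`. -/
def evalAt (y : Q) : M →ₗ[R] TopL R Q := LinearMap.proj y ∘ₗ J.toFun

theorem evalAt_apply (y : Q) (m : M) : J.evalAt y m = J.toFun m y := rfl

theorem mem (m : M) : J.toFun m ∈ quadModule R Q := J.range_eq ▸ ⟨m, rfl⟩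

theorem exists_eq {F : Q → TopL R Q} (hF : F ∈ quadModule R Q) : ∃ m, J.toFun m = F := by
  rwa [← J.range_eq] at hF

variable [IsDedekindDomain R] {p : Ideal R} [p.IsMaximal]

/-- The basis of `M` given by a frame at `p`. -/
def localBasis (hR : ¬ IsField R) (hQ : IsMaximalQuinticRing R Q) (X : PreFrame (Q := Q) p) :
    LocalBasis R M where
  r := X.ψ
  b i := (J.exists_eq (X.n_mem i)).choose
  κ j := X.ev j ∘ₗ X.δ.compLeft Q ∘ₗ J.toFun
  smul_eq m := J.injective (by
    rw [map_smul, X.ψ_smul hR hQ (J.mem m), map_sum]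
    refine Finset.sum_congr rfl fun i _ => ?_
    rw [map_smul, (J.exists_eq (X.n_mem i)).choose_spec]
    rfl)
  κ_b i j := by
    rw [LinearMap.comp_apply, LinearMap.comp_apply, (J.exists_eq (X.n_mem j)).choose_spec]
    refine (X.ev_S j i).trans ?_
    simp only [eq_comm]

variable (hR : ¬ IsField R) (hQ : IsMaximalQuinticRing R Q) (X : PreFrame (Q := Q) p)

theorem toFun_localBasis (i : Fin 5) : J.toFun ((J.localBasis hR hQ X).b i) = X.n i :=
  (J.exists_eq (X.n_mem i)).choose_spec

theorem localBasis_r : (J.localBasis hR hQ X).r = X.ψ := rfl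

theorem localBasis_κ (j : Fin 5) (m : M) :
    (J.localBasis hR hQ X).κ j m = X.ev j fun z => X.δ (J.evalAt z m) := rfl

theorem pairForm_κ (i j : Fin 5) (μ : ⋀[R]^2 M) :
    pairForm ((J.localBasis hR hQ X).κ i) ((J.localBasis hR hQ X).κ j) μ =
      X.ev i fun y => X.ev j fun z => TensorProduct.map X.δ X.δ (pairForm (J.evalAt y) (J.evalAt z) μ) := by
  induction μ using two_vector_induction with
  | h r v w =>
    simp only [map_smul, pairForm_wedge₂, map_sub, TensorProduct.map_tmul, localBasis_κ,
      evalFive_apply, TensorProduct.sub_tmul, TensorProduct.tmul_sub]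
    module
  | add μ ν hμ hν =>
    simp only [map_add, hμ, hν, evalFive_apply]
    module

include hR hQ in
-- Locally the coordinates on `M` are combinations of evaluations, so the pairings with evaluations
-- determine all coordinates of a 2-vector.
theorem eq_zero_of_pairForm_eq_zero {μ : ⋀[R]^2 M}
    (h : ∀ y z, pairForm (J.evalAt y) (J.evalAt z) μ = 0) : μ = 0 := by
  refine eq_zero_of_forall_maximal (R := R) μ fun p hp => ?_
  obtain ⟨X⟩ := hQ.nonempty_preFrame hR p
  refine ⟨X.ψ ^ 2, fun h => X.ψ_notMem (hp.isPrime.mem_of_pow_mem _ h), ?_⟩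
  have h1 := (J.localBasis hR hQ X).r_sq_smul μ
  simp only [pairForm_κ, h, map_zero, evalFive_apply, sub_zero] at h1
  refine h1.trans ?_
  simp [skewVector]

end Realization

namespace PreFrame

variable {p : Ideal R} (X : PreFrame (Q := Q) p)

theorem Φ_one (i j : Fin 5) : X.Φ 1 i j = 0 := by
  have h (y z : Q) : X.τ 1 y z = 0 := by
    rw [τ, wedgeQuad_apply, topForm_eq_zero (i := 0) rfl, map_zero]
  simp [Φ, evalFive_apply, h]

/-- The coordinate on `(⋀⁴ L)^{⊗ 3}`. -/
def cubeForm : TopLCube R Q →ₗ[R] R :=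
  tensorForm X.δ (tensorForm X.δ X.δ)

theorem isCoordinate_cubeForm :
    IsCoordinate (X.D ⊗ₜ[R] (X.D ⊗ₜ[R] X.D)) X.cubeForm (X.r * (X.r * X.r)) :=
  X.isCoordinate.tensor (X.isCoordinate.tensor X.isCoordinate)

theorem cubeForm_tmul (a b c : TopL R Q) :
    X.cubeForm (a ⊗ₜ[R] (b ⊗ₜ[R] c)) = X.δ a * (X.δ b * X.δ c) := rfl

theorem _root_.QuinticResolvent.IsMaximalQuinticRing.isTorsionFree_cube [IsDedekindDomain R]
    (hR : ¬ IsField R) (hQ : IsMaximalQuinticRing R Q) : Module.IsTorsionFree R (TopLCube R Q) :=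
  have hΛ := hQ.isLocallyCyclic hR
  (hΛ.tensor (hΛ.tensor hΛ)).isTorsionFree

theorem cube_ext [IsDedekindDomain R] [p.IsMaximal] (hR : ¬ IsField R)
    (hQ : IsMaximalQuinticRing R Q) {x y : TopLCube R Q} (h : X.cubeForm x = X.cubeForm y) : x = y :=
  have := hQ.isTorsionFree_cube hR
  X.isCoordinate_cubeForm.ext
    (mul_ne_zero X.r_ne_zero (mul_ne_zero X.r_ne_zero X.r_ne_zero)) h

end PreFrame

theorem pairForm_skewVector {M : Type w} [AddCommGroup M] [Module R M] (f g : M →ₗ[R] R)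
    {A : Matrix (Fin 5) (Fin 5) R} (hA : ∀ i, A i i = 0) (hA' : ∀ i j, A i j = -A j i)
    (b : Fin 5 → M) :
    LinearMap.mul' R R (pairForm f g (skewVector A b)) = ∑ j, ∑ i, A i j * f (b i) * g (b j) := by
  simp only [skewVector_eq, map_add, map_smul, pairForm_wedge₂, map_sub, LinearMap.mul'_apply,
    smul_eq_mul, Fin.sum_univ_five, hA, hA' 1 0, hA' 2 0, hA' 3 0, hA' 4 0, hA' 2 1, hA' 3 1,
    hA' 4 1, hA' 3 2, hA' 4 2, hA' 4 3]
  ring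

namespace Realization

variable {M : Type w} [AddCommGroup M] [Module R M] (J : Realization R Q M)

/-- The defining property of the map `φ`. -/
def IsPhi (φ : TopL R Q ⊗[R] QuotMod R Q →ₗ[R] ⋀[R]^2 M) (r : R) : Prop :=
  ∀ l x y z, pairForm (J.evalAt y) (J.evalAt z) (φ (l ⊗ₜ quotMk R x)) = r • l ⊗ₜ[R] wedgeQuad x y z

/-- The defining property of the map `θ`. -/
def IsTheta (φ : TopL R Q ⊗[R] QuotMod R Q →ₗ[R] ⋀[R]^2 M) (θ : ⋀[R]^5 M →ₗ[R] TopLCube R Q)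
    (r : R) : Prop :=
  ∀ l y m, θ (wedgeVec (square (φ (l ⊗ₜ quotMk R y))) m) = r • l ⊗ₜ[R] (l ⊗ₜ[R] J.evalAt y m)

variable [IsDedekindDomain R] {p : Ideal R} [p.IsMaximal]
variable (hR : ¬ IsField R) (hQ : IsMaximalQuinticRing R Q) (X : PreFrame (Q := Q) p)

/-- The map `x ↦ ∑_{i < j} Φ x i j • b i ∧ b j`. -/
def skewMap : QuotMod R Q →ₗ[R] ⋀[R]^2 M :=
  Submodule.liftQ _
    { toFun := fun x => skewVector (X.Φ x) (J.localBasis hR hQ X).b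
      map_add' := fun x y => by
        have h (i j : Fin 5) : X.Φ (x + y) i j = X.Φ x i j + X.Φ y i j := (X.Φlin i j).map_add x y
        simp only [skewVector_eq, h]
        module
      map_smul' := fun r x => by
        have h (i j : Fin 5) : X.Φ (r • x) i j = r * X.Φ x i j := (X.Φlin i j).map_smul r x
        simp only [skewVector_eq, h, RingHom.id_apply]
        module } (by
    rintro _ ⟨r, rfl⟩
    have h (i j : Fin 5) : X.Φ (algebraMap R Q r) i j = 0 := by
      rw [Algebra.algebraMap_eq_smul_one]
      exact ((X.Φlin i j).map_smul r 1).trans (by rw [show X.Φlin i j 1 = 0 from X.Φ_one i j, smul_zero])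
    rw [LinearMap.mem_ker]
    change skewVector (X.Φ (algebraMap R Q r)) _ = 0
    simp [skewVector, h])

/-- The map `φ` up to a scalar, locally at `p`. -/
def localPhi : TopL R Q ⊗[R] QuotMod R Q →ₗ[R] ⋀[R]^2 M :=
  (TensorProduct.lid R (⋀[R]^2 M)).toLinearMap ∘ₗ TensorProduct.map X.δ (J.skewMap hR hQ X)

theorem localPhi_apply (l : TopL R Q) (x : Q) : J.localPhi hR hQ X (l ⊗ₜ quotMk R x) =
    X.δ l • skewVector (X.Φ x) (J.localBasis hR hQ X).b := rfl

/-- Expanding `x ∧ y ∧ z ∧ y z` in the dual family, once in `z` and once in `y`, gives exactly the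
matrix `Φ x`, at the cost of `ψ²`. -/
theorem isPhi_localPhi : J.IsPhi (J.localPhi hR hQ X) (X.ψ ^ 2) := by
  intro l x y z
  have hΛ := hQ.isLocallyCyclic hR
  have := (hΛ.tensor hΛ).isTorsionFree
  refine (X.isCoordinate.tensor X.isCoordinate).ext (mul_ne_zero X.r_ne_zero X.r_ne_zero) ?_
  rw [localPhi_apply, map_smul, map_smul, map_smul, tensorForm_tmul]
  have h1 (μ : ⋀[R]^2 M) : tensorForm X.δ X.δ (pairForm (J.evalAt y) (J.evalAt z) μ) =
      LinearMap.mul' R R (pairForm (X.δ ∘ₗ J.evalAt y) (X.δ ∘ₗ J.evalAt z) μ) := by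
    rw [← map_pairForm]
    rfl
  rw [h1, pairForm_skewVector _ _ (X.Φ_self x) (X.Φ_swap x)]
  have h2 := X.ψ_sq_mul_τ hR hQ x y z
  simp only [LinearMap.comp_apply, evalAt_apply, toFun_localBasis, smul_eq_mul]
  rw [show X.δ (wedgeQuad x y z) = X.τ x y z from rfl, mul_left_comm, h2]
  rfl

include hR hQ in
theorem exists_isPhi : ∃ φ, J.IsPhi φ 1 := by
  -- The admissible scalars form an ideal, and the local constructions put an element outside each
  -- maximal ideal into it; so `1` is admissible.
  let I : Ideal R :=
    { carrier := {r | ∃ φ, J.IsPhi φ r}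
      zero_mem' := ⟨0, fun l x y z => by rw [LinearMap.zero_apply, map_zero, zero_smul]⟩
      add_mem' := by
        rintro a b ⟨f, hf⟩ ⟨g, hg⟩
        exact ⟨f + g, fun l x y z => by rw [LinearMap.add_apply, map_add, hf, hg, add_smul]⟩
      smul_mem' := by
        rintro a b ⟨f, hf⟩
        exact ⟨a • f, fun l x y z => by
          rw [LinearMap.smul_apply, map_smul, hf, smul_smul, smul_eq_mul]⟩ }
  have hI : I = ⊤ := exists_mem_of_forall_maximal I fun p hp => by
    obtain ⟨X⟩ := hQ.nonempty_preFrame hR p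
    exact ⟨_, ⟨_, J.isPhi_localPhi hR hQ X⟩, fun h => X.ψ_notMem (hp.isPrime.mem_of_pow_mem _ h)⟩
  exact (hI ▸ trivial : (1 : R) ∈ I)

variable {φ : TopL R Q ⊗[R] QuotMod R Q →ₗ[R] ⋀[R]^2 M}

variable {J} in
include hR hQ in
theorem IsPhi.eq {φ' : TopL R Q ⊗[R] QuotMod R Q →ₗ[R] ⋀[R]^2 M} {r : R} (h : J.IsPhi φ r)
    (h' : J.IsPhi φ' r) : φ = φ' := by
  refine TensorProduct.ext' fun l x => ?_
  obtain ⟨x, rfl⟩ := Submodule.mkQ_surjective _ x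
  refine sub_eq_zero.1 (J.eq_zero_of_pairForm_eq_zero hR hQ fun y z => ?_)
  rw [map_sub, sub_eq_zero]
  exact (h l x y z).trans (h' l x y z).symm

variable {J} in
theorem IsPhi.ψ_sq_smul (h : J.IsPhi φ 1) (l : TopL R Q) (x : Q) :
    X.ψ ^ 2 • φ (l ⊗ₜ quotMk R x) = X.δ l • skewVector (X.Φ x) (J.localBasis hR hQ X).b := by
  have h1 : J.IsPhi (X.ψ ^ 2 • φ) (X.ψ ^ 2) := fun l x y z => by
    rw [LinearMap.smul_apply, map_smul, h, one_smul]
  exact LinearMap.congr_fun (h1.eq hR hQ (J.isPhi_localPhi hR hQ X)) (l ⊗ₜ quotMk R x)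

theorem sum_κ_mul_S (m : M) (y : Q) :
    ∑ k, (J.localBasis hR hQ X).κ k m * X.S k y = X.ψ * X.δ (J.evalAt y m) := by
  have h := congrArg X.δ (congrArg (J.evalAt y) ((J.localBasis hR hQ X).smul_eq m))
  simp only [map_sum, map_smul, evalAt_apply, toFun_localBasis, smul_eq_mul] at h
  exact h.symm

variable {J} in
-- The exponent collects `ψ⁴` from squaring `ψ² φ`, one `ψ` from expanding `m` in the local basis,
-- and one from replacing the Pfaffians by the forms `S`.
theorem IsPhi.ψ_pow_smul_wedgeVec (h : J.IsPhi φ 1) (l : TopL R Q) (y : Q) (m : M) :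
    X.ψ ^ 6 • wedgeVec (square (φ (l ⊗ₜ quotMk R y))) m =
      (X.δ l ^ 2 * (X.pf * (X.ψ * X.δ (J.evalAt y m)))) • (J.localBasis hR hQ X).top := by
  have wv (r : R) (α : ⋀[R]^4 M) (m : M) : wedgeVec (r • α) m = r • wedgeVec α m :=
    Subtype.ext (smul_mul_assoc _ _ _)
  have h1 := congrArg square (h.ψ_sq_smul hR hQ X l y)
  rw [square_smul, square_smul, ← pow_mul] at h1
  have h2 := (J.localBasis hR hQ X).wedgeVec_square_skewVector (X.Φ y) m
  have h3 : X.ψ * ∑ k, (J.localBasis hR hQ X).κ k m * pfaffians (X.Φ y) k =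
      X.pf * (X.ψ * X.δ (J.evalAt y m)) := by
    rw [← sum_κ_mul_S J hR hQ X, Finset.mul_sum, Finset.mul_sum]
    refine Finset.sum_congr rfl fun k _ => ?_
    rw [mul_left_comm, X.ψ_mul_pfaffians hR hQ, mul_left_comm]
  rw [localBasis_r] at h2
  rw [show 6 = 2 + 2 * 2 from rfl, pow_add, mul_smul, ← wv, h1, wv, smul_comm, mul_smul]
  congr 1
  rw [pow_two, mul_smul, h2, smul_smul, h3]

/-- The map `θ` up to a scalar, locally at `p`. -/
def localTheta : ⋀[R]^5 M →ₗ[R] TopLCube R Q :=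
  LinearMap.toSpanSingleton R _ (X.D ⊗ₜ[R] (X.D ⊗ₜ[R] X.D)) ∘ₗ (J.localBasis hR hQ X).detForm

variable {J} in
-- By the Pfaffian identity the coordinate of `φ (l ⊗ y)^□ ∧ m` on `⋀⁵ M` is `pf δ(l)² δ(m(y))`; the
-- factor `r³` is the coordinate of the generator of the cube.
theorem IsPhi.isTheta_localTheta (h : J.IsPhi φ 1) :
    J.IsTheta φ (J.localTheta hR hQ X) (X.pf * (X.r * (X.r * X.r))) := by
  intro l y m
  refine X.cube_ext hR hQ ?_
  have h1 := congrArg (J.localBasis hR hQ X).detForm (h.ψ_pow_smul_wedgeVec hR hQ X l y m)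
  rw [map_smul, map_smul, LocalBasis.detForm_top, localBasis_r] at h1
  rw [localTheta, LinearMap.comp_apply, LinearMap.toSpanSingleton_apply, map_smul, map_smul,
    X.cubeForm_tmul, X.cubeForm_tmul, X.δ_D]
  simp only [smul_eq_mul] at h1 ⊢
  refine mul_left_cancel₀ (pow_ne_zero 6 X.ψ_ne_zero) ?_
  linear_combination (X.r * (X.r * X.r)) * h1

variable {J} in
include hR hQ in
theorem IsPhi.exists_isTheta (h : J.IsPhi φ 1) : ∃ θ, J.IsTheta φ θ 1 := by
  let I : Ideal R :=
    { carrier := {r | ∃ θ, J.IsTheta φ θ r}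
      zero_mem' := ⟨0, fun l y m => by rw [LinearMap.zero_apply, zero_smul]⟩
      add_mem' := by
        rintro a b ⟨f, hf⟩ ⟨g, hg⟩
        exact ⟨f + g, fun l y m => by rw [LinearMap.add_apply, hf, hg, add_smul]⟩
      smul_mem' := by
        rintro a b ⟨f, hf⟩
        exact ⟨a • f, fun l y m => by
          rw [LinearMap.smul_apply, hf, smul_smul, smul_eq_mul]⟩ }
  have hI : I = ⊤ := exists_mem_of_forall_maximal I fun p hp => by
    obtain ⟨X⟩ := hQ.nonempty_preFrame hR p
    refine ⟨_, ⟨_, h.isTheta_localTheta hR hQ X⟩, fun h => ?_⟩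
    have hr := X.r_notMem
    rcases hp.isPrime.mem_or_mem h with h | h
    · exact X.pf_notMem h
    · rcases hp.isPrime.mem_or_mem h with h | h
      · exact hr h
      · exact (hp.isPrime.mem_or_mem h).elim hr hr
  exact (hI ▸ trivial : (1 : R) ∈ I)

variable {J} in
/-- The top vector is a multiple of `φ (D ⊗ s)^□ ∧ b 0`. -/
theorem IsPhi.smul_top (h : J.IsPhi φ 1) :
    (X.r ^ 2 * X.pf * X.ψ ^ 2) • (J.localBasis hR hQ X).top =
      X.ψ ^ 6 • wedgeVec (square (φ (X.D ⊗ₜ quotMk R X.s))) ((J.localBasis hR hQ X).b 0) := by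
  have h0 : X.δ (J.evalAt X.s ((J.localBasis hR hQ X).b 0)) = X.ψ := by
    rw [evalAt_apply, toFun_localBasis]
    exact X.S_s 0
  rw [h.ψ_pow_smul_wedgeVec hR hQ X, X.δ_D, h0]
  congr 1
  ring

variable {J} in
include hR hQ in
-- The vectors `φ (l ⊗ y)^□ ∧ m` span `⋀⁵ M`: near each `p`, one of them is already a generator up
-- to a unit.
theorem IsPhi.theta_ext (h : J.IsPhi φ 1) {N : Type*} [AddCommGroup N] [Module R N]
    {θ θ' : ⋀[R]^5 M →ₗ[R] N}
    (hθ : ∀ l y m, θ (wedgeVec (square (φ (l ⊗ₜ quotMk R y))) m) =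
      θ' (wedgeVec (square (φ (l ⊗ₜ quotMk R y))) m)) : θ = θ' := by
  refine LinearMap.ext fun ξ => sub_eq_zero.1 (eq_zero_of_forall_maximal (R := R) _ fun p hp => ?_)
  obtain ⟨X⟩ := hQ.nonempty_preFrame hR p
  have hprime := hp.isPrime
  refine ⟨X.r ^ 2 * X.pf * X.ψ ^ 2 * X.ψ ^ 5, ?_, ?_⟩
  · intro h
    rcases hprime.mem_or_mem h with h | h
    · rcases hprime.mem_or_mem h with h | h
      · rcases hprime.mem_or_mem h with h | h
        · exact X.r_notMem (hprime.mem_of_pow_mem _ h)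
        · exact X.pf_notMem h
      · exact X.ψ_notMem (hprime.mem_of_pow_mem _ h)
    · exact X.ψ_notMem (hprime.mem_of_pow_mem _ h)
  · have h1 := (J.localBasis hR hQ X).isCoordinate ξ
    rw [localBasis_r] at h1
    rw [← LinearMap.sub_apply, ← map_smul, mul_smul, ← h1, smul_comm, h.smul_top hR hQ X, map_smul,
      map_smul, LinearMap.sub_apply, hθ, sub_self, smul_zero, smul_zero]

variable {J} in
include hR hQ in
theorem IsTheta.bijective (h : J.IsPhi φ 1) {θ : ⋀[R]^5 M →ₗ[R] TopLCube R Q}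
    (hθ : J.IsTheta φ θ 1) : Function.Bijective θ := by
  -- With `l = D`, `y = s` and `m = b 0`, whose value at `s` has coordinate `ψ`, both defining
  -- formulas become explicit: up to units at `p`, `θ` takes one local generator to the other.
  have key (p : Ideal R) (hp : p.IsMaximal) (X : PreFrame (Q := Q) p) :
      (X.r ^ 2 * X.pf * X.ψ ^ 2) • X.r • θ (J.localBasis hR hQ X).top =
        (X.ψ ^ 6 * X.ψ) • X.D ⊗ₜ[R] (X.D ⊗ₜ[R] X.D) := by
    have h0 : X.δ (J.evalAt X.s ((J.localBasis hR hQ X).b 0)) = X.ψ := by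
      rw [evalAt_apply, toFun_localBasis]
      exact X.S_s 0
    rw [smul_comm, ← map_smul, h.smul_top hR hQ X, map_smul, hθ, one_smul, smul_comm, mul_smul]
    congr 1
    rw [← TensorProduct.tmul_smul, ← TensorProduct.tmul_smul, ← X.isCoordinate, h0,
      TensorProduct.tmul_smul, TensorProduct.tmul_smul]
  have htors := hQ.isTorsionFree_cube hR
  constructor
  · rw [injective_iff_map_eq_zero]
    intro ξ hξ
    refine eq_zero_of_forall_maximal (R := R) _ fun p hp => ?_
    obtain ⟨X⟩ := hQ.nonempty_preFrame hR p
    refine ⟨X.ψ ^ 5, fun h => X.ψ_notMem (hp.isPrime.mem_of_pow_mem _ h), ?_⟩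
    have h1 := (J.localBasis hR hQ X).isCoordinate ξ
    rw [localBasis_r] at h1
    have h2 := congrArg θ h1
    rw [map_smul, map_smul, hξ, smul_zero] at h2
    have h3 : (J.localBasis hR hQ X).detForm ξ • (X.ψ ^ 6 * X.ψ) • X.D ⊗ₜ[R] (X.D ⊗ₜ[R] X.D) = 0 := by
      rw [← key p hp X, smul_comm, smul_comm _ X.r, h2, smul_zero, smul_zero]
    have h4 := congrArg X.cubeForm h3
    rw [map_smul, map_smul, X.cubeForm_tmul, X.δ_D, map_zero] at h4
    have h5 : (J.localBasis hR hQ X).detForm ξ = 0 := by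
      simpa [X.ψ_ne_zero, X.r_ne_zero] using h4
    rw [← h1, h5, zero_smul]
  · rw [← LinearMap.range_eq_top, eq_top_iff]
    intro ξ _
    refine mem_of_forall_maximal (LinearMap.range θ) ξ fun p hp => ?_
    obtain ⟨X⟩ := hQ.nonempty_preFrame hR p
    refine ⟨X.ψ ^ 7 * (X.r * (X.r * X.r)), fun h => ?_, ?_⟩
    · have hr := X.r_notMem
      rcases hp.isPrime.mem_or_mem h with h | h
      · exact X.ψ_notMem (hp.isPrime.mem_of_pow_mem _ h)
      · rcases hp.isPrime.mem_or_mem h with h | h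
        · exact hr h
        · exact (hp.isPrime.mem_or_mem h).elim hr hr
    · rw [mul_smul, ← X.isCoordinate_cubeForm, smul_comm, pow_succ, ← key p hp X]
      exact Submodule.smul_mem _ _ (Submodule.smul_mem _ _ (Submodule.smul_mem _ _ ⟨_, rfl⟩))

end Realization

end

section

variable {R : Type u} [CommRing R] {Q : Type v} [CommRing Q] [Algebra R Q]

/-! ### Contractions and the resolvent identity. -/

section Contract

variable {M : Type w} [AddCommGroup M] [Module R M]

theorem map_contract {P : Type*} [AddCommGroup P] [Module R P] (θ : ⋀[R]^5 M →ₗ[R] P)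
    (α β : ⋀[R]^4 M) (μ : ⋀[R]^2 M) :
    TensorProduct.map θ θ (contract μ α β) =
      pairForm (θ ∘ₗ wedgeVec α) (θ ∘ₗ wedgeVec β) μ :=
  map_pairForm (N := ⋀[R]^5 M) (N' := ⋀[R]^5 M) (wedgeVec α) (wedgeVec β) θ θ μ

variable {P : Type*} [AddCommMonoid P] [Module R P]

theorem map_contract_eq_map {N : Type*} [AddCommGroup N] [Module R N] (θ : ⋀[R]^5 M →ₗ[R] P)
    {α β : ⋀[R]^4 M} {f g : M →ₗ[R] N} {a b : N →ₗ[R] P} (hα : θ ∘ₗ wedgeVec α = a ∘ₗ f)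
    (hβ : θ ∘ₗ wedgeVec β = b ∘ₗ g) (μ : ⋀[R]^2 M) :
    TensorProduct.map θ θ (contract μ α β) = TensorProduct.map a b (pairForm f g μ) := by
  let _ := Module.addCommMonoidToAddCommGroup R (M := P)
  refine (map_contract θ α β μ).trans (Eq.trans ?_ (map_pairForm f g a b μ).symm)
  rw [hα, hβ]

/-- Applying a linear form to the first half of a contraction turns it into `θ (β ∧ m)` for a vector
`m` that does not depend on `β`. Uniqueness uses this to produce vectors in an unknown resolvent. -/
theorem lid_map_contract_of_group {P : Type*} [AddCommGroup P] [Module R P] (θ : ⋀[R]^5 M →ₗ[R] P)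
    (h : P →ₗ[R] R) (α β : ⋀[R]^4 M) (μ : ⋀[R]^2 M) :
    TensorProduct.lid R P (TensorProduct.map h LinearMap.id (TensorProduct.map θ θ (contract μ α β))) =
      θ (wedgeVec β (TensorProduct.lid R M
        (pairForm (h ∘ₗ θ ∘ₗ wedgeVec α) LinearMap.id μ))) := by
  rw [map_contract, map_pairForm]
  have h2 (f : M →ₗ[R] P) (t : R ⊗[R] M) : f (TensorProduct.lid R M t) =
      TensorProduct.lid R P (TensorProduct.map LinearMap.id f t) := by
    induction t with
    | zero => simp
    | add a b ha hb => simp only [map_add, ha, hb]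
    | tmul a b => simp
  rw [← LinearMap.comp_apply θ, h2, map_pairForm]
  rfl

theorem lid_map_contract (θ : ⋀[R]^5 M →ₗ[R] P) (h : P →ₗ[R] R) (α β : ⋀[R]^4 M) (μ : ⋀[R]^2 M) :
    TensorProduct.lid R P (TensorProduct.map h LinearMap.id (TensorProduct.map θ θ (contract μ α β))) =
      θ (wedgeVec β (TensorProduct.lid R M
        (pairForm (h ∘ₗ θ ∘ₗ wedgeVec α) LinearMap.id μ))) :=
  let _ := Module.addCommMonoidToAddCommGroup R (M := P)
  lid_map_contract_of_group θ h α β μ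

theorem tensorForm_map {N : Type*} [AddCommGroup N] [Module R N] (a b : N →ₗ[R] P)
    (f g : P →ₗ[R] R) (t : N ⊗[R] N) :
    tensorForm f g (TensorProduct.map a b t) = tensorForm (f ∘ₗ a) (g ∘ₗ b) t := by
  induction t with
  | zero => simp
  | add a b ha hb => rw [map_add, map_add, map_add, ha, hb]
  | tmul a b => rfl

end Contract

/-- The map `m ↦ l ⊗ (l ⊗ m)`. -/
def cubeMk (l : TopL R Q) : TopL R Q →ₗ[R] TopLCube R Q :=
  TensorProduct.mk R _ _ l ∘ₗ TensorProduct.mk R _ _ l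

theorem cubeMk_apply (l m : TopL R Q) : cubeMk l m = l ⊗ₜ[R] (l ⊗ₜ[R] m) := rfl

theorem wedgeQuad_eq (x y z : Q) : wedgeQuad (R := R) x y z =
    wedge₄ (quotMk R x) (quotMk R y) (quotMk R z) (quotMk R (y * z)) :=
  topForm_apply _ _ _ _

namespace Realization

variable {M : Type w} [AddCommGroup M] [Module R M] {J : Realization R Q M}
variable {φ : TopL R Q ⊗[R] QuotMod R Q →ₗ[R] ⋀[R]^2 M} {θ : ⋀[R]^5 M →ₗ[R] TopLCube R Q}

theorem IsTheta.comp_wedgeVec (hθ : J.IsTheta φ θ 1) (l : TopL R Q) (y : Q) :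
    θ ∘ₗ wedgeVec (square (φ (l ⊗ₜ quotMk R y))) = cubeMk l ∘ₗ J.evalAt y :=
  LinearMap.ext fun m => (hθ l y m).trans (one_smul _ _)

theorem IsTheta.map_contract (hθ : J.IsTheta φ θ 1) (μ : ⋀[R]^2 M) (l l' : TopL R Q) (y z : Q) :
    TensorProduct.map θ θ
        (contract μ (square (φ (l ⊗ₜ quotMk R y))) (square (φ (l' ⊗ₜ quotMk R z)))) =
      TensorProduct.map (cubeMk l) (cubeMk l') (pairForm (J.evalAt y) (J.evalAt z) μ) :=
  map_contract_eq_map (P := TopLCube R Q) θ (hθ.comp_wedgeVec l y) (hθ.comp_wedgeVec l' z) μ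

variable [IsDedekindDomain R] (hR : ¬ IsField R) (hQ : IsMaximalQuinticRing R Q)

include hR hQ in
-- The condition on `θ` turns the contraction into the pairing of `φ` with two evaluations, which is
-- known. Only the order of the tensor factors remains, and it is immaterial in rank one.
theorem IsPhi.identity (hφ : J.IsPhi φ 1) (hθ : J.IsTheta φ θ 1) (l₁ l₂ l₃ : TopL R Q)
    (x y z : Q) :
    TensorProduct.map θ θ
        (contract (φ (l₁ ⊗ₜ quotMk R x))
          (square (φ (l₂ ⊗ₜ quotMk R y))) (square (φ (l₃ ⊗ₜ quotMk R z)))) =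
      (l₁ ⊗ₜ[R] (l₂ ⊗ₜ[R] l₂)) ⊗ₜ[R]
        (l₃ ⊗ₜ[R] (l₃ ⊗ₜ[R]
          wedge₄ (quotMk R x) (quotMk R y) (quotMk R z) (quotMk R (y * z)))) := by
  obtain ⟨p, hp⟩ := Ideal.exists_maximal R
  obtain ⟨X⟩ := hQ.nonempty_preFrame hR p
  rw [hθ.map_contract, hφ, one_smul, TensorProduct.map_tmul, wedgeQuad_eq, cubeMk_apply,
    cubeMk_apply]
  congr 1
  refine X.cube_ext hR hQ ?_
  rw [X.cubeForm_tmul, X.cubeForm_tmul]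
  ring

include hR hQ in
-- Read the same computation backwards with both other scalars equal to the local generator `D`; the
-- resulting factor `r⁴` cancels.
theorem IsTheta.isPhi (hθ : J.IsTheta φ θ 1) (h : ∀ (l₁ l₂ l₃ : TopL R Q) (x y z : Q),
    TensorProduct.map θ θ
        (contract (φ (l₁ ⊗ₜ quotMk R x))
          (square (φ (l₂ ⊗ₜ quotMk R y))) (square (φ (l₃ ⊗ₜ quotMk R z)))) =
      (l₁ ⊗ₜ[R] (l₂ ⊗ₜ[R] l₂)) ⊗ₜ[R]
        (l₃ ⊗ₜ[R] (l₃ ⊗ₜ[R]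
          wedge₄ (quotMk R x) (quotMk R y) (quotMk R z) (quotMk R (y * z))))) : J.IsPhi φ 1 := by
  intro l x y z
  obtain ⟨p, hp⟩ := Ideal.exists_maximal R
  obtain ⟨X⟩ := hQ.nonempty_preFrame hR p
  have hΛ := hQ.isLocallyCyclic hR
  have := (hΛ.tensor hΛ).isTorsionFree
  refine (X.isCoordinate.tensor X.isCoordinate).ext (mul_ne_zero X.r_ne_zero X.r_ne_zero) ?_
  have h0 := (hθ.map_contract (φ (l ⊗ₜ quotMk R x)) X.D X.D y z).symm.trans (h l X.D X.D x y z)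
  have h1 := congrArg (tensorForm (M := TopLCube R Q) (N := TopLCube R Q) X.cubeForm X.cubeForm) h0
  have h2 : X.cubeForm ∘ₗ cubeMk X.D = X.r ^ 2 • X.δ := LinearMap.ext fun m => by
    rw [LinearMap.comp_apply, cubeMk_apply, X.cubeForm_tmul, X.δ_D, LinearMap.smul_apply,
      smul_eq_mul]
    ring
  have h3 (t : TopL R Q ⊗[R] TopL R Q) : tensorForm (X.r ^ 2 • X.δ) (X.r ^ 2 • X.δ) t =
      X.r ^ 4 * tensorForm X.δ X.δ t := by
    induction t with
    | zero => simp
    | add a b ha hb => rw [map_add, map_add, mul_add, ha, hb]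
    | tmul a b =>
      simp only [tensorForm_tmul, LinearMap.smul_apply, smul_eq_mul]
      ring
  have h4 := tensorForm_map (P := TopLCube R Q) (cubeMk X.D) (cubeMk X.D) X.cubeForm X.cubeForm
    (pairForm (J.evalAt y) (J.evalAt z) (φ (l ⊗ₜ quotMk R x)))
  rw [h2, h3] at h4
  rw [h4, tensorForm_tmul, X.cubeForm_tmul, X.cubeForm_tmul, X.δ_D, ← wedgeQuad_eq] at h1
  refine mul_left_cancel₀ (pow_ne_zero 4 X.r_ne_zero) ?_
  rw [h1, one_smul, tensorForm_tmul]
  ring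

end Realization

/-! ### The lattice `M`. -/

section Existence

variable [IsDedekindDomain R] (hR : ¬ IsField R) (hQ : IsMaximalQuinticRing R Q)

include hR hQ in
theorem Realization.isLattice {M : Type w} [AddCommGroup M] [Module R M] (J : Realization R Q M) :
    IsLattice R 5 M := by
  obtain ⟨p, hp⟩ := Ideal.exists_maximal R
  obtain ⟨X⟩ := hQ.nonempty_preFrame hR p
  have := (hQ.isLocallyCyclic hR).isTorsionFree
  have : Module.IsTorsionFree R M := by
    refine Module.IsTorsionFree.of_smul_eq_zero fun r m h => ?_
    by_contra! hne
    refine hne.2 (J.injective ?_)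
    rw [map_zero]
    ext z : 1
    have h1 := congrFun (congrArg J.toFun h) z
    rw [map_smul, map_zero, Pi.smul_apply, Pi.zero_apply] at h1
    exact (smul_eq_zero.1 h1).resolve_left hne.1
  exact (J.localBasis hR hQ X).isLattice X.ψ_ne_zero

include hR hQ in
-- A finite module over `R` is small, so `quadModule` has a copy in the universe of `R`.
theorem exists_realization : ∃ (M : Type u) (_ : AddCommGroup M) (_ : Module R M),
    Nonempty (Realization R Q M) := by
  let J : Realization R Q (quadModule R Q) :=
    ⟨(quadModule R Q).subtype, Subtype.val_injective, Submodule.range_subtype _⟩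
  have := (J.isLattice hR hQ).finite
  have : Small.{u} (quadModule R Q) := Module.Finite.small R _
  refine ⟨Shrink.{u} (quadModule R Q), inferInstance, inferInstance,
    ⟨J.toFun ∘ₗ (Shrink.linearEquiv R (quadModule R Q)).toLinearMap, ?_, ?_⟩⟩
  · exact J.injective.comp (Shrink.linearEquiv R _).injective
  · rw [LinearMap.range_comp_of_range_eq_top _ (LinearEquiv.range _), J.range_eq]

end Existence

/-! ### Comparison with an arbitrary resolvent. -/

section Uniqueness

/-- The functions `(l, z) ↦ l ⊗ (l ⊗ m z)`. -/
def Realization.cubeMap {M : Type w} [AddCommGroup M] [Module R M] (J : Realization R Q M) :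
    M →ₗ[R] (TopL R Q × Q → TopLCube R Q) :=
  LinearMap.pi fun a => cubeMk a.1 ∘ₗ J.evalAt a.2

namespace Resolvent

variable (Y : Resolvent.{u, v, w} R Q)

/-- The functions `(l, z) ↦ θ (φ (l ⊗ z)^□ ∧ m)`. -/
def eval : Y.M →ₗ[R] (TopL R Q × Q → TopLCube R Q) :=
  LinearMap.pi fun a => Y.θ ∘ₗ wedgeVec (square (Y.φ (a.1 ⊗ₜ quotMk R a.2)))

theorem eval_apply (m : Y.M) (l : TopL R Q) (z : Q) :
    Y.eval m (l, z) = Y.θ (wedgeVec (square (Y.φ (l ⊗ₜ quotMk R z))) m) := rfl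

end Resolvent

variable [IsDedekindDomain R] (hR : ¬ IsField R) (hQ : IsMaximalQuinticRing R Q)

include hR hQ in
theorem Realization.cubeMap_injective {M : Type w} [AddCommGroup M] [Module R M]
    (J : Realization R Q M) : Function.Injective J.cubeMap := by
  obtain ⟨p, hp⟩ := Ideal.exists_maximal R
  obtain ⟨X⟩ := hQ.nonempty_preFrame hR p
  have := (hQ.isLocallyCyclic hR).isTorsionFree
  rw [injective_iff_map_eq_zero]
  intro m hm
  refine J.injective ?_
  rw [map_zero]
  ext z : 1
  have h1 := congrArg X.cubeForm (congrFun hm (X.D, z))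
  change X.cubeForm (X.D ⊗ₜ[R] (X.D ⊗ₜ[R] J.toFun m z)) = X.cubeForm 0 at h1
  rw [X.cubeForm_tmul, X.δ_D, map_zero] at h1
  refine X.isCoordinate.eq_zero X.r_ne_zero (x := J.toFun m z) ?_
  simpa [X.r_ne_zero] using h1

namespace Resolvent

variable (Y : Resolvent.{u, v, w} R Q)

include hR hQ in
-- For a spanning map, contract the identity with `l₁ = l₂ = D` by the coordinate of the first half.
-- This gives a vector of `Y.M` whose function is the required one times `r³`, a unit at `p`.
theorem mem_range_eval {F : Q → TopL R Q} (hF : F ∈ quadModule R Q) :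
    (fun a : TopL R Q × Q => cubeMk a.1 (F a.2)) ∈ LinearMap.range Y.eval := by
  induction hF using Submodule.span_induction with
  | mem _ h =>
    obtain ⟨⟨x, y⟩, rfl⟩ := h
    refine mem_of_forall_maximal (M := TopL R Q × Q → TopLCube R Q) (LinearMap.range Y.eval) _ fun p hp => ?_
    obtain ⟨X⟩ := hQ.nonempty_preFrame hR p
    refine ⟨X.r * (X.r * X.r), fun h => ?_, ?_⟩
    · have hr := X.r_notMem
      rcases hp.isPrime.mem_or_mem h with h | h
      · exact hr h
      · exact (hp.isPrime.mem_or_mem h).elim hr hr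
    let g : Y.M →ₗ[R] R := X.cubeForm ∘ₗ Y.θ ∘ₗ wedgeVec (square (Y.φ (X.D ⊗ₜ quotMk R y)))
    refine ⟨TensorProduct.lid R _ (pairForm g LinearMap.id (Y.φ (X.D ⊗ₜ quotMk R x))), ?_⟩
    ext ⟨l, z⟩ : 1
    have h1 := congrArg (fun t => TensorProduct.lid R _ (TensorProduct.map X.cubeForm LinearMap.id t))
      (Y.identity X.D X.D l x y z)
    simp only [TensorProduct.map_tmul, TensorProduct.lid_tmul] at h1
    rw [X.cubeForm_tmul, X.δ_D, ← wedgeQuad_eq] at h1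
    exact (lid_map_contract (P := TopLCube R Q) Y.θ X.cubeForm _ _ _).symm.trans h1
  | zero =>
    convert Submodule.zero_mem (LinearMap.range Y.eval) using 1
    ext a : 1
    simp
  | add F G _ _ h h' =>
    convert Submodule.add_mem _ h h' using 1
    ext a : 1
    simp
  | smul r F _ h =>
    convert Submodule.smul_mem _ r h using 1
    ext a : 1
    simp

variable {M : Type w₁} [AddCommGroup M] [Module R M] (J : Realization R Q M)

include hR hQ in
theorem exists_eval_eq (m : M) : ∃ m', Y.eval m' = J.cubeMap m :=
  Y.mem_range_eval hR hQ (J.mem m)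

variable {p : Ideal R} [p.IsMaximal] (X : PreFrame (Q := Q) p)

theorem linearIndependent_localBasis {g : Fin 5 → R}
    (hg : ∑ i, g i • (J.localBasis hR hQ X).b i = 0) (i : Fin 5) : g i = 0 := by
  have := congrArg ((J.localBasis hR hQ X).κ i) hg
  simp only [map_sum, map_smul, LocalBasis.κ_b, map_zero] at this
  simpa [Realization.localBasis_r, X.ψ_ne_zero] using this

/-- The five lifts are independent because their images are, and the rank is five, so any sixth
vector depends on them. -/
theorem exists_smul_eq {b : Fin 5 → Y.M}
    (hb : ∀ i, Y.eval (b i) = J.cubeMap ((J.localBasis hR hQ X).b i)) (m : Y.M) :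
    ∃ c : R, c ≠ 0 ∧ ∃ g : Fin 5 → R, c • m = ∑ i, g i • b i := by
  have := Y.isLattice.finite
  have hdep : ¬ LinearIndependent R (Fin.cons m b : Fin 6 → Y.M) := fun h => by
    have := h.fintype_card_le_finrank
    rw [Y.isLattice.finrank_eq, Fintype.card_fin] at this
    omega
  rw [Fintype.not_linearIndependent_iff] at hdep
  obtain ⟨g, hg, i, hi⟩ := hdep
  rw [Fin.sum_univ_succ] at hg
  simp only [Fin.cons_zero, Fin.cons_succ] at hg
  refine ⟨g 0, fun h0 => hi ?_, fun i => -g i.succ, ?_⟩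
  · rw [h0, zero_smul, zero_add] at hg
    have h1 := congrArg Y.eval hg
    simp only [map_sum, map_smul, hb, map_zero] at h1
    have h2 : ∑ i : Fin 5, g i.succ • (J.localBasis hR hQ X).b i = 0 :=
      J.cubeMap_injective hR hQ (by simpa using h1)
    refine Fin.cases h0 (fun i => ?_) i
    exact linearIndependent_localBasis hR hQ J X h2 i
  · simp only [neg_smul, Finset.sum_neg_distrib]
    exact eq_neg_of_add_eq_zero_left hg

include hR hQ J in
-- A vector in the kernel has a nonzero multiple among combinations of the five lifts, on which the
-- map is injective.
theorem eval_injective : Function.Injective Y.eval := by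
  obtain ⟨p, hp⟩ := Ideal.exists_maximal R
  obtain ⟨X⟩ := hQ.nonempty_preFrame hR p
  choose b hb using fun i => Y.exists_eval_eq hR hQ J ((J.localBasis hR hQ X).b i)
  have := Y.isLattice.isTorsionFree
  rw [injective_iff_map_eq_zero]
  intro m hm
  obtain ⟨c, hc, g, hg⟩ := Y.exists_smul_eq hR hQ J X hb m
  have h1 := congrArg Y.eval hg
  simp only [map_sum, map_smul, hb, hm, smul_zero] at h1
  have h2 : ∑ i : Fin 5, g i • (J.localBasis hR hQ X).b i = 0 :=
    J.cubeMap_injective hR hQ (by simpa using h1.symm)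
  have h3 := linearIndependent_localBasis hR hQ J X h2
  simp only [h3, zero_smul, Finset.sum_const_zero] at hg
  exact (smul_eq_zero.1 hg).resolve_left hc

include hR hQ in
theorem eval_mem_range (m : Y.M) : Y.eval m ∈ LinearMap.range J.cubeMap := by
  refine mem_of_forall_maximal (M := TopL R Q × Q → TopLCube R Q) (LinearMap.range J.cubeMap) _ fun p hp => ?_
  obtain ⟨X⟩ := hQ.nonempty_preFrame hR p
  choose b hb using fun i => Y.exists_eval_eq hR hQ J ((J.localBasis hR hQ X).b i)
  obtain ⟨c, hc, g, hg⟩ := Y.exists_smul_eq hR hQ J X hb m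
  have htors := hQ.isTorsionFree_cube hR
  refine ⟨X.r ^ 2 * X.ψ, fun h => ?_, ?_⟩
  · rcases hp.isPrime.mem_or_mem h with h | h
    · exact X.r_notMem (hp.isPrime.mem_of_pow_mem _ h)
    · exact X.ψ_notMem h
  have h1 := congrArg Y.eval hg
  simp only [map_sum, map_smul, hb] at h1
  -- The denominator `c` may lie in `p`. Applying the functionals to `eval m` itself gives elements
  -- of `R` that equal `r² ψ gᵢ / c`, so `c` divides out.
  let γ (i : Fin 5) : R := X.ev i fun z => X.cubeForm (Y.eval m (X.D, z))
  have hγ (i : Fin 5) : c * γ i = X.r ^ 2 * X.ψ * g i := by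
    have h2 : c • (fun z => X.cubeForm (Y.eval m (X.D, z))) = X.r ^ 2 • ∑ k, g k • X.S k := by
      ext z
      have h3 := congrArg X.cubeForm (congrFun h1 (X.D, z))
      rw [Pi.smul_apply, map_smul, Finset.sum_apply, map_sum] at h3
      rw [Pi.smul_apply, h3, Pi.smul_apply, Finset.sum_apply, Finset.smul_sum]
      refine Finset.sum_congr rfl fun k _ => ?_
      rw [Pi.smul_apply, map_smul, Pi.smul_apply]
      change g k * X.cubeForm (X.D ⊗ₜ[R] (X.D ⊗ₜ[R] J.toFun _ z)) = X.r ^ 2 * (g k * X.S k z)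
      rw [X.cubeForm_tmul, X.δ_D, Realization.toFun_localBasis, PreFrame.S]
      ring
    have h4 := congrArg (X.ev i) h2
    rw [map_smul, map_smul, map_sum] at h4
    simp only [map_smul, X.ev_S, smul_eq_mul, mul_ite, mul_zero, Finset.sum_ite_eq',
      Finset.mem_univ, if_true] at h4
    rw [h4]
    ring
  refine ⟨∑ i, γ i • (J.localBasis hR hQ X).b i, ?_⟩
  ext a : 1
  refine smul_right_injective _ hc ?_
  have h5 : c • J.cubeMap (∑ i, γ i • (J.localBasis hR hQ X).b i) =
      c • Y.eval ((X.r ^ 2 * X.ψ) • m) := by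
    rw [map_smul Y.eval, smul_comm c, h1, map_sum, Finset.smul_sum, Finset.smul_sum]
    simp only [map_smul, smul_smul, hγ]
  rw [map_smul Y.eval] at h5
  exact congrFun h5 a

include hR hQ in
theorem exists_equiv : ∃ f : M ≃ₗ[R] Y.M, ∀ m, Y.eval (f m) = J.cubeMap m := by
  have hr : LinearMap.range J.cubeMap = LinearMap.range Y.eval := by
    apply le_antisymm
    · rintro _ ⟨m, rfl⟩
      exact Y.exists_eval_eq hR hQ J m
    · rintro _ ⟨m, rfl⟩
      exact Y.eval_mem_range hR hQ J m
  let e₁ := LinearEquiv.ofInjective _ (J.cubeMap_injective hR hQ)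
  let e₂ := LinearEquiv.ofInjective _ (Y.eval_injective hR hQ J)
  refine ⟨e₁.trans ((LinearEquiv.ofEq _ _ hr).trans e₂.symm), fun m => ?_⟩
  have h : e₂ (e₂.symm (LinearEquiv.ofEq _ _ hr (e₁ m))) = LinearEquiv.ofEq _ _ hr (e₁ m) :=
    e₂.apply_symm_apply _
  exact congrArg Subtype.val h

include hR hQ in
-- Transporting the realization to `Y.M` gives the condition on `θ` by construction of the
-- isomorphism; the identity for `Y` then gives the condition on `φ`, and both maps are determined
-- by their conditions.
theorem isIsomorphic_of_isPhi (X : Resolvent.{u, v, w₁} R Q) (J : Realization R Q X.M)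
    (hφ : J.IsPhi X.φ 1) (hθ : J.IsTheta X.φ X.θ 1) : X.IsIsomorphic Y := by
  obtain ⟨f, hf⟩ := Y.exists_equiv hR hQ J
  let J' : Realization R Q Y.M := ⟨J.toFun ∘ₗ f.symm.toLinearMap, J.injective.comp f.symm.injective,
    by rw [LinearMap.range_comp_of_range_eq_top _ (LinearEquiv.range _), J.range_eq]⟩
  have hJ' (y : Q) (m : X.M) : J'.evalAt y (f m) = J.evalAt y m := by
    change J.toFun (f.symm (f m)) y = _
    rw [f.symm_apply_apply]
    rfl
  have hθ' : J'.IsTheta Y.φ Y.θ 1 := fun l y m => by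
    obtain ⟨m, rfl⟩ := f.surjective m
    rw [← eval_apply, hf, hJ', one_smul]
    rfl
  have hφ' : J'.IsPhi Y.φ 1 := hθ'.isPhi hR hQ Y.identity
  have hmap : exteriorPower.map 2 f.toLinearMap ∘ₗ X.φ = Y.φ := by
    refine Realization.IsPhi.eq hR hQ (J := J') (r := 1) (fun l x y z => ?_) hφ'
    have h (y : Q) : J'.evalAt y ∘ₗ f.toLinearMap = J.evalAt y := LinearMap.ext (hJ' y)
    rw [LinearMap.comp_apply, pairForm_map, h, h, hφ]
  refine ⟨f, hmap, ?_⟩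
  refine hφ.theta_ext hR hQ (N := TopLCube R Q) fun l y m => ?_
  have hmap' := LinearMap.congr_fun hmap (l ⊗ₜ quotMk R y)
  rw [LinearMap.comp_apply] at hmap'
  rw [LinearMap.comp_apply, map_wedgeVec, map_square, hmap', hθ, one_smul, ← hJ']
  exact (hθ' l y (f m)).trans (one_smul _ _)

end Resolvent

end Uniqueness

end

end QuinticResolvent

end

theorem theorem3 {R : Type u} [CommRing R] [IsDedekindDomain R] (hR : ¬ IsField R)
    {Q : Type v} [CommRing Q] [Algebra R Q]
    (hQ : QuinticResolvent.IsMaximalQuinticRing R Q) :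
    ∃ X : QuinticResolvent.Resolvent.{u, v, u} R Q, X.IsNumerical ∧
      ∀ Y : QuinticResolvent.Resolvent.{u, v, w} R Q, X.IsIsomorphic Y := by
  obtain ⟨M, _, _, ⟨J⟩⟩ := QuinticResolvent.exists_realization hR hQ
  obtain ⟨φ, hφ⟩ := J.exists_isPhi hR hQ
  obtain ⟨θ, hθ⟩ := hφ.exists_isTheta hR hQ
  let X : QuinticResolvent.Resolvent.{u, v, u} R Q :=
    ⟨M, J.isLattice hR hQ, φ, θ, hφ.identity hR hQ hθ⟩
  exact ⟨X, hθ.bijective hR hQ hφ, fun Y => Y.isIsomorphic_of_isPhi hR hQ X J hφ hθ⟩
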